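/- **Setting.** Second-order Boolean logic has function variables $f$ of arities $r\ge 0$ (infinitely many of each arity; those of arity $0$ are called propositional), interpreted by Boolean functions $\{0,1\}^r\to\{0,1\}$. Terms are $f(t_1,\dots,t_r)$ with terms $t_i$; a literal is a term or a negated term, and $\neg\neg\ell$ is identified with $\ell$. Consider closed prenex formulae $$\phi = Q_1 f_1\cdots Q_m f_m\ \textstyle\bigwedge_k C_k,\qquad Q_i\in\{\exists,\forall\},$$ with distinct quantified variables. Such a formula is *true* if it holds under the usual semantics of quantification over Boolean functions. A *block* is a maximal run of equal quantifiers. The formula is *Krom* if every clause $C_k$ is a disjunction of one or two literals, *simple* if all arguments of functions are propositional variables, and has *uniqueness* if every function variable always occurs with the same arguments. It is *braided* if all arguments of every $g$ are quantified after $g$, and lie in the block of $g$ or the next one if $g$ is existential, and in the block of $g$ or one of the next two if $g$ is universal. The *braided $\Sigma_\omega^{\mathsf{usk}}$-formulae* are those which are braided, Krom, simple, and have uniqueness. **Implication graph.** The vertices are the terms occurring in $\phi$ and their negations. Every clause $\neg\ell_1\lor\ell_2$ gives the edge $\ell_1\to\ell_2$ (hence also $\neg\ell_2\to\neg\ell_1$),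 and a unit clause $\ell$ gives $\neg\ell\to\ell$. A vertex is universal (existential) if the head of its term is. Ignoring signs of literals, a vertex $v$ *depends on* $v'$, in symbols $v\rightsquigarrow v'$, if $v'$ is an argument of $v$, or $v'$ is quantified before $v$ and every argument $a$ of $v'$ is an argument of $v$, or is universal and quantified before $v$, or is existential and quantified before $v$ or in the same block as $v$. For strongly connected components $S,S'$ write $S\rightsquigarrow S'$ if some universal $u\in S$ depends on some $v\in S'$. **Theorem.** The truth problem of braided $\Sigma_\omega^{\mathsf{usk}}$-formulae, that is, the language of all encodings (with variable names written in binary) of true braided $\Sigma_\omega^{\mathsf{usk}}$-formulae, is in $\mathrm{NL}$. Moreover, a braided $\Sigma_\omega^{\mathsf{usk}}$-formula $\phi$ is true if and only if all of the following hold in its implication graph: 1. there is no path from a universal vertex to a different universal vertex; 2. no component contains a vertex $v$ together with $\neg v$; 3. every existential vertex $v$ in the same component as a universal vertex $u$ satisfies $v\rightsquigarrow u$; 4. there is no $\rightsquigarrow$-cycle (of any length $\ge 1$) among the components. -/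

import Mathlib

/-! ### Nondeterministic logarithmic space -/

namespace NLSpace

/-- Head movements. -/
inductive Move
  | left
  | stay
  | right

/-- What the input head can see: a letter of the input word or one of the two end markers. -/
inductive InSym (α : Type)
  | leftEnd
  | letter (a : α)
  | rightEnd

/-- A nondeterministic Turing machine with a read-only two-way input tape over the alphabet `α`
and finitely many read-write work tapes, each infinite to the right.  In one step it reads the
scanned input symbol and the scanned work symbols, changes its state, moves the input head, and on
every work tape writes a symbol and moves the head. -/
structure Machine (α : Type) where
  /-- states -/
  Q : Type
  finQ : Finite Q
  /-- work alphabet -/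
  Γ : Type
  finΓ : Finite Γ
  /-- number of work tapes -/
  tapes : ℕ
  blank : Γ
  start : Q
  accept : Set Q
  /-- `trans q a γ q' d act`: in state `q`, reading `a` on the input tape and `γ i` on the `i`-th
  work tape, the machine may go to state `q'`, move the input head by `d`, and on the `i`-th work
  tape write `(act i).1` and move by `(act i).2`. -/
  trans : Q → InSym α → (Fin tapes → Γ) → Q → Move → (Fin tapes → Γ × Move) → Prop

variable {α : Type}

/-- The symbol at position `p` of the input tape: the left end marker is at position `0`, the letters
of `w` are at positions `1, …, |w|`, the right end marker is at position `|w| + 1`. -/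
def inputAt (w : List α) : ℕ → InSym α
  | 0 => .leftEnd
  | p + 1 => match w[p]? with
    | some a => .letter a
    | none => .rightEnd

/-- Movement of a head on cells `0, 1, 2, …`; it cannot move left of cell `0`. -/
def Move.apply : Move → ℕ → ℕ
  | .left, p => p - 1
  | .stay, p => p
  | .right, p => p + 1

/-- A configuration (the input word is fixed and not part of it). -/
structure Config (M : Machine α) where
  state : M.Q
  inHead : ℕ
  tape : Fin M.tapes → ℕ → M.Γ
  head : Fin M.tapes → ℕ

/-- The initial configuration. -/
def Machine.init (M : Machine α) : Config M where
  state := M.start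
  inHead := 0
  tape := fun _ _ => M.blank
  head := fun _ => 0

/-- One computation step on the input `w`.  The input head never leaves the end markers. -/
def Machine.Step (M : Machine α) (w : List α) (c c' : Config M) : Prop :=
  ∃ (d : Move) (act : Fin M.tapes → M.Γ × Move),
    M.trans c.state (inputAt w c.inHead) (fun i => c.tape i (c.head i)) c'.state d act ∧
    c'.inHead = min (d.apply c.inHead) (w.length + 1) ∧
    (∀ i, c'.tape i = Function.update (c.tape i) (c.head i) (act i).1) ∧
    (∀ i, c'.head i = (act i).2.apply (c.head i))

/-- The configuration `c` occurs in some computation on the input `w`. -/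
def Machine.Reaches (M : Machine α) (w : List α) (c : Config M) : Prop :=
  Relation.ReflTransGen (M.Step w) M.init c

/-- Some computation on `w` arrives at an accepting state. -/
def Machine.Accepts (M : Machine α) (w : List α) : Prop :=
  ∃ c, M.Reaches w c ∧ c.state ∈ M.accept

/-- On every input of length `n`, all computations use only `O(log n)` cells of the work tapes. -/
def Machine.LogSpace (M : Machine α) : Prop :=
  ∃ k : ℕ, ∀ (w : List α) (c : Config M), M.Reaches w c →
    ∀ i, c.head i < k * (Nat.log 2 w.length + 1)

/-- The complexity class `NL`. -/
def InNL [Finite α] (L : Language α) : Prop :=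
  ∃ M : Machine α, M.LogSpace ∧ ∀ w : List α, w ∈ L ↔ M.Accepts w

end NLSpace

/-! ### Second-order Boolean logic -/

namespace SO2

/-- Function variables; there are infinitely many of every arity.  Those of arity `0` are the
propositional variables. -/
structure FVar where
  arity : ℕ
  idx : ℕ
  deriving DecidableEq

/-- Terms `f(t₁, …, tₙ)`, where `n` is the arity of `f`; propositional variables for `n = 0`. -/
inductive Term
  | app (f : FVar) (args : Fin f.arity → Term)

/-- Interpretations of all function variables. -/
abbrev Interp : Type := (f : FVar) → (Fin f.arity → Bool) → Bool

namespace Term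

def head : Term → FVar
  | app f _ => f

/-- The set of arguments `t₁, …, tₙ` of `f(t₁, …, tₙ)`. -/
def args : Term → Set Term
  | app _ a => Set.range a

/-- The set of all terms occurring in a term, including the term itself. -/
def subterms : Term → Set Term
  | app f a => {app f a} ∪ ⋃ i, (a i).subterms

def eval (I : Interp) : Term → Bool
  | app f a => I f (fun i => (a i).eval I)

end Term

/-- A literal: the term `atom` if `pos = true`, and its negation if `pos = false`. -/
structure Literal where
  pos : Bool
  atom : Term

/-- The complementary literal; `¬¬ℓ` is identified with `ℓ`. -/
def Literal.neg (l : Literal) : Literal := ⟨!l.pos, l.atom⟩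

def Literal.Holds (I : Interp) (l : Literal) : Prop := l.atom.eval I = l.pos

inductive Quant
  | ex
  | all
  deriving DecidableEq

/-- A prenex formula in conjunctive normal form: a quantifier prefix, outermost quantifier first,
and a conjunction of disjunctions of literals. -/
structure PrenexCNF where
  quants : List (Quant × FVar)
  clauses : List (List Literal)

def ClausesHold (cs : List (List Literal)) (I : Interp) : Prop :=
  ∀ C ∈ cs, ∃ l ∈ C, l.Holds I

/-- Truth of a prenex formula under an interpretation. -/
def Sat (cs : List (List Literal)) : List (Quant × FVar) → Interp → Prop
  | [], I => ClausesHold cs I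
  | (.ex, f) :: p, I => ∃ F : (Fin f.arity → Bool) → Bool, Sat cs p (Function.update I f F)
  | (.all, f) :: p, I => ∀ F : (Fin f.arity → Bool) → Bool, Sat cs p (Function.update I f F)

namespace PrenexCNF

variable (φ : PrenexCNF)

/-- A formula is true if it holds under all interpretations. -/
def IsTrue : Prop := ∀ I : Interp, Sat φ.clauses φ.quants I

/-- The set of all terms occurring in the formula, including those nested inside other terms. -/
def terms : Set Term := {t | ∃ C ∈ φ.clauses, ∃ l ∈ C, t ∈ l.atom.subterms}

/-! #### The quantifier prefix -/

/-- The number of quantifier alternations up to the position `i` of the prefix.  Two positions are in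
the same block, i.e. in the same maximal run of equal quantifiers, iff these numbers agree;
consecutive blocks have consecutive numbers. -/
def block (i : ℕ) : ℕ :=
  ((Finset.range i).filter fun j =>
    (φ.quants[j]?).map Prod.fst ≠ (φ.quants[j + 1]?).map Prod.fst).card

/-- The variable `f` is quantified at position `i` by the quantifier `q`. -/
def QuantAt (i : ℕ) (q : Quant) (f : FVar) : Prop := φ.quants[i]? = some (q, f)

def IsUniversal (f : FVar) : Prop := ∃ i, φ.QuantAt i .all f

def IsExistential (f : FVar) : Prop := ∃ i, φ.QuantAt i .ex f

/-- `f` is quantified before `g`. -/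
def Before (f g : FVar) : Prop :=
  ∃ i j q q', φ.QuantAt i q f ∧ φ.QuantAt j q' g ∧ i < j

/-- `f` and `g` are quantified in the same block. -/
def SameBlock (f g : FVar) : Prop :=
  ∃ i j q q', φ.QuantAt i q f ∧ φ.QuantAt j q' g ∧ φ.block i = φ.block j

/-! #### Syntactic classes -/

/-- All quantified variables are distinct. -/
def DistinctQuants : Prop := (φ.quants.map Prod.snd).Nodup

def Closed : Prop := ∀ t ∈ φ.terms, t.head ∈ φ.quants.map Prod.snd

/-- Every function variable always appears with the same arguments. -/
def Unique : Prop := ∀ s ∈ φ.terms, ∀ t ∈ φ.terms, s.head = t.head → s = t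

/-- Functions have only propositions as arguments. -/
def Simple : Prop := ∀ t ∈ φ.terms, ∀ a ∈ t.args, a.head.arity = 0

/-- Every clause consists of one or two literals. -/
def Krom : Prop := ∀ C ∈ φ.clauses, C ≠ [] ∧ C.length ≤ 2

/-- The arguments of every function variable `g` are quantified after `g`, in the block of `g` or the
next block if `g` is existential, and in the block of `g` or one of the next two blocks if `g` is
universal. -/
def Braided : Prop :=
  ∀ t ∈ φ.terms, ∀ a ∈ t.args, ∀ i j q q', φ.QuantAt i q t.head → φ.QuantAt j q' a.head →
    i < j ∧ φ.block j ≤ φ.block i + (match q with | .ex => 1 | .all => 2)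

/-- Closed braided prenex Krom formulae that are simple and have uniqueness. -/
structure BraidedUSK : Prop where
  distinct : φ.DistinctQuants
  closed : φ.Closed
  unique : φ.Unique
  simple : φ.Simple
  krom : φ.Krom
  braided : φ.Braided

/-! #### The implication graph and the truth criterion -/

/-- The vertices of the implication graph: the terms of the formula and their negations. -/
def vertices : Set Literal := {l | l.atom ∈ φ.terms}

/-- The edges of the implication graph: there is an edge from `l₁` to `l₂` if the formula has the
clause `¬l₁ ∨ l₂` (in either order), or the unit clause `l₂`, read as `¬l₂ → l₂`, and `l₁ = ¬l₂`. -/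
def Edge (l₁ l₂ : Literal) : Prop :=
  [l₁.neg, l₂] ∈ φ.clauses ∨ [l₂, l₁.neg] ∈ φ.clauses ∨ ([l₂] ∈ φ.clauses ∧ l₁ = l₂.neg)

def Path (l₁ l₂ : Literal) : Prop := Relation.ReflTransGen φ.Edge l₁ l₂

/-- The strongly connected component of a literal. -/
def component (l : Literal) : Set Literal :=
  {l' | φ.Path l l' ∧ φ.Path l' l}

/-- The strongly connected components of the implication graph. -/
def IsComponent (S : Set Literal) : Prop := ∃ l ∈ φ.vertices, S = φ.component l

/-- The literal `v` depends on the literal `v'` (the signs of the literals do not matter). -/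
def DependsOn (v v' : Literal) : Prop :=
  v'.atom ∈ v.atom.args ∨
  (φ.Before v'.atom.head v.atom.head ∧
    ∀ a ∈ v'.atom.args, a ∈ v.atom.args ∨
      (φ.IsUniversal a.head ∧ φ.Before a.head v.atom.head) ∨
      (φ.IsExistential a.head ∧
        (φ.Before a.head v.atom.head ∨ φ.SameBlock a.head v.atom.head)))

/-- The dependency relation between components. -/
def ComponentDependsOn (S S' : Set Literal) : Prop :=
  φ.IsComponent S ∧ φ.IsComponent S' ∧
    ∃ u ∈ S, ∃ v ∈ S', φ.IsUniversal u.atom.head ∧ φ.DependsOn u v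

/-- The four conditions on the implication graph. -/
structure GraphCondition : Prop where
  /-- There is no path from a universal vertex to another one. -/
  noUniversalPath : ∀ u ∈ φ.vertices, ∀ u' ∈ φ.vertices,
    φ.IsUniversal u.atom.head → φ.IsUniversal u'.atom.head → u ≠ u' → ¬ φ.Path u u'
  /-- No component contains complementary literals. -/
  noContradiction : ∀ S, φ.IsComponent S → ∀ v ∈ S, v.neg ∉ S
  /-- An existential vertex depends on the universal vertices of its component. -/
  properDependency : ∀ S, φ.IsComponent S → ∀ u ∈ S, ∀ v ∈ S,
    φ.IsUniversal u.atom.head → φ.IsExistential v.atom.head → φ.DependsOn v u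
  /-- There is no dependency cycle among the components (cycles of length one included). -/
  noCycle : ∀ S, ¬ Relation.TransGen φ.ComponentDependsOn S S

end PrenexCNF

/-! ### The truth problem as a formal language -/

/-- The alphabet in which formulae are written. -/
inductive Sym
  | zero
  | one
  | sep
  | lpar
  | rpar
  | neg
  | clause
  | ex
  | all
  deriving DecidableEq

instance : Fintype Sym :=
  ⟨{.zero, .one, .sep, .lpar, .rpar, .neg, .clause, .ex, .all}, fun x => by cases x <;> decide⟩

/-- Binary notation, least significant bit first, without superfluous zeros. -/
def encodeNat (n : ℕ) : List Sym := n.bits.map fun b => if b then .one else .zero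

/-- A variable is written as its index and its arity in binary. -/
def encodeFVar (f : FVar) : List Sym := encodeNat f.idx ++ .sep :: encodeNat f.arity

/-- A term is written as its head followed by the parenthesized list of its arguments. -/
def Term.encode : Term → List Sym
  | app f a => encodeFVar f ++ .lpar :: (List.ofFn fun i => (a i).encode).flatten ++ [.rpar]

def Literal.encode (l : Literal) : List Sym :=
  if l.pos then l.atom.encode else .neg :: l.atom.encode

def encodeClause (C : List Literal) : List Sym := .clause :: C.flatMap Literal.encode

def encodeQuant (p : Quant × FVar) : List Sym :=
  (match p.1 with | .ex => .ex | .all => .all) :: encodeFVar p.2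

def PrenexCNF.encode (φ : PrenexCNF) : List Sym :=
  φ.quants.flatMap encodeQuant ++ φ.clauses.flatMap encodeClause

/-- The truth problem of braided `Σ_ω`-Krom formulae with uniqueness and simpleness: the set of the
encodings of the true ones. -/
def truthBraidedUSK : Language Sym :=
  {w | ∃ φ : PrenexCNF, φ.BraidedUSK ∧ φ.IsTrue ∧ φ.encode = w}

end SO2

/-! Truth of a prenex formula is a game in which functions are chosen in the order of the prefix,
and wherever the clauses hold, truth is preserved along the edges of the implication graph.

Necessity of the criterion. In a true formula every strategy for the universal variables has a run
in which the clauses hold (`IsTrue.exists_run`), so each violated condition is refuted by a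
strategy. Against a path between universal vertices, constants make its source true and its target
false. Contradictory literals in one component fail under every interpretation. If an existential
`v` shares a component with a universal `u` on which it does not depend, then either `u` itself or a
universal argument of `u` that is quantified after `v` is chosen against the value of `v`
(`exists_run_diagonal`); braidedness excludes the remaining case, an existential argument of `u` in
a block after that of `v`. On a dependency cycle every universal term copies the next one, except
for a single term that negates it: a liar paradox (`no_cycle_of_isTrue`).

Sufficiency. A component has at most one universal vertex, and this vertex dictates the value of its
whole component. The vertices in components without a universal one receive a constant assignment as
in 2-SAT, chosen so that it includes everything implied by universal vertices (`exists_assignment`).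
Since dependency is acyclic, the value of every term can then be defined by recursion
(`exists_valuation`). Proper dependency says that an existential function sees enough to compute the
value of its component, which yields Skolem functions (`skolem`, `eval_skolem`).

Complexity. Instead of programming a Turing machine for the criterion, the proof sets up a calculus.
A `System` has words of logarithmic length as configurations, and its steps are regular relations
that may consult one input letter. The predicates recognized in this way (`Rec`) are closed under
conjunction, disjunction, projection and transitive closure, essentially by running systems one
after the other, and under complement by the inductive counting of Immerman and Szelepcsényi
(`Rec.not`). Such systems are simulated by machines that sweep over a single work tape (`Rec.inNL`).
On top of this, `Dfn` speaks of relations between objects represented by short words. Terms,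
literals and variables are represented as infixes of the input, that is, by a position and a length.
As the terms of a simple formula are not nested more than once, parsing needs no stack, and syntax,
reachability in the implication graph and finally all four conditions are definable. -/

namespace NLSpace

/-! ### Regular predicates on words -/

/-- A predicate on words over `Γ` of arbitrary length that is decided by a finite automaton. -/
def Rgl {Γ : Type} (P : ∀ L : ℕ, (Fin L → Γ) → Prop) : Prop :=
  ∃ (σ : Type) (_ : Finite σ) (M : DFA Γ σ), ∀ L u, P L u ↔ M.eval (List.ofFn u) ∈ M.accept

namespace Rgl

variable {Γ Γ' : Type}

theorem congr {P Q : ∀ L : ℕ, (Fin L → Γ) → Prop} (h : Rgl P) (hPQ : ∀ L u, P L u ↔ Q L u) :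
    Rgl Q := by
  obtain ⟨σ, hσ, M, hM⟩ := h
  exact ⟨σ, hσ, M, fun L u => (hPQ L u).symm.trans (hM L u)⟩

theorem not {P : ∀ L : ℕ, (Fin L → Γ) → Prop} (h : Rgl P) : Rgl fun L u => ¬ P L u := by
  obtain ⟨σ, hσ, M, hM⟩ := h
  exact ⟨σ, hσ, ⟨M.step, M.start, M.acceptᶜ⟩, fun L u => not_congr (hM L u)⟩

theorem and {P Q : ∀ L : ℕ, (Fin L → Γ) → Prop} (hP : Rgl P) (hQ : Rgl Q) :
    Rgl fun L u => P L u ∧ Q L u := by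
  obtain ⟨σ, hσ, M, hM⟩ := hP
  obtain ⟨τ, hτ, N, hN⟩ := hQ
  refine ⟨σ × τ, inferInstance, ⟨fun s a => (M.step s.1 a, N.step s.2 a), (M.start, N.start),
    {s | s.1 ∈ M.accept ∧ s.2 ∈ N.accept}⟩, fun L u => ?_⟩
  have key : ∀ (l : List Γ) (s : σ × τ),
      l.foldl (fun s a => (M.step s.1 a, N.step s.2 a)) s
        = (l.foldl M.step s.1, l.foldl N.step s.2) := by
    intro l
    induction l with
    | nil => intro s; rfl
    | cons a l ih => intro s; simp [ih]
  beta_reduce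
  rw [hM, hN]
  simp only [DFA.eval, DFA.evalFrom, key]
  rfl

theorem or {P Q : ∀ L : ℕ, (Fin L → Γ) → Prop} (hP : Rgl P) (hQ : Rgl Q) :
    Rgl fun L u => P L u ∨ Q L u :=
  (hP.not.and hQ.not).not.congr fun L u => by tauto

theorem comp {P : ∀ L : ℕ, (Fin L → Γ) → Prop} (hP : Rgl P) (f : Γ' → Γ) :
    Rgl fun L u => P L (fun i => f (u i)) := by
  obtain ⟨σ, hσ, M, hM⟩ := hP
  refine ⟨σ, hσ, M.comap f, fun L u => ?_⟩
  beta_reduce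
  rw [hM, DFA.eval_comap, List.map_ofFn]
  rfl

theorem all (q : Γ → Prop) : Rgl fun L (u : Fin L → Γ) => ∀ i, q (u i) := by
  classical
  refine ⟨Bool, inferInstance, ⟨fun s a => s && decide (q a), true, {true}⟩, fun L u => ?_⟩
  have key : ∀ (l : List Γ) (s : Bool),
      l.foldl (fun s a => s && decide (q a)) s = true ↔ s = true ∧ ∀ a ∈ l, q a := by
    intro l
    induction l with
    | nil => intro s; simp
    | cons a l ih => intro s; simp [ih, and_assoc]
  simp [DFA.eval, DFA.evalFrom, key]

theorem const (p : Prop) : Rgl fun L (_ : Fin L → Γ) => p := by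
  refine ⟨Unit, inferInstance, ⟨fun s _ => s, (), {_s | p}⟩, fun L u => ?_⟩
  simp

/-- A finite family of regular predicates is decided by a single automaton up to the choice of the
accepting states. -/
theorem exists_uniform {ι : Type} [Finite ι] {P : ι → ∀ L : ℕ, (Fin L → Γ) → Prop}
    (h : ∀ i, Rgl (P i)) : ∃ (σ : Type) (_ : Finite σ) (step : σ → Γ → σ) (start : σ)
      (acc : ι → Set σ), ∀ i L u, P i L u ↔ (List.ofFn u).foldl step start ∈ acc i := by
  choose σ hσ M hM using h
  refine ⟨∀ i, σ i, Pi.finite, fun s a i => (M i).step (s i) a, fun i => (M i).start,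
    fun i => {s | s i ∈ (M i).accept}, fun i L u => ?_⟩
  have key : ∀ (l : List Γ) (s : ∀ i, σ i),
      l.foldl (fun s a i => (M i).step (s i) a) s i = l.foldl (M i).step (s i) := by
    intro l
    induction l with
    | nil => intro s; rfl
    | cons a l ih => intro s; simp [ih]
  rw [hM]
  simp only [Set.mem_ofPred_eq, key]
  rfl

end Rgl

/-! ### Numbers in positional notation -/

/-- The value of a number written in base `B`, least significant digit first. -/
def listVal {B : ℕ} (l : List (Fin B)) : ℕ := Nat.ofDigits B (l.map Fin.val)

/-- The value of a number written in base `B`, least significant digit first. -/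
def val {B L : ℕ} (u : Fin L → Fin B) : ℕ := listVal (List.ofFn u)

@[simp] theorem listVal_nil {B : ℕ} : listVal ([] : List (Fin B)) = 0 := rfl

@[simp] theorem listVal_cons {B : ℕ} (a : Fin B) (l : List (Fin B)) :
    listVal (a :: l) = a + B * listVal l := by
  simp [listVal, Nat.ofDigits_cons]

theorem listVal_lt {B : ℕ} (l : List (Fin B)) : listVal l < B ^ l.length := by
  induction l with
  | nil => simp
  | cons a l ih =>
    rw [listVal_cons, List.length_cons, pow_succ]
    have := a.2
    nlinarith

theorem listVal_inj {B : ℕ} : ∀ {l l' : List (Fin B)}, l.length = l'.length →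
    listVal l = listVal l' → l = l'
  | [], [], _, _ => rfl
  | a :: l, b :: l', hl, h => by
    rw [listVal_cons, listVal_cons] at h
    have hB : 0 < B := a.pos
    have h1 : (a : ℕ) = b := by
      have := congrArg (· % B) h
      simpa [Nat.add_mul_mod_self_left, Nat.mod_eq_of_lt a.2, Nat.mod_eq_of_lt b.2] using this
    have h2 : listVal l = listVal l' := by
      rw [h1] at h
      exact Nat.eq_of_mul_eq_mul_left hB (by omega)
    rw [listVal_inj (by simpa using hl) h2, Fin.ext h1]

theorem val_lt {B L : ℕ} (u : Fin L → Fin B) : val u < B ^ L := by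
  simpa [val] using listVal_lt (List.ofFn u)

theorem val_injective {B L : ℕ} : Function.Injective (val : (Fin L → Fin B) → ℕ) := fun u v h =>
  List.ofFn_injective (listVal_inj (by simp) h)

/-- By counting: an injection between two sets with `B ^ L` elements is onto. -/
theorem exists_val_eq {B L n : ℕ} (h : n < B ^ L) : ∃ u : Fin L → Fin B, val u = n := by
  have hinj : Function.Injective (fun u : Fin L → Fin B => (⟨val u, val_lt u⟩ : Fin (B ^ L))) :=
    fun u v huv => val_injective (by simpa using huv)
  have hbij := (Fintype.bijective_iff_injective_and_card _).2 ⟨hinj, by simp⟩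
  obtain ⟨u, hu⟩ := hbij.2 ⟨n, h⟩
  exact ⟨u, by simpa using hu⟩

theorem listVal_eq_zero {B : ℕ} (hB : 0 < B) (l : List (Fin B)) :
    listVal l = 0 ↔ ∀ a ∈ l, (a : ℕ) = 0 := by
  induction l with
  | nil => simp
  | cons a l ih => simp [ih, hB.ne']

theorem val_eq_zero {B L : ℕ} (hB : 0 < B) (u : Fin L → Fin B) :
    val u = 0 ↔ ∀ i, (u i : ℕ) = 0 := by
  rw [val, listVal_eq_zero hB, List.forall_mem_ofFn_iff]

/-- The successor relation on numbers is regular. -/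
theorem Rgl.succ (B : ℕ) :
    Rgl fun L (u : Fin L → Fin B × Fin B) =>
      val (fun i => (u i).2) = val (fun i => (u i).1) + 1 := by
  classical
  -- states: carry, no carry, failure
  let step : Fin 3 → Fin B × Fin B → Fin 3 := fun s a =>
    if s = 0 then
      if (a.1 : ℕ) + 1 = B ∧ (a.2 : ℕ) = 0 then 0
      else if (a.2 : ℕ) = a.1 + 1 then 1 else 2
    else if s = 1 then if a.1 = a.2 then 1 else 2
    else 2
  refine ⟨Fin 3, inferInstance, ⟨step, 0, {1}⟩, fun L u => ?_⟩
  have h2 : ∀ l : List (Fin B × Fin B), l.foldl step 2 = 2 := by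
    intro l
    induction l with
    | nil => rfl
    | cons a l ih => simpa [step] using ih
  have h1 : ∀ l : List (Fin B × Fin B),
      l.foldl step 1 = 1 ↔ listVal (l.map Prod.snd) = listVal (l.map Prod.fst) := by
    intro l
    induction l with
    | nil => simp
    | cons a l ih =>
      rw [List.foldl_cons]
      by_cases h : a.1 = a.2
      · have : step 1 a = 1 := by simp [step, h]
        rw [this, ih]
        have hB : 0 < B := a.1.pos
        simp [h, hB.ne']
      · have : step 1 a = 2 := by simp [step, h]
        rw [this, h2]
        refine iff_of_false (by decide) fun h' => h ?_
        have := listVal_inj (by simp) h'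
        simp only [List.map_cons, List.cons.injEq] at this
        exact this.1.symm
  -- As the least significant digit comes first, the pending carry is all that has to be remembered.
  -- Ending in the carry state would be an overflow, hence only state `1` accepts.
  have h0 : ∀ l : List (Fin B × Fin B),
      l.foldl step 0 = 1 ↔ listVal (l.map Prod.snd) = listVal (l.map Prod.fst) + 1 := by
    intro l
    induction l with
    | nil => simp
    | cons a l ih =>
      rw [List.foldl_cons]
      have hB : 0 < B := a.1.pos
      have ha1 := a.1.2
      have ha2 := a.2.2
      simp only [List.map_cons, listVal_cons]
      by_cases h : (a.1 : ℕ) + 1 = B ∧ (a.2 : ℕ) = 0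
      · have : step 0 a = 0 := by simp [step, h]
        rw [this, ih, h.2]
        constructor
        · intro h'; rw [h', mul_add]; omega
        · intro h'
          have : B * listVal (l.map Prod.snd) = B * (listVal (l.map Prod.fst) + 1) := by
            rw [mul_add]; omega
          exact Nat.eq_of_mul_eq_mul_left hB this
      · by_cases h' : (a.2 : ℕ) = a.1 + 1
        · have : step 0 a = 1 := by simp only [step, if_neg h, if_pos h', if_true]
          rw [this, h1, h']
          constructor
          · intro e; rw [e]; omega
          · intro e; exact Nat.eq_of_mul_eq_mul_left hB (by omega)
        · have : step 0 a = 2 := by simp only [step, if_neg h, if_neg h', if_true]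
          rw [this, h2]
          refine iff_of_false (by decide) fun e => ?_
          have e' := congrArg (· % B) e
          simp only [Nat.add_mul_mod_self_left, Nat.mod_eq_of_lt ha2] at e'
          rw [add_right_comm, Nat.add_mul_mod_self_left] at e'
          by_cases hc : (a.1 : ℕ) + 1 = B
          · rw [hc, Nat.mod_self] at e'
            exact h ⟨hc, e'⟩
          · rw [Nat.mod_eq_of_lt (by omega)] at e'
            exact h' e'
  have := h0 (List.ofFn u)
  simp only [List.map_ofFn] at this
  exact this.symm

end NLSpace

/-! ### Predicates recognized by transition systems on words of logarithmic length -/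

namespace NLSpace

theorem reflTransGen_map {A B : Type*} {r : A → A → Prop} {p : B → B → Prop} (f : A → B)
    (h : ∀ a b, r a b → p (f a) (f b)) {a b : A} (hab : Relation.ReflTransGen r a b) :
    Relation.ReflTransGen p (f a) (f b) :=
  Relation.ReflTransGen.lift f h _ _ hab

/-! ### Regular transition systems -/

/-- The length of the words that encode the working memory on the input `w`. -/
def len {α : Type} (w : List α) : ℕ := w.length.size + 1

/-- The additional cell keeps working words nonempty even on the empty input. Conditions such as
"every letter carries the flag `true`" would otherwise hold vacuously, and flags could not separate
the phases of a computation. -/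
theorem len_pos {α : Type} (w : List α) : 0 < len w := Nat.succ_pos _

theorem length_lt_two_pow_len {α : Type} (w : List α) : 2 * w.length + 1 < 2 ^ len w := by
  have := Nat.lt_size_self w.length
  rw [len, pow_succ]
  omega

/-- A nondeterministic transition system whose configurations are words over `Δ` of length `len w`,
and whose steps are regular relations that may depend on one letter of the input word `w`, namely on
the one at the position which the current configuration holds in binary. -/
structure System (α Γ : Type) where
  Δ : Type
  finΔ : Finite Δ
  nonemptyΔ : Nonempty Δ
  π : Δ → Γ
  pos : Δ → Fin 2
  I : ∀ L, (Fin L → Δ) → Prop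
  F : ∀ L, (Fin L → Δ) → Prop
  K : Option α → ∀ L, (Fin L → Δ × Δ) → Prop
  regI : Rgl I
  regF : Rgl F
  regK : ∀ a, Rgl (K a)

namespace System

variable {α Γ : Type} (S : System α Γ)

/-- A position behind the input yields `none`, so a system can also detect the end of the input. -/
def Step (w : List α) (x y : Fin (len w) → S.Δ) : Prop :=
  S.K (w[val fun i => S.pos (x i)]?) _ fun i => (x i, y i)

/-- Some computation with input `u` ends in a final configuration. -/
def Accepts (w : List α) (u : Fin (len w) → Γ) : Prop :=
  ∃ x y, (∀ i, S.π (x i) = u i) ∧ S.I _ x ∧ Relation.ReflTransGen (S.Step w) x y ∧ S.F _ y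

end System

/-- Predicates on words that are recognized by regular transition systems. -/
def Rec {α Γ : Type} (P : ∀ w : List α, (Fin (len w) → Γ) → Prop) : Prop :=
  ∃ S : System α Γ, ∀ w u, P w u ↔ S.Accepts w u

namespace Rec

open Relation

variable {α Γ Γ' : Type}

theorem congr {P Q : ∀ w : List α, (Fin (len w) → Γ) → Prop} (h : Rec P)
    (hPQ : ∀ w u, P w u ↔ Q w u) : Rec Q := by
  obtain ⟨S, hS⟩ := h
  exact ⟨S, fun w u => (hPQ w u).symm.trans (hS w u)⟩

/-- The flag separates initial from final words, so the only step, which checks `K`, cannot be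
skipped. -/
theorem base [Finite Γ] [Nonempty Γ] (pos : Γ → Fin 2) {K : Option α → ∀ L, (Fin L → Γ) → Prop}
    (hK : ∀ a, Rgl (K a)) :
    Rec fun w (u : Fin (len w) → Γ) => K (w[val fun i => pos (u i)]?) _ u := by
  refine ⟨⟨Γ × Bool, inferInstance, inferInstance, Prod.fst, fun d => pos d.1,
    fun L x => ∀ i, (x i).2 = false, fun L x => ∀ i, (x i).2 = true,
    fun a L x => (∀ i, (x i).1.2 = false ∧ (x i).2.2 = true) ∧ K a L fun i => (x i).1.1,
    Rgl.all fun d : Γ × Bool => d.2 = false, Rgl.all fun d : Γ × Bool => d.2 = true,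
    fun a => (Rgl.all fun d : (Γ × Bool) × (Γ × Bool) => d.1.2 = false ∧ d.2.2 = true).and
      ((hK a).comp fun d : (Γ × Bool) × (Γ × Bool) => d.1.1)⟩, fun w u => ?_⟩
  constructor
  · intro h
    exact ⟨fun i => (u i, false), fun i => (u i, true), fun i => rfl, fun i => rfl,
      .single ⟨fun i => ⟨rfl, rfl⟩, h⟩, fun i => rfl⟩
  · rintro ⟨x, y, hu, hI, h, hF⟩
    rcases ReflTransGen.cases_head h with rfl | ⟨z, ⟨-, hz⟩, -⟩
    · have := (hI ⟨0, len_pos w⟩).symm.trans (hF ⟨0, len_pos w⟩)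
      simp at this
    · have : u = fun i => (x i).1 := (funext hu).symm
      subst this
      exact hz

/-- As `f` need not be injective, the letters of `u` are carried along on a second track. -/
theorem comp {P : ∀ w : List α, (Fin (len w) → Γ) → Prop} (h : Rec P) [Finite Γ'] [Nonempty Γ']
    (f : Γ' → Γ) : Rec fun w (u : Fin (len w) → Γ') => P w fun i => f (u i) := by
  obtain ⟨S, hS⟩ := h
  have := S.finΔ
  have := S.nonemptyΔ
  refine ⟨⟨S.Δ × Γ', inferInstance, inferInstance, Prod.snd, fun d => S.pos d.1,
    fun L x => (∀ i, S.π (x i).1 = f (x i).2) ∧ S.I L fun i => (x i).1, fun L x => S.F L fun i => (x i).1,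
    fun a L x => S.K a L fun i => ((x i).1.1, (x i).2.1),
    (Rgl.all fun d : S.Δ × Γ' => S.π d.1 = f d.2).and (S.regI.comp _), S.regF.comp _,
    fun a => (S.regK a).comp fun d : (S.Δ × Γ') × (S.Δ × Γ') => (d.1.1, d.2.1)⟩, fun w u => ?_⟩
  beta_reduce
  rw [hS]
  constructor
  · rintro ⟨x, y, hu, hI, h, hF⟩
    refine ⟨fun i => (x i, u i), fun i => (y i, u i), fun i => rfl, ⟨hu, hI⟩, ?_, hF⟩
    exact reflTransGen_map (fun (x : Fin (len w) → S.Δ) i => (x i, u i)) (fun a b h => h) h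
  · rintro ⟨x, y, hu, ⟨hx, hI⟩, h, hF⟩
    refine ⟨fun i => (x i).1, fun i => (y i).1, fun i => (hx i).trans (congrArg f (hu i)), hI, ?_, hF⟩
    exact reflTransGen_map (fun (x : Fin (len w) → S.Δ × Γ') i => (x i).1) (fun a b h => h) h

/-- The initial configuration is already chosen nondeterministically; hiding the second component of
its label turns that component into a guess. -/
theorem ex {P : ∀ w : List α, (Fin (len w) → Γ × Γ') → Prop} (h : Rec P) :
    Rec fun w (u : Fin (len w) → Γ) => ∃ v : Fin (len w) → Γ', P w fun i => (u i, v i) := by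
  obtain ⟨S, hS⟩ := h
  refine ⟨⟨S.Δ, S.finΔ, S.nonemptyΔ, fun d => (S.π d).1, S.pos, S.I, S.F, S.K, S.regI, S.regF,
    S.regK⟩, fun w u => ?_⟩
  constructor
  · rintro ⟨v, hv⟩
    obtain ⟨x, y, hu, h⟩ := (hS _ _).1 hv
    exact ⟨x, y, fun i => by simp [hu i], h⟩
  · rintro ⟨x, y, hu, h⟩
    exact ⟨fun i => (S.π (x i)).2, (hS _ _).2 ⟨x, y, fun i => by simp [← hu i], h⟩⟩

theorem and {P Q : ∀ w : List α, (Fin (len w) → Γ) → Prop} (hP : Rec P) (hQ : Rec Q) :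
    Rec fun w u => P w u ∧ Q w u := by
  obtain ⟨S, hS⟩ := hP
  obtain ⟨T, hT⟩ := hQ
  have := S.finΔ
  have := S.nonemptyΔ
  have := T.finΔ
  have := T.nonemptyΔ
  -- Both systems have a track of their own and run one after the other; the flag tells whose turn
  -- it is. The switching step need not test `S.F`: the first track stays frozen from then on, and
  -- finality of both tracks is tested at the end.
  let Δ := S.Δ × T.Δ × Bool
  let R : System α Γ := ⟨Δ, inferInstance, inferInstance, fun d => S.π d.1,
    fun d => bif d.2.2 then T.pos d.2.1 else S.pos d.1,
    fun L x => (∀ i, S.π (x i).1 = T.π (x i).2.1) ∧ (∀ i, (x i).2.2 = false) ∧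
      S.I L (fun i => (x i).1) ∧ T.I L (fun i => (x i).2.1),
    fun L x => S.F L (fun i => (x i).1) ∧ T.F L (fun i => (x i).2.1),
    fun a L x =>
      ((∀ i, (x i).1.2.2 = false ∧ (x i).2.2.2 = false ∧ (x i).1.2.1 = (x i).2.2.1) ∧
        S.K a L fun i => ((x i).1.1, (x i).2.1)) ∨
      (∀ i, (x i).1.1 = (x i).2.1 ∧ (x i).1.2.1 = (x i).2.2.1 ∧ (x i).2.2.2 = true) ∨
      ((∀ i, (x i).1.2.2 = true ∧ (x i).2.2.2 = true ∧ (x i).1.1 = (x i).2.1) ∧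
        T.K a L fun i => ((x i).1.2.1, (x i).2.2.1)),
    (Rgl.all fun d : Δ => S.π d.1 = T.π d.2.1).and ((Rgl.all fun d : Δ => d.2.2 = false).and
      ((S.regI.comp _).and (T.regI.comp fun d : Δ => d.2.1))),
    (S.regF.comp _).and (T.regF.comp fun d : Δ => d.2.1),
    fun a => ((Rgl.all fun d : Δ × Δ => d.1.2.2 = false ∧ d.2.2.2 = false ∧ d.1.2.1 = d.2.2.1).and
        ((S.regK a).comp fun d : Δ × Δ => (d.1.1, d.2.1))).or
      ((Rgl.all fun d : Δ × Δ => d.1.1 = d.2.1 ∧ d.1.2.1 = d.2.2.1 ∧ d.2.2.2 = true).or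
        ((Rgl.all fun d : Δ × Δ => d.1.2.2 = true ∧ d.2.2.2 = true ∧ d.1.1 = d.2.1).and
          ((T.regK a).comp fun d : Δ × Δ => (d.1.2.1, d.2.2.1))))⟩
  refine ⟨R, fun w u => ?_⟩
  beta_reduce
  rw [hS, hT]
  constructor
  · rintro ⟨⟨x, y, hu, hI, h, hF⟩, ⟨x', y', hu', hI', h', hF'⟩⟩
    refine ⟨fun i => (x i, x' i, false), fun i => (y i, y' i, true), hu,
      ⟨fun i => (hu i).trans (hu' i).symm, fun i => rfl, hI, hI'⟩, ?_, hF, hF'⟩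
    refine (reflTransGen_map (r := S.Step w) (p := R.Step w)
      (fun (x : Fin (len w) → S.Δ) i => (x i, x' i, false)) (fun a b h => ?_) h).trans
      (.head (b := fun i => (y i, x' i, true)) ?_ (reflTransGen_map (r := T.Step w) (p := R.Step w)
        (fun (x : Fin (len w) → T.Δ) i => (y i, x i, true)) (fun a b h => ?_) h'))
    · exact Or.inl ⟨fun i => ⟨rfl, rfl, rfl⟩, h⟩
    · exact Or.inr (Or.inl fun i => ⟨rfl, rfl, rfl⟩)
    · exact Or.inr (Or.inr ⟨fun i => ⟨rfl, rfl, rfl⟩, h⟩)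
  · rintro ⟨x, y, hu, ⟨hx, -, hI, hI'⟩, h, hF, hF'⟩
    have key : ReflTransGen (S.Step w) (fun i => (x i).1) (fun i => (y i).1) ∧
        ReflTransGen (T.Step w) (fun i => (x i).2.1) (fun i => (y i).2.1) := by
      clear hF hF'
      induction h with
      | refl => exact ⟨.refl, .refl⟩
      | @tail y z _ hyz ih =>
        rcases hyz with ⟨h1, h2⟩ | h1 | ⟨h1, h2⟩
        · refine ⟨ih.1.tail ?_, ?_⟩
          · have : (fun i => R.pos (y i)) = fun i => S.pos (y i).1 := by
              funext i; have e : (y i).2.2 = false := (h1 i).1; simp [R, e]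
            rw [this] at h2
            exact h2
          · have : (fun i => (z i).2.1) = fun i => (y i).2.1 := funext fun i => (h1 i).2.2.symm
            rw [this]; exact ih.2
        · have e1 : (fun i => (z i).1) = fun i => (y i).1 := funext fun i => (h1 i).1.symm
          have e2 : (fun i => (z i).2.1) = fun i => (y i).2.1 := funext fun i => (h1 i).2.1.symm
          rw [e1, e2]; exact ih
        · refine ⟨?_, ih.2.tail ?_⟩
          · have : (fun i => (z i).1) = fun i => (y i).1 := funext fun i => (h1 i).2.2.symm
            rw [this]; exact ih.1
          · have : (fun i => R.pos (y i)) = fun i => T.pos (y i).2.1 := by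
              funext i; have e : (y i).2.2 = true := (h1 i).1; simp [R, e]
            rw [this] at h2
            exact h2
    exact ⟨⟨_, _, hu, hI, key.1, hF⟩, ⟨_, _, fun i => (hx i).symm.trans (hu i), hI', key.2, hF'⟩⟩

theorem or {P Q : ∀ w : List α, (Fin (len w) → Γ) → Prop} (hP : Rec P) (hQ : Rec Q) :
    Rec fun w u => P w u ∨ Q w u := by
  obtain ⟨S, hS⟩ := hP
  obtain ⟨T, hT⟩ := hQ
  have := S.finΔ
  have := S.nonemptyΔ
  have := T.finΔ
  have := T.nonemptyΔ
  -- Here the flag is guessed in the initial configuration and never changes.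
  let Δ := S.Δ × T.Δ × Bool
  let R : System α Γ := ⟨Δ, inferInstance, inferInstance,
    fun d => bif d.2.2 then T.π d.2.1 else S.π d.1,
    fun d => bif d.2.2 then T.pos d.2.1 else S.pos d.1,
    fun L x => ((∀ i, (x i).2.2 = false) ∧ S.I L (fun i => (x i).1)) ∨
      ((∀ i, (x i).2.2 = true) ∧ T.I L (fun i => (x i).2.1)),
    fun L x => ((∀ i, (x i).2.2 = false) ∧ S.F L (fun i => (x i).1)) ∨
      ((∀ i, (x i).2.2 = true) ∧ T.F L (fun i => (x i).2.1)),
    fun a L x =>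
      ((∀ i, (x i).1.2.2 = false ∧ (x i).2.2.2 = false) ∧ S.K a L fun i => ((x i).1.1, (x i).2.1)) ∨
      ((∀ i, (x i).1.2.2 = true ∧ (x i).2.2.2 = true) ∧
        T.K a L fun i => ((x i).1.2.1, (x i).2.2.1)),
    ((Rgl.all fun d : Δ => d.2.2 = false).and (S.regI.comp _)).or
      ((Rgl.all fun d : Δ => d.2.2 = true).and (T.regI.comp fun d : Δ => d.2.1)),
    ((Rgl.all fun d : Δ => d.2.2 = false).and (S.regF.comp _)).or
      ((Rgl.all fun d : Δ => d.2.2 = true).and (T.regF.comp fun d : Δ => d.2.1)),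
    fun a => ((Rgl.all fun d : Δ × Δ => d.1.2.2 = false ∧ d.2.2.2 = false).and
        ((S.regK a).comp fun d : Δ × Δ => (d.1.1, d.2.1))).or
      ((Rgl.all fun d : Δ × Δ => d.1.2.2 = true ∧ d.2.2.2 = true).and
        ((T.regK a).comp fun d : Δ × Δ => (d.1.2.1, d.2.2.1)))⟩
  refine ⟨R, fun w u => ?_⟩
  beta_reduce
  rw [hS, hT]
  constructor
  · rintro (⟨x, y, hu, hI, h, hF⟩ | ⟨x, y, hu, hI, h, hF⟩)
    · obtain ⟨t⟩ := T.nonemptyΔ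
      refine ⟨fun i => (x i, t, false), fun i => (y i, t, false), hu, Or.inl ⟨fun i => rfl, hI⟩, ?_,
        Or.inl ⟨fun i => rfl, hF⟩⟩
      exact reflTransGen_map (r := S.Step w) (p := R.Step w)
        (fun (x : Fin (len w) → S.Δ) i => (x i, t, false))
        (fun a b h => Or.inl ⟨fun i => ⟨rfl, rfl⟩, h⟩) h
    · obtain ⟨s⟩ := S.nonemptyΔ
      refine ⟨fun i => (s, x i, true), fun i => (s, y i, true), hu, Or.inr ⟨fun i => rfl, hI⟩, ?_,
        Or.inr ⟨fun i => rfl, hF⟩⟩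
      exact reflTransGen_map (r := T.Step w) (p := R.Step w)
        (fun (x : Fin (len w) → T.Δ) i => (s, x i, true))
        (fun a b h => Or.inr ⟨fun i => ⟨rfl, rfl⟩, h⟩) h
  · rintro ⟨x, y, hu, hI, h, hF⟩
    have i0 : Fin (len w) := ⟨0, len_pos w⟩
    have key : ((∀ i, (x i).2.2 = false) ∧ (∀ i, (y i).2.2 = false) ∧
          ReflTransGen (S.Step w) (fun i => (x i).1) (fun i => (y i).1)) ∨
        ((∀ i, (x i).2.2 = true) ∧ (∀ i, (y i).2.2 = true) ∧
          ReflTransGen (T.Step w) (fun i => (x i).2.1) (fun i => (y i).2.1)) := by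
      clear hF
      induction h with
      | refl =>
        rcases hI with hI | hI
        · exact Or.inl ⟨hI.1, hI.1, .refl⟩
        · exact Or.inr ⟨hI.1, hI.1, .refl⟩
      | @tail y z _ hyz ih =>
        rcases hyz with ⟨h1, h2⟩ | ⟨h1, h2⟩
        · rcases ih with ⟨hx, hy, ih⟩ | ⟨hx, hy, ih⟩
          · refine Or.inl ⟨hx, fun i => (h1 i).2, ih.tail ?_⟩
            have : (fun i => R.pos (y i)) = fun i => S.pos (y i).1 := by
              funext i; have e : (y i).2.2 = false := (h1 i).1; simp [R, e]
            rw [this] at h2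
            exact h2
          · have := (hy i0).symm.trans (h1 i0).1
            simp at this
        · rcases ih with ⟨hx, hy, ih⟩ | ⟨hx, hy, ih⟩
          · have := (hy i0).symm.trans (h1 i0).1
            simp at this
          · refine Or.inr ⟨hx, fun i => (h1 i).2, ih.tail ?_⟩
            have : (fun i => R.pos (y i)) = fun i => T.pos (y i).2.1 := by
              funext i; have e : (y i).2.2 = true := (h1 i).1; simp [R, e]
            rw [this] at h2
            exact h2
    rcases key with ⟨hx, hy, h⟩ | ⟨hx, hy, h⟩
    · refine Or.inl ⟨_, _, fun i => ?_, ?_, h, ?_⟩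
      · rw [← hu i]; simp [R, hx i]
      · rcases hI with hI | hI
        · exact hI.2
        · have := (hI.1 i0).symm.trans (hx i0)
          simp at this
      · rcases hF with hF | hF
        · exact hF.2
        · have := (hF.1 i0).symm.trans (hy i0)
          simp at this
    · refine Or.inr ⟨_, _, fun i => ?_, ?_, h, ?_⟩
      · rw [← hu i]; simp [R, hx i]
      · rcases hI with hI | hI
        · have := (hI.1 i0).symm.trans (hx i0)
          simp at this
        · exact hI.2
      · rcases hF with hF | hF
        · have := (hF.1 i0).symm.trans (hy i0)
          simp at this
        · exact hF.2

/-- Transitive closure of a relation with a parameter. -/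
theorem transGen {P : ∀ w : List α, (Fin (len w) → Γ' × Γ × Γ) → Prop} (h : Rec P)
    [Finite Γ] [Nonempty Γ] [Finite Γ'] [Nonempty Γ'] :
    Rec fun w (u : Fin (len w) → Γ' × Γ × Γ) =>
      TransGen (fun a b : Fin (len w) → Γ => P w fun i => ((u i).1, a i, b i))
        (fun i => (u i).2.1) (fun i => (u i).2.2) := by
  obtain ⟨S, hS⟩ := h
  have := S.finΔ
  have := S.nonemptyΔ
  -- The tracks are a configuration of `S`, the triple that it is checking (parameter, source and
  -- target of the current edge), and the final target. Besides the steps of `S` there is a step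
  -- that closes a finished run: the old target becomes the source, a new target is guessed, and `S`
  -- is restarted.
  let Δ := S.Δ × (Γ' × Γ × Γ) × Γ
  let R : System α (Γ' × Γ × Γ) := ⟨Δ, inferInstance, inferInstance,
    fun d => (d.2.1.1, d.2.1.2.1, d.2.2), fun d => S.pos d.1,
    fun L x => (∀ i, S.π (x i).1 = (x i).2.1) ∧ S.I L (fun i => (x i).1),
    fun L x => (∀ i, (x i).2.1.2.2 = (x i).2.2) ∧ S.F L (fun i => (x i).1),
    fun a L x =>
      ((∀ i, (x i).1.2 = (x i).2.2) ∧ S.K a L fun i => ((x i).1.1, (x i).2.1)) ∨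
      ((∀ i, (x i).1.2.2 = (x i).2.2.2 ∧ (x i).1.2.1.1 = (x i).2.2.1.1 ∧
          (x i).1.2.1.2.2 = (x i).2.2.1.2.1 ∧ S.π (x i).2.1 = (x i).2.2.1) ∧
        S.F L (fun i => (x i).1.1) ∧ S.I L (fun i => (x i).2.1)),
    (Rgl.all fun d : Δ => S.π d.1 = d.2.1).and (S.regI.comp _),
    (Rgl.all fun d : Δ => d.2.1.2.2 = d.2.2).and (S.regF.comp _),
    fun a => ((Rgl.all fun d : Δ × Δ => d.1.2 = d.2.2).and
        ((S.regK a).comp fun d : Δ × Δ => (d.1.1, d.2.1))).or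
      ((Rgl.all fun d : Δ × Δ => d.1.2.2 = d.2.2.2 ∧ d.1.2.1.1 = d.2.2.1.1 ∧
          d.1.2.1.2.2 = d.2.2.1.2.1 ∧ S.π d.2.1 = d.2.2.1).and ((S.regF.comp fun d : Δ × Δ => d.1.1).and
        (S.regI.comp fun d : Δ × Δ => d.2.1)))⟩
  refine ⟨R, fun w u => ?_⟩
  constructor
  · intro h
    have lift : ∀ (a b t : Fin (len w) → Γ) {x y : Fin (len w) → S.Δ},
        ReflTransGen (S.Step w) x y → ReflTransGen (R.Step w)
          (fun i => (x i, ((u i).1, a i, b i), t i))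
          (fun i => (y i, ((u i).1, a i, b i), t i)) := by
      intro a b t x y h
      exact reflTransGen_map (r := S.Step w) (p := R.Step w)
        (fun (x : Fin (len w) → S.Δ) i => (x i, ((u i).1, a i, b i), t i))
        (fun _ _ h => Or.inl ⟨fun i => rfl, h⟩) h
    have key : ∀ a t : Fin (len w) → Γ,
        TransGen (fun a b : Fin (len w) → Γ => P w fun i => ((u i).1, a i, b i)) a t →
        R.Accepts w fun i => ((u i).1, a i, t i) := by
      intro a t h
      induction h using TransGen.head_induction_on with
      | @single a h =>
        obtain ⟨x, y, hu, hI, h, hF⟩ := (hS _ _).1 h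
        exact ⟨fun i => (x i, ((u i).1, a i, t i), t i), fun i => (y i, ((u i).1, a i, t i), t i),
          fun i => rfl, ⟨hu, hI⟩, lift _ _ _ h, fun i => rfl, hF⟩
      | @head a b h _ ih =>
        obtain ⟨x, y, hu, hI, h, hF⟩ := (hS _ _).1 h
        obtain ⟨x', y', hu', hI', h', hF'⟩ := ih
        refine ⟨fun i => (x i, ((u i).1, a i, b i), t i), y', fun i => rfl, ⟨hu, hI⟩,
          (lift _ _ _ h).trans (.head ?_ h'), hF'⟩
        refine Or.inr ⟨fun i => ?_, hF, hI'.2⟩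
        have e := hu' i
        simp only [R, Prod.mk.injEq] at e
        exact ⟨e.2.2.symm, e.1.symm, e.2.1.symm, hI'.1 i⟩
    exact key _ _ h
  · rintro ⟨x, y, hu, hI, h, hF⟩
    have hu' : u = fun i => ((x i).2.1.1, (x i).2.1.2.1, (x i).2.2) := (funext hu).symm
    subst hu'
    -- Invariant: the completed edges lead from the original source to the current one, and the
    -- current run of `S` started properly on the current edge.
    have key : (∀ i, (y i).2.1.1 = (x i).2.1.1) ∧ (∀ i, (y i).2.2 = (x i).2.2) ∧
        ReflTransGen (fun a b : Fin (len w) → Γ => P w fun i => ((x i).2.1.1, a i, b i))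
          (fun i => (x i).2.1.2.1) (fun i => (y i).2.1.2.1) ∧
        ∃ x0 : Fin (len w) → S.Δ, (∀ i, S.π (x0 i) = (y i).2.1) ∧ S.I _ x0 ∧
          ReflTransGen (S.Step w) x0 fun i => (y i).1 := by
      clear hF
      induction h with
      | refl => exact ⟨fun i => rfl, fun i => rfl, .refl, fun i => (x i).1, hI.1, hI.2, .refl⟩
      | @tail y z _ hyz ih =>
        obtain ⟨h1, h2, h3, x0, hx0, hI0, h4⟩ := ih
        rcases hyz with ⟨e, hK⟩ | ⟨e, hFy, hIz⟩
        · refine ⟨fun i => ?_, fun i => ?_, ?_, x0, fun i => ?_, hI0, h4.tail hK⟩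
          · rw [← h1 i, e i]
          · rw [← h2 i, e i]
          · have : (fun i => (z i).2.1.2.1) = fun i => (y i).2.1.2.1 := by
              funext i; rw [e i]
            rw [this]; exact h3
          · rw [hx0 i, e i]
        · refine ⟨fun i => ?_, fun i => ?_, h3.tail ?_, _, fun i => (e i).2.2.2, hIz, .refl⟩
          · rw [← h1 i, (e i).2.1]
          · rw [← h2 i, (e i).1]
          · rw [hS]
            refine ⟨x0, _, fun i => ?_, hI0, h4, hFy⟩
            rw [hx0 i]
            exact Prod.ext (h1 i) (Prod.ext rfl (e i).2.2.1)
    obtain ⟨h1, h2, h3, x0, hx0, hI0, h4⟩ := key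
    refine .tail' h3 ?_
    rw [hS]
    refine ⟨x0, _, fun i => ?_, hI0, h4, hF.2⟩
    rw [hx0 i]
    simp only [← h1 i, ← h2 i, ← hF.1 i]

end Rec

end NLSpace

/-! ### From transition systems to Turing machines -/

namespace NLSpace

open Relation

/-! ### Machines working in sweeps -/

/-- A nondeterministic machine that works in rounds.  In each round it runs a letter-to-letter
transducer over its working word, then reads the scanned input symbol, possibly appends a letter to
the working word, moves the input head, and chooses the state for the next round. -/
structure Sweeper (α : Type) where
  P : Type
  finP : Finite P
  Col : Type
  finCol : Finite Col
  start : P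
  accept : Set P
  trans : P → Col → P → Col → Prop
  finish : P → InSym α → Option Col → Move → P → Prop

namespace Sweeper

variable {α : Type} (S : Sweeper α)

/-- Runs of the transducer. -/
inductive Run : S.P → List S.Col → List S.Col → S.P → Prop
  | nil (p) : Run p [] [] p
  | snoc {p u v q c d r} : Run p u v q → S.trans q c r d → Run p (u ++ [c]) (v ++ [d]) r

@[elab_as_elim]
theorem Run.induct {S : Sweeper α} {p : S.P} {M : List S.Col → List S.Col → S.P → Prop}
    {u v : List S.Col} {q : S.P} (h : S.Run p u v q) (nil : M [] [] p)
    (snoc : ∀ u v q c d r, S.Run p u v q → S.trans q c r d → M u v q → M (u ++ [c]) (v ++ [d]) r) :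
    M u v q := by
  induction h with
  | nil => exact nil
  | snoc h ht ih => exact snoc _ _ _ _ _ _ h ht ih

theorem Run.length_eq {S : Sweeper α} {p u v q} (h : S.Run p u v q) : v.length = u.length := by
  induction h with
  | nil => rfl
  | snoc _ _ ih => simp [ih]

theorem Run.cons {S : Sweeper α} {p u v q c d p'} (hp : S.trans p' c p d) (h : S.Run p u v q) :
    S.Run p' (c :: u) (d :: v) q := by
  induction h with
  | nil => exact .snoc (.nil p') hp
  | snoc _ h ih => exact .snoc ih h

/-- A configuration at the beginning of a round. -/
structure Conf where
  state : S.P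
  word : List S.Col
  pos : ℕ

/-- One round on the input `w`. -/
def Round (w : List α) (c c' : S.Conf) : Prop :=
  ∃ q v app d, S.Run c.state c.word v q ∧ S.finish q (inputAt w c.pos) app d c'.state ∧
    c'.word = v ++ app.toList ∧ c'.pos = min (d.apply c.pos) (w.length + 1)

def Reaches (w : List α) (c : S.Conf) : Prop := ReflTransGen (S.Round w) ⟨S.start, [], 0⟩ c

/-- The work alphabet of the Turing machine: the left end marker, the blank, or a letter. -/
inductive TapeSym (C : Type)
  | marker
  | blank
  | col (c : C)

/-- The states of the Turing machine. -/
inductive State (P : Type)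
  | boot
  | sweep (p : P)
  | back (p : P)

instance {C : Type} [Finite C] : Finite (TapeSym C) :=
  Finite.of_injective (β := Option (Option C))
    (fun | .marker => none | .blank => some none | .col c => some (some c))
    (by rintro (_ | _ | _) (_ | _ | _) h <;> simp_all)

instance {P : Type} [Finite P] : Finite (State P) :=
  Finite.of_injective (β := Option (P ⊕ P))
    (fun | .boot => none | .sweep p => some (.inl p) | .back p => some (.inr p))
    (by rintro (_ | _ | _) (_ | _ | _) h <;> simp_all)

/-- This is also what the machine writes at the end of a sweep: if nothing is appended, the blank
behind the word is rewritten. -/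
def appendSym {C : Type} : Option C → TapeSym C
  | none => .blank
  | some c => .col c

/-- The transitions of the Turing machine. -/
inductive TMTrans : State S.P → InSym α → TapeSym S.Col → State S.P → Move → TapeSym S.Col × Move → Prop
  | boot (a) : TMTrans .boot a .blank (.sweep S.start) .stay (.marker, .right)
  | sweep {a p c q d} : S.trans p c q d →
      TMTrans (.sweep p) a (.col c) (.sweep q) .stay (.col d, .right)
  | finish {a q app d p} : S.finish q a app d p →
      TMTrans (.sweep q) a .blank (.back p) d (appendSym app, .left)
  | back (a p c) : TMTrans (.back p) a (.col c) (.back p) .stay (.col c, .left)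
  | turn (a p) : TMTrans (.back p) a .marker (.sweep p) .stay (.marker, .right)

/-- The Turing machine, with one work tape. -/
def toMachine : Machine α where
  Q := State S.P
  finQ := by have := S.finP; infer_instance
  Γ := TapeSym S.Col
  finΓ := by have := S.finCol; infer_instance
  tapes := 1
  blank := .blank
  start := .boot
  accept := {q | ∃ p ∈ S.accept, q = .sweep p}
  trans q a γ q' d act := S.TMTrans q a (γ 0) q' d (act 0)

/-- The tape holding the left end marker followed by the word `u`. -/
def tapeOf {C : Type} (u : List C) : ℕ → TapeSym C
  | 0 => .marker
  | n + 1 => appendSym u[n]?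

theorem tapeOf_append {C : Type} (u v : List C) (c : C) :
    tapeOf (u ++ c :: v) (u.length + 1) = .col c := by
  simp [tapeOf, appendSym]

theorem tapeOf_end {C : Type} (u : List C) : tapeOf u (u.length + 1) = .blank := by
  simp [tapeOf, appendSym]

theorem update_tapeOf {C : Type} (u v : List C) (c d : C) :
    Function.update (tapeOf (u ++ c :: v)) (u.length + 1) (.col d) = tapeOf (u ++ d :: v) := by
  funext n
  rcases n with _ | n
  · simp [tapeOf]
  · by_cases h : n = u.length
    · subst h; simp [tapeOf, appendSym]
    · rw [Function.update_of_ne (by simpa using h)]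
      simp only [tapeOf]
      congr 1
      rcases lt_or_gt_of_ne h with h | h
      · simp [List.getElem?_append_left h]
      · rw [List.getElem?_append_right (by omega), List.getElem?_append_right (by omega)]
        obtain ⟨k, rfl⟩ : ∃ k, n = u.length + k + 1 := ⟨n - u.length - 1, by omega⟩
        simp [show u.length + k + 1 - u.length = k + 1 by omega]

theorem update_tapeOf_end {C : Type} (u : List C) (app : Option C) :
    Function.update (tapeOf u) (u.length + 1) (appendSym app) = tapeOf (u ++ app.toList) := by
  funext n
  rcases n with _ | n
  · simp [tapeOf]
  · by_cases h : n = u.length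
    · subst h; cases app <;> simp [tapeOf, appendSym]
    · rw [Function.update_of_ne (by simpa using h)]
      simp only [tapeOf]
      congr 1
      rcases lt_or_gt_of_ne h with h | h
      · simp [List.getElem?_append_left h]
      · rw [List.getElem?_eq_none (by omega), List.getElem?_eq_none]
        cases app <;> simp <;> omega

/-- A configuration of the Turing machine. -/
def conf (q : State S.P) (h : ℕ) (t : ℕ → TapeSym S.Col) (k : ℕ) : Config S.toMachine :=
  ⟨q, h, fun _ => t, fun _ => k⟩

theorem conf_surj (c : Config S.toMachine) :
    c = S.conf c.state c.inHead (c.tape (0 : Fin 1)) (c.head (0 : Fin 1)) := by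
  obtain ⟨q, h, t, k⟩ := c
  simp only [conf, Config.mk.injEq, true_and]
  constructor
  · funext (i : Fin 1); rw [Subsingleton.elim i 0]
  · funext (i : Fin 1); rw [Subsingleton.elim i 0]

theorem step_conf {w : List α} {q h t k q' h' t' k'} :
    S.toMachine.Step w (S.conf q h t k) (S.conf q' h' t' k') ↔
      ∃ d act, S.TMTrans q (inputAt w h) (t k) q' d act ∧ h' = min (d.apply h) (w.length + 1) ∧
        t' = Function.update t k act.1 ∧ k' = act.2.apply k := by
  constructor
  · rintro ⟨d, act, h1, h2, h3, h4⟩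
    exact ⟨d, act (0 : Fin 1), h1, h2, h3 (0 : Fin 1), h4 (0 : Fin 1)⟩
  · rintro ⟨d, act, h1, h2, h3, h4⟩
    exact ⟨d, fun _ => act, h1, h2, fun _ => h3, fun _ => h4⟩

/-- What a configuration of the Turing machine looks like. -/
def Inv (w : List α) (c : Config S.toMachine) : Prop :=
  c = S.toMachine.init ∨ ∃ a : S.Conf, S.Reaches w a ∧ a.pos ≤ w.length + 1 ∧
    ((∃ u v x q, S.Run a.state u v q ∧ a.word = u ++ x ∧
        c = S.conf (.sweep q) a.pos (tapeOf (v ++ x)) (u.length + 1)) ∨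
      (∃ k, k ≤ a.word.length ∧ c = S.conf (.back a.state) a.pos (tapeOf a.word) k))

theorem inv_step {w : List α} {c c' : Config S.toMachine} (h : S.Inv w c)
    (hs : S.toMachine.Step w c c') : S.Inv w c' := by
  rw [S.conf_surj c'] at hs ⊢
  generalize c'.state = q' at *
  generalize c'.inHead = h' at *
  generalize c'.tape (0 : Fin 1) = t' at *
  generalize c'.head (0 : Fin 1) = k' at *
  rcases h with rfl | ⟨a, ha, hpos, ⟨u, v, x, q, hrun, hword, rfl⟩ | ⟨k, hk, rfl⟩⟩
  · obtain ⟨d, act, h1, rfl, rfl, rfl⟩ :=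
      (S.step_conf (q := .boot) (h := 0) (t := fun _ => .blank) (k := 0)).1 hs
    cases h1
    refine Or.inr ⟨⟨S.start, [], 0⟩, .refl, Nat.zero_le _, Or.inl ⟨[], [], [], S.start, .nil _, rfl, ?_⟩⟩
    congr 1
    · funext n
      rcases n with _ | n
      · simp [tapeOf]
      · simp [tapeOf, appendSym]
  · obtain ⟨d, act, h1, rfl, rfl, rfl⟩ := S.step_conf.1 hs
    have hlen := hrun.length_eq
    rcases x with _ | ⟨c, x⟩
    · have e : tapeOf (v ++ []) (u.length + 1) = .blank := by
        rw [List.append_nil, ← hlen, tapeOf_end]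
      rw [e] at h1
      generalize hact : act = act' at h1
      cases h1 with
      | finish h1 =>
        rename_i app p
        subst hact
        refine Or.inr ⟨⟨p, v ++ app.toList, _⟩, ha.tail
          ⟨q, v, app, d, by rw [hword, List.append_nil]; exact hrun, h1, rfl, rfl⟩,
          min_le_right _ _, Or.inr ⟨u.length, by simp [hlen], ?_⟩⟩
        congr 1
        rw [List.append_nil, ← hlen, update_tapeOf_end]
    · have e : tapeOf (v ++ c :: x) (u.length + 1) = .col c := by rw [← hlen, tapeOf_append]
      rw [e] at h1
      cases h1 with
      | sweep h1 =>
        rename_i q' d'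
        refine Or.inr ⟨a, ha, hpos, Or.inl ⟨u ++ [c], v ++ [d'], x, q', hrun.snoc h1, by simp [hword],
          ?_⟩⟩
        congr 1
        · simpa [Move.apply] using hpos
        · rw [← hlen, update_tapeOf]; simp
        · simp [Move.apply]
  · obtain ⟨d, act, h1, rfl, rfl, rfl⟩ := S.step_conf.1 hs
    rcases k with _ | k
    · have e : tapeOf a.word 0 = .marker := rfl
      rw [e] at h1
      cases h1
      refine Or.inr ⟨a, ha, hpos, Or.inl ⟨[], [], a.word, a.state, .nil _, rfl, ?_⟩⟩
      congr 1
      · simpa [Move.apply] using hpos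
      · rw [← e, Function.update_eq_self]; rfl
    · have e : tapeOf a.word (k + 1) = .col (a.word[k]'hk) := by
        simp [tapeOf, appendSym, List.getElem?_eq_getElem hk]
      rw [e] at h1
      cases h1
      refine Or.inr ⟨a, ha, hpos, Or.inr ⟨k, by omega, ?_⟩⟩
      congr 1
      · simpa [Move.apply] using hpos
      · rw [← e, Function.update_eq_self]

theorem inv_of_reaches {w : List α} {c : Config S.toMachine} (h : S.toMachine.Reaches w c) :
    S.Inv w c := by
  induction h with
  | refl => exact Or.inl rfl
  | tail _ hs ih => exact S.inv_step ih hs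

theorem pos_le {w : List α} {a : S.Conf} (h : S.Reaches w a) : a.pos ≤ w.length + 1 := by
  induction h with
  | refl => exact Nat.zero_le _
  | tail _ hs ih =>
    obtain ⟨_, _, _, _, _, _, _, h⟩ := hs
    rw [h]; exact min_le_right _ _

theorem reaches_conf {w : List α} {a : S.Conf} (h : S.Reaches w a) :
    S.toMachine.Reaches w (S.conf (.sweep a.state) a.pos (tapeOf a.word) 1) := by
  induction h with
  | refl =>
    refine .single ((S.step_conf (q := .boot) (h := 0) (t := fun _ => .blank) (k := 0)).2
      ⟨.stay, _, .boot _, by simp [Move.apply], ?_, rfl⟩)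
    funext n
    rcases n with _ | n
    · simp [tapeOf]
    · simp [tapeOf, appendSym]
  | @tail a b hra hs ih =>
    have hpa := S.pos_le hra
    have hpb := S.pos_le (hra.tail hs)
    obtain ⟨q, v, app, d, hrun, hfin, hword, hpos⟩ := hs
    have hlen := hrun.length_eq
    have h1 : ∀ {p u v q} (_ : S.Run p u v q) (x : List S.Col),
        ReflTransGen (S.toMachine.Step w) (S.conf (.sweep p) a.pos (tapeOf (u ++ x)) 1)
          (S.conf (.sweep q) a.pos (tapeOf (v ++ x)) (u.length + 1)) := by
      intro p u v q h
      clear ih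
      induction h with
      | nil => intro x; exact .refl
      | @snoc u v q c d r hr ht ih =>
        intro x
        have := ih ([c] ++ x)
        rw [← List.append_assoc] at this
        refine this.tail (S.step_conf.2 ⟨.stay, (.col d, .right), ?_, ?_, ?_, ?_⟩)
        · have : tapeOf (v ++ ([c] ++ x)) (u.length + 1) = .col c := by
            rw [← hr.length_eq]; exact tapeOf_append _ _ _
          rw [this]
          exact .sweep ht
        · simpa [Move.apply] using hpa
        · rw [← hr.length_eq]
          have := update_tapeOf v x c d
          simpa using this.symm
        · simp [Move.apply]
    have h2 : ∀ k, k ≤ b.word.length → ReflTransGen (S.toMachine.Step w)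
        (S.conf (.back b.state) b.pos (tapeOf b.word) k)
        (S.conf (.sweep b.state) b.pos (tapeOf b.word) 1) := by
      intro k
      induction k with
      | zero =>
        intro _
        refine .single (S.step_conf.2 ⟨.stay, _, .turn _ _, ?_, ?_, rfl⟩)
        · simpa [Move.apply] using hpb
        · exact (Function.update_eq_self 0 (tapeOf b.word)).symm
      | succ k ih =>
        intro hk
        have e : tapeOf b.word (k + 1) = .col (b.word[k]'hk) := by
          simp [tapeOf, appendSym, List.getElem?_eq_getElem hk]
        refine .head (S.step_conf.2 ⟨.stay, (.col (b.word[k]'hk), .left), ?_, ?_, ?_, rfl⟩)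
          (ih (by omega))
        · rw [e]; exact .back _ _ _
        · simpa [Move.apply] using hpb
        · rw [← e, Function.update_eq_self]
    have h3 := h1 hrun []
    simp only [List.append_nil] at h3
    refine (ih.trans h3).trans (.head (S.step_conf.2 ⟨d, (appendSym app, .left), ?_, hpos, ?_, rfl⟩)
      (h2 a.word.length ?_))
    · rw [← hlen, tapeOf_end]
      exact .finish hfin
    · rw [hword, ← hlen, update_tapeOf_end]
    · rw [hword]; simp [hlen]

/-- The language of a sweeping machine whose working words have logarithmic length is in `NL`. -/
theorem inNL [Finite α] {L : Language α} (k : ℕ)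
    (hacc : ∀ p c q d, S.trans p c q d → q ∉ S.accept)
    (hlen : ∀ w a, S.Reaches w a → a.word.length ≤ k * (Nat.log 2 w.length + 1))
    (hL : ∀ w, w ∈ L ↔ ∃ a, S.Reaches w a ∧ a.state ∈ S.accept) : InNL L := by
  -- The head reaches at most the blank behind the word, which is one cell further because of the
  -- left marker. Raising `k` by two makes up for this and for the strict inequality.
  refine ⟨S.toMachine, ⟨k + 2, fun w c hc i => ?_⟩, fun w => ?_⟩
  · rcases S.inv_of_reaches hc with rfl | ⟨a, ha, -, ⟨u, v, x, q, -, hword, rfl⟩ | ⟨j, hj, rfl⟩⟩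
    · simp [Machine.init]
    · have := hlen w a ha
      rw [hword, List.length_append] at this
      change u.length + 1 < _
      nlinarith
    · have := hlen w a ha
      change j < _
      nlinarith
  · rw [hL]
    constructor
    · rintro ⟨a, ha, hacc⟩
      exact ⟨_, S.reaches_conf ha, a.state, hacc, rfl⟩
    · rintro ⟨c, hc, p, hp, hcp⟩
      rcases S.inv_of_reaches hc with rfl | ⟨a, ha, -, ⟨u, v, x, q, hrun, hword, rfl⟩ | ⟨j, hj, rfl⟩⟩
      · exact absurd hcp (by intro h; injection h)
      · obtain rfl : p = q := by injection hcp with h; exact h.symm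
        -- By `hacc` the transducer never enters an accepting state, so acceptance occurs only at
        -- the very beginning of a sweep, where the configuration is that of a round.
        cases hrun with
        | nil => exact ⟨a, ha, hp⟩
        | snoc _ h => exact absurd hp (hacc _ _ _ _ h)
      · exact absurd hcp (by intro h; injection h)

end Sweeper

end NLSpace

namespace NLSpace

open Relation

/-! ### Simulation of transition systems in logarithmic space -/

theorem listVal_append_singleton {B : ℕ} (l : List (Fin B)) (c : Fin B) :
    listVal (l ++ [c]) = listVal l + B ^ l.length * c := by
  induction l with
  | nil => simp
  | cons a l ih => simp [ih, pow_succ]; ring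

theorem zip_ofFn {A B : Type} {L : ℕ} (x : Fin L → A) (y : Fin L → B) :
    (List.ofFn x).zip (List.ofFn y) = List.ofFn fun i => (x i, y i) := by
  apply List.ext_getElem <;> simp

/-- The input symbol at a position holding a letter or lying behind the word. -/
def optSym {α : Type} : Option α → InSym α
  | some a => .letter a
  | none => .rightEnd

/-- Because of the left marker, letter `k` is scanned at position `k + 1`. A head that tries to go
further stays on the right marker, which stands for `none`. -/
theorem inputAt_min {α : Type} (w : List α) (k : ℕ) :
    inputAt w (min (k + 1) (w.length + 1)) = optSym w[k]? := by
  by_cases h : k < w.length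
  · rw [min_eq_left (by omega)]
    simp [inputAt, optSym, h]
  · rw [min_eq_right (by omega)]
    simp [inputAt, optSym, List.getElem?_eq_none (Nat.le_of_not_lt h)]

theorem size_succ_of_lt {m L : ℕ} (h : m.size = L) (hL : m + 1 < 2 ^ L) : (m + 1).size = L :=
  le_antisymm (Nat.size_le.2 hL) (h ▸ Nat.size_le_size (Nat.le_succ m))

theorem exists_ofFn {A : Type} {L : ℕ} {l : List A} (h : l.length = L) :
    ∃ x : Fin L → A, l = List.ofFn x := by
  subst h
  exact ⟨l.get, (List.ofFn_get l).symm⟩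

/-- A regular transition system with fixed automata for its regular predicates. -/
structure AutoSystem (α : Type) where
  Δ : Type
  finΔ : Finite Δ
  default : Δ
  pos : Δ → Fin 2
  σI : Type
  finI : Finite σI
  stepI : σI → Δ → σI
  startI : σI
  accI : Set σI
  σF : Type
  finF : Finite σF
  stepF : σF → Δ → σF
  startF : σF
  accF : Set σF
  σK : Type
  finK : Finite σK
  stepK : σK → Δ × Δ → σK
  startK : σK
  accK : Option α → Set σK

namespace AutoSystem

variable {α : Type} (S : AutoSystem α)

def Init {L : ℕ} (x : Fin L → S.Δ) : Prop := (List.ofFn x).foldl S.stepI S.startI ∈ S.accI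

def Final {L : ℕ} (x : Fin L → S.Δ) : Prop := (List.ofFn x).foldl S.stepF S.startF ∈ S.accF

def Step (w : List α) (x y : Fin (len w) → S.Δ) : Prop :=
  (List.ofFn fun i => (x i, y i)).foldl S.stepK S.startK ∈
    S.accK (w[val fun i => S.pos (x i)]?)

def Reach (w : List α) (y : Fin (len w) → S.Δ) : Prop :=
  ∃ x, S.Init x ∧ ReflTransGen (S.Step w) x y

/-- The states of the simulating machine: measure the length of the input, choose an initial
configuration, rewind the input head, move it to the position to be read, read and choose the next
configuration, check whether the configuration is final. -/
inductive St
  | start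
  | count
  | counted
  | last
  | init (s : S.σI)
  | rewind
  | down
  | downed
  | read (a : Option α) (s : S.σK)
  | check (s : S.σF)
  | accept

instance [Finite α] : Finite S.St := by
  have := S.finI
  have := S.finF
  have := S.finK
  refine Finite.of_injective (β := Fin 8 ⊕ S.σI ⊕ (Option α × S.σK) ⊕ S.σF)
    (fun
      | .start => .inl 0 | .count => .inl 1 | .counted => .inl 2 | .last => .inl 3
      | .rewind => .inl 4 | .down => .inl 5 | .downed => .inl 6 | .accept => .inl 7
      | .init s => .inr (.inl s) | .read a s => .inr (.inr (.inl (a, s)))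
      | .check s => .inr (.inr (.inr s))) ?_
  rintro (_ | _ | _ | _ | _ | _ | _ | _ | _ | _ | _) (_ | _ | _ | _ | _ | _ | _ | _ | _ | _ | _) h <;>
    simp_all

/-- A column of the working memory: a digit of a counter and a letter of the configuration. -/
abbrev Col := Fin 2 × S.Δ

/-- The column for a letter of a configuration, the counter being set to the position to read. -/
def col (d : S.Δ) : S.Col := (S.pos d, d)

/-- `count` increments and `down` decrements a binary counter, where `counted` and `downed` mean
that the carry or borrow has been absorbed. Every newly guessed letter resets its counter digit to
the position to be read next. As `read` accepts only zero digits, the next configuration can be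
chosen only after the countdown is complete. -/
inductive Trans : S.St → S.Col → S.St → S.Col → Prop
  | count_one (d) : Trans .count (1, d) .count (0, d)
  | count_zero (d) : Trans .count (0, d) .counted (1, d)
  | counted (c) : Trans .counted c .counted c
  | last (c) : Trans .last c .last c
  | init (s c d) : Trans (.init s) c (.init (S.stepI s d)) (S.col d)
  | rewind (c) : Trans .rewind c .rewind c
  | down_zero (d) : Trans .down (0, d) .down (1, d)
  | down_one (d) : Trans .down (1, d) .downed (0, d)
  | downed (c) : Trans .downed c .downed c
  | read (a s d d') : Trans (.read a s) (0, d) (.read a (S.stepK s (d, d'))) (S.col d')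
  | check (s c) : Trans (.check s) c (.check (S.stepF s c.2)) c

/-- A carry out of the last digit appends a column, so the counter has just the length of the binary
notation of the number of letters passed; the column added in `last` completes it to `len w`. The
guess that the input is exhausted and the guessed letter `a` in `read` are verified by the scanned
symbol. There is no rule for `down`, so decrementing zero blocks the machine. -/
inductive Finish : S.St → InSym α → Option S.Col → Move → S.St → Prop
  | start (q) : q = .count ∨ q = .last → Finish .start .leftEnd none .right q
  | count (a q) : q = .count ∨ q = .last →
      Finish .count (.letter a) (some (1, S.default)) .right q
  | counted (a q) : q = .count ∨ q = .last → Finish .counted (.letter a) none .right q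
  | last : Finish .last .rightEnd (some (0, S.default)) .stay (.init S.startI)
  | init (s a q) : s ∈ S.accI → q = .rewind ∨ q = .check S.startF →
      Finish (.init s) a none .stay q
  | rewind (a) : a ≠ .leftEnd → Finish .rewind a none .left .rewind
  | rewound (q) : q = .down ∨ (∃ a, q = .read a S.startK) → Finish .rewind .leftEnd none .right q
  | downed (a q) : q = .down ∨ (∃ a, q = .read a S.startK) → Finish .downed a none .right q
  | read (a s q) : s ∈ S.accK a → q = .rewind ∨ q = .check S.startF →
      Finish (.read a s) (optSym a) none .stay q
  | check (s a) : s ∈ S.accF → Finish (.check s) a none .stay .accept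

/-- The configuration of the simulating machine that holds a configuration of the system, the
counter being set to the position to read. -/
def word {L : ℕ} (y : Fin L → S.Δ) : List S.Col := (List.ofFn y).map S.col

theorem word_snd {L : ℕ} (y : Fin L → S.Δ) : (S.word y).map Prod.snd = List.ofFn y := by
  simp [word, List.map_ofFn, Function.comp_def, col]

theorem word_fst {L : ℕ} (y : Fin L → S.Δ) :
    listVal ((S.word y).map Prod.fst) = val fun i => S.pos (y i) := by
  simp [word, List.map_ofFn, Function.comp_def, col, val]

/-- The simulating machine. -/
abbrev sweeper [Finite α] : Sweeper α where
  P := S.St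
  finP := inferInstance
  Col := S.Col
  finCol := by have := S.finΔ; infer_instance
  start := .start
  accept := {.accept}
  trans := S.Trans
  finish := S.Finish

variable [Finite α]

theorem run_copy {p : S.St} (hp : ∀ c q d, S.Trans p c q d → q = p ∧ d = c) {u v : List S.Col}
    {q : S.St} (h : S.sweeper.Run p u v q) : v = u ∧ q = p := by
  refine Sweeper.Run.induct h ?_ ?_
  · exact ⟨rfl, rfl⟩
  · intro u v q c d r _hr ht ih
    obtain ⟨rfl, rfl⟩ := ih
    obtain ⟨rfl, rfl⟩ := hp _ _ _ ht
    exact ⟨rfl, rfl⟩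

theorem run_of_copy {p : S.St} (hp : ∀ c, S.Trans p c p c) (u : List S.Col) :
    S.sweeper.Run p u u p := by
  induction u using List.reverseRecOn with
  | nil => exact .nil _
  | append_singleton u c ih => exact .snoc ih (hp c)

/-- In the first case the carry leaves the word, and the counter has lost a full power of two. -/
theorem run_count {u v : List S.Col} {q : S.St} (h : S.sweeper.Run .count u v q) :
    (q = .count ∧ listVal (u.map Prod.fst) + 1 = listVal (v.map Prod.fst) + 2 ^ u.length) ∨
    (q = .counted ∧ listVal (v.map Prod.fst) = listVal (u.map Prod.fst) + 1) := by
  refine Sweeper.Run.induct h ?_ ?_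
  · simp
  · intro u v q c d r hr ht ih
    have hl := hr.length_eq
    simp only [List.map_append, List.map_cons, List.map_nil, listVal_append_singleton,
      List.length_map, List.length_append, List.length_singleton, hl, pow_succ]
    rcases ih with ⟨rfl, ih⟩ | ⟨rfl, ih⟩
    · rcases ht with _ | _
      · left; refine ⟨rfl, ?_⟩; simp; omega
      · right; refine ⟨rfl, ?_⟩; simp; omega
    · rcases ht with _ | _
      right; refine ⟨rfl, ?_⟩; omega

theorem exists_run_count (u : List S.Col) :
    ∃ v q, S.sweeper.Run .count u v q ∧ (q = .count ∨ q = .counted) := by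
  induction u using List.reverseRecOn with
  | nil => exact ⟨_, _, .nil _, Or.inl rfl⟩
  | append_singleton u c ih =>
    obtain ⟨v, q, h, rfl | rfl⟩ := ih
    · obtain ⟨b, d⟩ := c
      fin_cases b
      · exact ⟨_, _, h.snoc (.count_zero d), Or.inr rfl⟩
      · exact ⟨_, _, h.snoc (.count_one d), Or.inl rfl⟩
    · exact ⟨_, _, h.snoc (.counted c), Or.inr rfl⟩

theorem run_down {u v : List S.Col} {q : S.St} (h : S.sweeper.Run .down u v q) :
    v.map Prod.snd = u.map Prod.snd ∧
    ((q = .down ∧ listVal (u.map Prod.fst) = 0) ∨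
    (q = .downed ∧ listVal (u.map Prod.fst) = listVal (v.map Prod.fst) + 1)) := by
  -- The induction must also record that, as long as a borrow is pending, all digits have turned
  -- into ones.
  have key : v.map Prod.snd = u.map Prod.snd ∧
    ((q = .down ∧ listVal (u.map Prod.fst) = 0 ∧
      listVal (v.map Prod.fst) + 1 = 2 ^ u.length) ∨
    (q = .downed ∧ listVal (u.map Prod.fst) = listVal (v.map Prod.fst) + 1)) := by
    refine Sweeper.Run.induct h ?_ ?_
    · simp
    · intro u v q c d r hr ht ih
      have hl := hr.length_eq
      obtain ⟨ih0, ih⟩ := ih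
      simp only [List.map_append, List.map_cons, List.map_nil, listVal_append_singleton,
        List.length_map, List.length_append, List.length_singleton, hl, pow_succ, ih0]
      rcases ih with ⟨rfl, ih, ih'⟩ | ⟨rfl, ih⟩
      · rcases ht with _ | _
        · refine ⟨rfl, Or.inl ⟨rfl, ?_⟩⟩; simp; omega
        · refine ⟨rfl, Or.inr ⟨rfl, ?_⟩⟩; simp; omega
      · rcases ht with _ | _
        refine ⟨rfl, Or.inr ⟨rfl, ?_⟩⟩; omega
  tauto

theorem exists_run_down (u : List S.Col) :
    ∃ v q, S.sweeper.Run .down u v q ∧ (q = .downed ∨ (q = .down ∧ listVal (u.map Prod.fst) = 0)) := by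
  induction u using List.reverseRecOn with
  | nil => exact ⟨_, _, .nil _, Or.inr ⟨rfl, rfl⟩⟩
  | append_singleton u c ih =>
    obtain ⟨v, q, h, rfl | ⟨rfl, h0⟩⟩ := ih
    · exact ⟨_, _, h.snoc (.downed c), Or.inl rfl⟩
    · obtain ⟨b, d⟩ := c
      fin_cases b
      · refine ⟨_, _, h.snoc (.down_zero d), Or.inr ⟨rfl, ?_⟩⟩
        simp [listVal_append_singleton, h0]
      · exact ⟨_, _, h.snoc (.down_one d), Or.inl rfl⟩

theorem run_init {s : S.σI} {u v : List S.Col} {q : S.St} (h : S.sweeper.Run (.init s) u v q) :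
    ∃ x : List S.Δ, x.length = u.length ∧ v = x.map S.col ∧ q = .init (x.foldl S.stepI s) := by
  refine Sweeper.Run.induct h ?_ ?_
  · exact ⟨[], rfl, rfl, rfl⟩
  · intro u v q c d r _hr ht ih
    obtain ⟨x, h1, rfl, rfl⟩ := ih
    rcases ht with _ | _
    rename_i d
    exact ⟨x ++ [d], by simp [h1], by simp, by simp⟩

theorem run_of_init (s : S.σI) (u : List S.Col) (x : List S.Δ) (h : x.length = u.length) :
    S.sweeper.Run (.init s) u (x.map S.col) (.init (x.foldl S.stepI s)) := by
  induction x using List.reverseRecOn generalizing u with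
  | nil =>
    obtain rfl : u = [] := List.length_eq_zero_iff.1 h.symm
    exact .nil _
  | append_singleton x d ih =>
    rcases List.eq_nil_or_concat u with rfl | ⟨u, c, rfl⟩
    · simp at h
    · simp only [List.concat_eq_append, List.map_append, List.foldl_append]
      exact .snoc (ih u (by simpa using h)) (.init _ _ _)

theorem run_read {a : Option α} {s : S.σK} {u v : List S.Col} {q : S.St}
    (h : S.sweeper.Run (.read a s) u v q) : listVal (u.map Prod.fst) = 0 ∧
    ∃ x : List S.Δ, x.length = u.length ∧ v = x.map S.col ∧
      q = .read a (((u.map Prod.snd).zip x).foldl S.stepK s) := by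
  refine Sweeper.Run.induct h ?_ ?_
  · exact ⟨rfl, [], rfl, rfl, rfl⟩
  · intro u v q c d r _hr ht ih
    obtain ⟨h0, x, h1, rfl, rfl⟩ := ih
    rcases ht with _ | _
    rename_i d d'
    refine ⟨by simp [listVal_append_singleton, h0], x ++ [d'], by simp [h1], by simp, ?_⟩
    rw [List.map_append, List.zip_append (by simp [h1])]
    simp

theorem run_of_read (a : Option α) (s : S.σK) (u : List S.Col) (x : List S.Δ)
    (h : x.length = u.length) (h0 : listVal (u.map Prod.fst) = 0) :
    S.sweeper.Run (.read a s) u (x.map S.col)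
      (.read a (((u.map Prod.snd).zip x).foldl S.stepK s)) := by
  induction x using List.reverseRecOn generalizing u with
  | nil =>
    obtain rfl : u = [] := List.length_eq_zero_iff.1 h.symm
    exact .nil _
  | append_singleton x d ih =>
    rcases List.eq_nil_or_concat u with rfl | ⟨u, c, rfl⟩
    · simp at h
    · have hl : x.length = u.length := by simpa using h
      rw [List.concat_eq_append, List.map_append (f := Prod.snd), List.zip_append (by simp [hl])]
      simp only [List.map_append, List.foldl_append]
      rw [List.concat_eq_append] at h0
      obtain ⟨b, d'⟩ := c
      simp only [List.map_append, List.map_cons, List.map_nil, listVal_append_singleton,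
        List.length_map] at h0
      obtain rfl : b = 0 := by
        have : 2 ^ u.length * (b : ℕ) = 0 := by omega
        have : (b : ℕ) = 0 := by simpa using this
        exact Fin.ext this
      exact .snoc (ih u hl (by omega)) (.read _ _ _ _)

theorem run_check {s : S.σF} {u v : List S.Col} {q : S.St} (h : S.sweeper.Run (.check s) u v q) :
    v = u ∧ q = .check ((u.map Prod.snd).foldl S.stepF s) := by
  refine Sweeper.Run.induct h ?_ ?_
  · exact ⟨rfl, rfl⟩
  · intro u v q c d r _hr ht ih
    obtain ⟨rfl, rfl⟩ := ih
    rcases ht with _ | _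
    simp

theorem run_of_check (s : S.σF) (u : List S.Col) :
    S.sweeper.Run (.check s) u u (.check ((u.map Prod.snd).foldl S.stepF s)) := by
  induction u using List.reverseRecOn with
  | nil => exact .nil _
  | append_singleton u c ih =>
    simp only [List.map_append, List.foldl_append]
    exact .snoc ih (.check _ _)

/-- What the configurations of the simulating machine look like. -/
def Inv (w : List α) (c : S.sweeper.Conf) : Prop :=
  match c.state with
  | .start => c.word = [] ∧ c.pos = 0
  | .count | .last => ∃ m ≤ w.length, c.pos = m + 1 ∧ c.word.length = m.size ∧
      listVal (c.word.map Prod.fst) = m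
  | .init s => s = S.startI ∧ c.word.length = len w
  | .rewind => ∃ y, S.Reach w y ∧ c.word = S.word y
  -- Here `k` is the number of decrements made so far. The head has moved along, except that it
  -- stops at the right marker.
  | .down => ∃ y, S.Reach w y ∧ c.word.map Prod.snd = List.ofFn y ∧ ∃ k,
      c.pos = min (k + 1) (w.length + 1) ∧
      k + listVal (c.word.map Prod.fst) = val fun i => S.pos (y i)
  | .read _ s => s = S.startK ∧ ∃ y, S.Reach w y ∧ c.word.map Prod.snd = List.ofFn y ∧ ∃ k,
      c.pos = min (k + 1) (w.length + 1) ∧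
      k + listVal (c.word.map Prod.fst) = val fun i => S.pos (y i)
  | .check s => s = S.startF ∧ ∃ y, S.Reach w y ∧ c.word = S.word y
  | .accept => c.word.length = len w ∧ ∃ y, S.Reach w y ∧ S.Final y
  -- These states occur only within a round, never at its beginning.
  | .counted | .downed => False

theorem inv_of_reaches {w : List α} {c : S.sweeper.Conf} (h : S.sweeper.Reaches w c) : S.Inv w c := by
  induction h with
  | refl => exact ⟨rfl, rfl⟩
  | @tail c c' _ hs ih =>
    obtain ⟨q, v, app, d, hrun, hfin, hword, hpos⟩ := hs
    obtain ⟨p, u, h⟩ := c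
    obtain ⟨p', u', h'⟩ := c'
    dsimp only at hrun hfin hword hpos
    have counting : ∀ {m v app}, m < w.length → h = m + 1 → v ++ Option.toList app = u' →
        u'.length = (m + 1).size → listVal (u'.map Prod.fst) = m + 1 →
        h' = min (Move.right.apply h) (w.length + 1) → p' = .count ∨ p' = .last →
        S.Inv w ⟨p', u', h'⟩ := by
      intro m v app hm hh hv hl hval hh' hp
      have : ∃ m ≤ w.length, h' = m + 1 ∧ u'.length = m.size ∧ listVal (u'.map Prod.fst) = m := by
        refine ⟨m + 1, hm, ?_, hl, hval⟩
        simp only [hh', hh, Move.apply]; omega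
      rcases hp with rfl | rfl <;> exact this
    have letter : ∀ {m} {a : α}, inputAt w (m + 1) = .letter a → m < w.length := by
      intro m a h
      by_contra hm
      simp [inputAt, List.getElem?_eq_none (Nat.le_of_not_lt hm)] at h
    cases p with
    | start =>
      obtain ⟨rfl, rfl⟩ := ih
      obtain ⟨rfl, rfl⟩ := S.run_copy (fun c q d h => by cases h) hrun
      cases hfin with
      | start _ hp =>
        have : ∃ m ≤ w.length, h' = m + 1 ∧ u'.length = m.size ∧
            listVal (u'.map Prod.fst) = m := by
          refine ⟨0, Nat.zero_le _, ?_, ?_, ?_⟩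
          · simp [hpos, Move.apply]
          · simp [hword]
          · simp [hword]
        rcases hp with rfl | rfl <;> exact this
    | count =>
      obtain ⟨m, hm, rfl, hl, hval⟩ := ih
      have hlen := hrun.length_eq
      dsimp only at hl hval
      have hlt : listVal (u.map Prod.fst) < 2 ^ u.length := by
        simpa using listVal_lt (u.map Prod.fst)
      rcases S.run_count hrun with ⟨rfl, hv⟩ | ⟨rfl, hv⟩
      · generalize ha : inputAt w (m + 1) = a at hfin
        cases hfin with
        | count a _ hp =>
          have h2 : m + 1 = 2 ^ u.length := by omega
          refine counting (letter ha) rfl hword.symm ?_ ?_ hpos hp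
          · rw [h2, Nat.size_pow, hword]; simp [hlen]
          · rw [hword]
            simp only [Option.toList_some, List.map_append, List.map_cons, List.map_nil,
              listVal_append_singleton, List.length_map, hlen]
            simp; omega
      · generalize ha : inputAt w (m + 1) = a at hfin
        cases hfin with
        | counted a _ hp =>
          simp only [Option.toList_none, List.append_nil] at hword
          subst hword
          refine counting (v := u') (app := none) (letter ha) rfl (by simp) ?_ ?_ hpos hp
          · have hlt' : listVal (u'.map Prod.fst) < 2 ^ u'.length := by
              simpa using listVal_lt (u'.map Prod.fst)
            rw [size_succ_of_lt hl.symm (by rw [← hlen]; omega), hlen]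
          · omega
    | counted => exact ih.elim
    | last =>
      obtain ⟨m, hm, rfl, hl, hval⟩ := ih
      obtain ⟨rfl, rfl⟩ := S.run_copy (fun c q d h => by cases h; exact ⟨rfl, rfl⟩) hrun
      generalize ha : inputAt w (m + 1) = a at hfin
      cases hfin
      have : m = w.length := by
        by_contra hne
        simp [inputAt, show m < w.length by omega] at ha
      subst this
      refine ⟨rfl, ?_⟩
      change u'.length = _
      rw [hword]
      simpa [len] using hl
    | init s =>
      obtain ⟨rfl, hl⟩ := ih
      obtain ⟨x, hx, rfl, rfl⟩ := S.run_init hrun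
      obtain ⟨y, rfl⟩ := exists_ofFn (hx.trans hl)
      cases hfin with
      | init _ _ _ hs hp =>
        have : ∃ y, S.Reach w y ∧ u' = S.word y := ⟨y, ⟨y, hs, .refl⟩, by simpa [word] using hword⟩
        rcases hp with rfl | rfl
        · exact this
        · exact ⟨rfl, this⟩
    | rewind =>
      obtain ⟨y, hy, rfl⟩ := ih
      obtain ⟨rfl, rfl⟩ := S.run_copy (fun c q d h => by cases h; exact ⟨rfl, rfl⟩) hrun
      generalize ha : inputAt w h = a at hfin
      cases hfin with
      | rewind => exact ⟨y, hy, by simpa using hword⟩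
      | rewound _ hp =>
        obtain rfl : h = 0 := by
          rcases h with _ | h
          · rfl
          · simp only [inputAt] at ha; split at ha <;> cases ha
        obtain rfl : u' = S.word y := by simpa using hword
        have : ∃ y', S.Reach w y' ∧ (S.word y).map Prod.snd = List.ofFn y' ∧ ∃ k,
            h' = min (k + 1) (w.length + 1) ∧
            k + listVal ((S.word y).map Prod.fst) = val fun i => S.pos (y' i) :=
          ⟨y, hy, S.word_snd y, 0, by simpa [Move.apply] using hpos, by rw [S.word_fst, zero_add]⟩
        rcases hp with rfl | ⟨a, rfl⟩
        · exact this
        · exact ⟨rfl, this⟩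
    | down =>
      obtain ⟨y, hy, hs, k, hk, hval⟩ := ih
      dsimp only at hs hk hval
      obtain ⟨hsnd, ⟨rfl, hz⟩ | ⟨rfl, hv⟩⟩ := S.run_down hrun
      · cases hfin
      · cases hfin with
        | downed _ _ hp =>
          obtain rfl : u' = v := by simpa using hword
          have : ∃ y', S.Reach w y' ∧ u'.map Prod.snd = List.ofFn y' ∧ ∃ k,
              h' = min (k + 1) (w.length + 1) ∧
              k + listVal (u'.map Prod.fst) = val fun i => S.pos (y' i) := by
            refine ⟨y, hy, hsnd.trans hs, k + 1, ?_, by omega⟩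
            simp only [hpos, Move.apply, hk]; omega
          rcases hp with rfl | ⟨a, rfl⟩
          · exact this
          · exact ⟨rfl, this⟩
    | downed => exact ih.elim
    | read a s =>
      obtain ⟨rfl, y, hy, hs, k, hk, hval⟩ := ih
      dsimp only at hs hk hval
      obtain ⟨h0, x, hx, rfl, rfl⟩ := S.run_read hrun
      obtain ⟨z, rfl⟩ := exists_ofFn (L := len w) (hx.trans (by
        have := congrArg List.length hs; simpa using this))
      rw [hk, inputAt_min] at hfin
      generalize ha : optSym w[k]? = a' at hfin
      cases hfin with
      | read _ _ _ hacc hp =>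
        have ha' : w[k]? = a := by
          generalize w[k]? = b at ha
          cases a <;> cases b <;> simp_all [optSym]
        have : ∃ y, S.Reach w y ∧ u' = S.word y := by
          obtain ⟨x, hx, hxy⟩ := hy
          refine ⟨z, ⟨x, hx, hxy.tail ?_⟩, by simpa [word] using hword⟩
          rw [Step, ← hval, h0, add_zero, ha', ← zip_ofFn, ← hs]
          exact hacc
        rcases hp with rfl | rfl
        · exact this
        · exact ⟨rfl, this⟩
    | check s =>
      obtain ⟨rfl, y, hy, rfl⟩ := ih
      obtain ⟨rfl, rfl⟩ := S.run_check hrun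
      cases hfin with
      | check _ _ hacc =>
        refine ⟨?_, y, hy, ?_⟩
        · change u'.length = _
          rw [hword]; simp [word]
        · rwa [S.word_snd] at hacc
    | accept =>
      obtain ⟨rfl, rfl⟩ := S.run_copy (fun c q d h => by cases h) hrun
      cases hfin

theorem reaches_counted {w : List α} : ∀ m ≤ w.length, ∀ p : S.St, p = .count ∨ p = .last →
    ∃ u, S.sweeper.Reaches w ⟨p, u, m + 1⟩ := by
  intro m
  induction m with
  | zero =>
    intro _ p hp
    exact ⟨[], .single ⟨.start, [], none, .right, .nil _, .start _ hp, rfl, by simp [Move.apply]⟩⟩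
  | succ m ih =>
    intro hm p hp
    obtain ⟨u, hu⟩ := ih (by omega) .count (Or.inl rfl)
    have hin : inputAt w (m + 1) = .letter (w[m]'(by omega)) := by
      simp [inputAt, show m < w.length by omega]
    have hpos : m + 1 + 1 = min (Move.right.apply (m + 1)) (w.length + 1) := by
      simp only [Move.apply]; omega
    obtain ⟨v, q, hr, rfl | rfl⟩ := S.exists_run_count u
    · exact ⟨_, hu.tail ⟨_, v, _, .right, hr, by dsimp only; rw [hin]; exact .count _ _ hp, rfl, hpos⟩⟩
    · exact ⟨_, hu.tail ⟨_, v, _, .right, hr, by dsimp only; rw [hin]; exact .counted _ _ hp, rfl, hpos⟩⟩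

theorem reaches_word {w : List α} {y : Fin (len w) → S.Δ} (hy : S.Reach w y) (p : S.St)
    (hp : p = .rewind ∨ p = .check S.startF) :
    ∃ h, h ≤ w.length + 1 ∧ S.sweeper.Reaches w ⟨p, S.word y, h⟩ := by
  obtain ⟨x, hx, hxy⟩ := hy
  induction hxy generalizing p with
  | refl =>
    obtain ⟨u, hu⟩ := S.reaches_counted (w := w) w.length le_rfl .last (Or.inr rfl)
    have hin : inputAt w (w.length + 1) = .rightEnd := by simp [inputAt]
    have h1 := hu.tail (c := ⟨.init S.startI, u ++ [(0, S.default)], w.length + 1⟩)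
      ⟨_, u, _, .stay, S.run_of_copy .last u, by dsimp only; rw [hin]; exact .last, rfl,
        by simp [Move.apply]⟩
    obtain ⟨-, hl⟩ := S.inv_of_reaches h1
    refine ⟨w.length + 1, le_rfl, h1.tail ⟨_, _, none, .stay,
      S.run_of_init S.startI _ (List.ofFn x) (by rw [hl]; simp), .init _ _ _ hx hp,
      by simp [word], by simp [Move.apply]⟩⟩
  | @tail y z _ hyz ih =>
    obtain ⟨h, hh, h1⟩ := ih .rewind (Or.inl rfl)
    have h2 : ∀ h, h ≤ w.length + 1 → S.sweeper.Reaches w ⟨.rewind, S.word y, h⟩ →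
        S.sweeper.Reaches w ⟨.rewind, S.word y, 0⟩ := by
      intro h
      induction h with
      | zero => intro _ h; exact h
      | succ h ih =>
        intro hh h1
        refine ih (by omega) (h1.tail ⟨_, _, none, .left, S.run_of_copy .rewind _, .rewind _ ?_,
          by simp, ?_⟩)
        · simp only [inputAt]; split <;> simp
        · simp only [Move.apply]; omega
    replace h1 := h2 h hh h1
    -- the countdown
    have h3 : ∀ k ≤ val (fun i => S.pos (y i)), ∀ p : S.St, p = .down ∨ (∃ a, p = .read a S.startK) →
        ∃ u : List S.Col, u.map Prod.snd = List.ofFn y ∧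
          k + listVal (u.map Prod.fst) = (val fun i => S.pos (y i)) ∧
          S.sweeper.Reaches w ⟨p, u, min (k + 1) (w.length + 1)⟩ := by
      intro k
      induction k with
      | zero =>
        intro _ p hp
        exact ⟨S.word y, S.word_snd y, by rw [S.word_fst, zero_add], h1.tail ⟨_, _, none, .right,
          S.run_of_copy .rewind _, .rewound _ hp, by simp, by simp [Move.apply]⟩⟩
      | succ k ih =>
        intro hk p hp
        obtain ⟨u, hu1, hu2, hu3⟩ := ih (by omega) .down (Or.inl rfl)
        obtain ⟨v, q, hr, rfl | ⟨rfl, h0⟩⟩ := S.exists_run_down u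
        · obtain ⟨hsnd, ⟨h, -⟩ | ⟨-, hv⟩⟩ := S.run_down hr
          · cases h
          · refine ⟨v, hsnd.trans hu1, by omega, hu3.tail ⟨_, _, none, .right, hr, .downed _ _ hp,
              by simp, ?_⟩⟩
            simp only [Move.apply]; omega
        · omega
    obtain ⟨u, hu1, hu2, hu3⟩ := h3 _ le_rfl
      (.read (w[val fun i => S.pos (y i)]?) S.startK) (Or.inr ⟨_, rfl⟩)
    refine ⟨min ((val fun i => S.pos (y i)) + 1) (w.length + 1), min_le_right _ _, hu3.tail ⟨_, _, none, .stay,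
      S.run_of_read _ _ u (List.ofFn z) ?_ (by omega), ?_, by simp [word], ?_⟩⟩
    · have := congrArg List.length hu1
      simpa using this.symm
    · dsimp only
      rw [inputAt_min, hu1, zip_ofFn]
      exact .read _ _ _ hyz hp
    · simp [Move.apply]

theorem inNL {L : Language α} (hL : ∀ w, w ∈ L ↔ ∃ y, S.Reach w y ∧ S.Final y) : InNL L := by
  refine S.sweeper.inNL 2 ?_ ?_ ?_
  · rintro p c q d h rfl
    cases h
  · intro w c hc
    have hlog : len w ≤ 2 * (Nat.log 2 w.length + 1) := by
      have : w.length.size ≤ Nat.log 2 w.length + 1 :=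
        Nat.size_le.2 (Nat.lt_pow_succ_log_self (by norm_num) _)
      rw [len]; omega
    refine le_trans ?_ hlog
    have hinv := S.inv_of_reaches hc
    obtain ⟨p, u, h⟩ := c
    have hofn : ∀ y : Fin (len w) → S.Δ, u.map Prod.snd = List.ofFn y → u.length ≤ len w := by
      intro y h
      have := congrArg List.length h
      simp at this
      omega
    have hsize : ∀ m ≤ w.length, u.length = m.size → u.length ≤ len w := by
      intro m hm h
      rw [h, len]
      exact (Nat.size_le_size hm).trans (Nat.le_succ _)
    cases p with
    | start => have : u = [] := hinv.1; simp [this]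
    | count => obtain ⟨m, hm, -, h, -⟩ := hinv; exact hsize m hm h
    | last => obtain ⟨m, hm, -, h, -⟩ := hinv; exact hsize m hm h
    | counted => exact hinv.elim
    | downed => exact hinv.elim
    | init => exact hinv.2.le
    | rewind => obtain ⟨y, -, rfl⟩ := hinv; simp [word]
    | down => obtain ⟨y, -, h, -⟩ := hinv; exact hofn y h
    | read => obtain ⟨-, y, -, h, -⟩ := hinv; exact hofn y h
    | check => obtain ⟨-, y, -, rfl⟩ := hinv; simp [word]
    | accept => exact hinv.1.le
  · intro w
    rw [hL]
    constructor
    · rintro ⟨y, hy, hF⟩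
      obtain ⟨h, hh, hr⟩ := S.reaches_word hy (.check S.startF) (Or.inr rfl)
      refine ⟨⟨.accept, S.word y, h⟩, hr.tail ⟨_, _, none, .stay, S.run_of_check _ _, .check _ _ ?_,
        by simp, by simpa [Move.apply] using hh⟩, rfl⟩
      rwa [S.word_snd]
    · rintro ⟨⟨p, u, h⟩, hr, rfl⟩
      exact (S.inv_of_reaches hr).2

end AutoSystem

/-- With labels in `Unit` the label of the initial configuration is no constraint. The automata for
the different letters are merged into one, which leaves the letter to affect only the accepting
states. -/
theorem Rec.inNL {α : Type} [Finite α] {P : ∀ w : List α, (Fin (len w) → Unit) → Prop} (h : Rec P)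
    {L : Language α} (hL : ∀ w, w ∈ L ↔ P w fun _ => ()) : InNL L := by
  obtain ⟨S, hS⟩ := h
  obtain ⟨δ⟩ := S.nonemptyΔ
  obtain ⟨σI, finI, MI, hI⟩ := S.regI
  obtain ⟨σF, finF, MF, hF⟩ := S.regF
  obtain ⟨σK, finK, stepK, startK, accK, hK⟩ := Rgl.exists_uniform S.regK
  let A : AutoSystem α := ⟨S.Δ, S.finΔ, δ, S.pos, σI, finI, MI.step, MI.start, MI.accept, σF, finF,
    MF.step, MF.start, MF.accept, σK, finK, stepK, startK, accK⟩
  refine A.inNL fun w => ?_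
  have hstep : A.Step w = S.Step w := by
    funext x y
    exact propext (hK _ _ _).symm
  rw [hL, hS]
  constructor
  · rintro ⟨x, y, -, h1, h2, h3⟩
    exact ⟨y, ⟨x, (hI _ _).1 h1, hstep ▸ h2⟩, (hF _ _).1 h3⟩
  · rintro ⟨y, ⟨x, h1, h2⟩, h3⟩
    exact ⟨x, y, fun _ => rfl, (hI _ _).2 h1, hstep ▸ h2, (hF _ _).2 h3⟩

end NLSpace

/-! ### A calculus of definable relations -/

namespace NLSpace

open Relation

/-! ### Definable relations between objects that are represented by words -/

/-- Objects of type `X` are, depending on the input `w`, represented by words of length `len w`. -/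
class Ctx (α X : Type) where
  Γ : Type
  fin : Finite Γ
  ne : Nonempty Γ
  rep : ∀ w : List α, (Fin (len w) → Γ) → X → Prop
  functional : ∀ {w u x y}, rep w u x → rep w u y → x = y
  valid : Rec fun w u => ∃ x, rep w u x

attribute [instance] Ctx.fin Ctx.ne

variable {α X Y Z : Type} [Ctx α X] [Ctx α Y] [Ctx α Z]

/-- The object is represented by some word. -/
def InDom (w : List α) (x : X) : Prop := ∃ u, Ctx.rep w u x

/-- Relations that are recognized, in terms of the representations, by a transition system. -/
def Dfn (P : List α → X → Prop) : Prop := Rec fun w u => ∃ x, Ctx.rep w u x ∧ P w x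

/-- Functions that act on the representations letter by letter. -/
@[fun_prop]
def Proj (α : Type) {X Y : Type} [Ctx α X] [Ctx α Y] (f : X → Y) : Prop :=
  ∃ g : Ctx.Γ α X → Ctx.Γ α Y, ∀ (w : List α) u x, Ctx.rep w u x → Ctx.rep w (fun i => g (u i)) (f x)

instance : Ctx α (X × Y) where
  Γ := Ctx.Γ α X × Ctx.Γ α Y
  fin := inferInstance
  ne := inferInstance
  rep w u p := Ctx.rep w (fun i => (u i).1) p.1 ∧ Ctx.rep w (fun i => (u i).2) p.2
  functional h h' := Prod.ext (Ctx.functional h.1 h'.1) (Ctx.functional h.2 h'.2)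
  valid := (((Ctx.valid (α := α) (X := X)).comp Prod.fst).and
    ((Ctx.valid (α := α) (X := Y)).comp Prod.snd)).congr fun _ _ =>
      ⟨fun ⟨⟨x, hx⟩, ⟨y, hy⟩⟩ => ⟨(x, y), hx, hy⟩, fun ⟨p, h⟩ => ⟨⟨p.1, h.1⟩, ⟨p.2, h.2⟩⟩⟩

@[simp] theorem inDom_prod {w : List α} {p : X × Y} : InDom w p ↔ InDom w p.1 ∧ InDom w p.2 :=
  ⟨fun ⟨_, h⟩ => ⟨⟨_, h.1⟩, ⟨_, h.2⟩⟩, fun ⟨⟨u, h⟩, ⟨v, h'⟩⟩ => ⟨fun i => (u i, v i), h, h'⟩⟩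

namespace Proj

@[fun_prop] theorem id : Proj α fun x : X => x := ⟨fun a => a, fun _ _ _ h => h⟩

@[fun_prop] theorem comp {f : Y → Z} {g : X → Y} (hf : Proj α f) (hg : Proj α g) :
    Proj α fun x => f (g x) := by
  obtain ⟨a, ha⟩ := hf
  obtain ⟨b, hb⟩ := hg
  exact ⟨fun c => a (b c), fun w u x h => ha _ _ _ (hb _ _ _ h)⟩

@[fun_prop] theorem fst {f : X → Y × Z} (hf : Proj α f) : Proj α fun x => (f x).1 := by
  obtain ⟨a, ha⟩ := hf
  exact ⟨fun c => (a c).1, fun w u x h => (ha _ _ _ h).1⟩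

@[fun_prop] theorem snd {f : X → Y × Z} (hf : Proj α f) : Proj α fun x => (f x).2 := by
  obtain ⟨a, ha⟩ := hf
  exact ⟨fun c => (a c).2, fun w u x h => (ha _ _ _ h).2⟩

@[fun_prop] theorem prodMk {f : X → Y} {g : X → Z} (hf : Proj α f) (hg : Proj α g) :
    Proj α fun x => (f x, g x) := by
  obtain ⟨a, ha⟩ := hf
  obtain ⟨b, hb⟩ := hg
  exact ⟨fun c => (a c, b c), fun w u x h => ⟨ha _ _ _ h, hb _ _ _ h⟩⟩

theorem inDom {f : X → Y} (hf : Proj α f) {w : List α} {x : X} (h : InDom w x) : InDom w (f x) := by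
  obtain ⟨a, ha⟩ := hf
  obtain ⟨u, hu⟩ := h
  exact ⟨_, ha _ _ _ hu⟩

end Proj

namespace Dfn

theorem congr {P Q : List α → X → Prop} (h : Dfn P)
    (hPQ : ∀ w x, InDom w x → (P w x ↔ Q w x)) : Dfn Q :=
  Rec.congr h fun w u => exists_congr fun x => and_congr_right fun hx => hPQ w x ⟨u, hx⟩

theorem true : Dfn fun (_ : List α) (_ : X) => True :=
  Ctx.valid.congr fun w u => by simp

theorem and {P Q : List α → X → Prop} (hP : Dfn P) (hQ : Dfn Q) : Dfn fun w x => P w x ∧ Q w x :=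
  (Rec.and hP hQ).congr fun _ _ => ⟨fun ⟨⟨x, hx, h⟩, ⟨_, hy, h'⟩⟩ =>
    ⟨x, hx, h, Ctx.functional hy hx ▸ h'⟩, fun ⟨x, hx, h, h'⟩ => ⟨⟨x, hx, h⟩, ⟨x, hx, h'⟩⟩⟩

theorem or {P Q : List α → X → Prop} (hP : Dfn P) (hQ : Dfn Q) : Dfn fun w x => P w x ∨ Q w x :=
  (Rec.or hP hQ).congr fun w u => by
    simp only [← exists_or, ← and_or_left]

theorem comp {P : List α → Y → Prop} (hP : Dfn P) {f : X → Y} (hf : Proj α f) :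
    Dfn fun w x => P w (f x) := by
  obtain ⟨a, ha⟩ := hf
  refine ((Ctx.valid (α := α) (X := X)).and (Rec.comp hP a)).congr fun w u => ?_
  constructor
  · rintro ⟨⟨x, hx⟩, ⟨y, hy, h⟩⟩
    obtain rfl := Ctx.functional (ha _ _ _ hx) hy
    exact ⟨x, hx, h⟩
  · rintro ⟨x, hx, h⟩
    exact ⟨⟨x, hx⟩, ⟨_, ha _ _ _ hx, h⟩⟩

theorem exDom {P : List α → X → Y → Prop} (hP : Dfn fun w (p : X × Y) => P w p.1 p.2) :
    Dfn fun w x => ∃ y, InDom w y ∧ P w x y := by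
  refine (Rec.ex hP).congr fun w u => ?_
  constructor
  · rintro ⟨v, ⟨x, y⟩, ⟨hx, hy⟩, h⟩
    exact ⟨x, hx, y, ⟨v, hy⟩, h⟩
  · rintro ⟨x, hx, y, ⟨v, hy⟩, h⟩
    exact ⟨v, (x, y), ⟨hx, hy⟩, h⟩

/-- A system can guess only represented objects; `hdom` guarantees that this loses no witness. -/
theorem ex {P : List α → X → Y → Prop} (hP : Dfn fun w (p : X × Y) => P w p.1 p.2)
    (hdom : ∀ w x y, InDom w x → P w x y → InDom w y) : Dfn fun w x => ∃ y, P w x y :=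
  hP.exDom.congr fun w x hx =>
    exists_congr fun y => ⟨And.right, fun h => ⟨hdom w x y hx h, h⟩⟩

theorem transGen {R : List α → Z → X → X → Prop}
    (hR : Dfn fun w (p : Z × X × X) => R w p.1 p.2.1 p.2.2) :
    Dfn fun w (p : Z × X × X) =>
      TransGen (fun a b => InDom w b ∧ R w p.1 a b) p.2.1 p.2.2 := by
  refine ((Ctx.valid (α := α) (X := Z × X × X)).and (Rec.transGen hR)).congr fun w u => ?_
  -- An object may have many representations, so paths of words and paths of objects have to be
  -- compared for arbitrary representations of the end points. Intermediate objects are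
  -- representable because `R` is restricted to the domain.
  have key : ∀ {z a b ua ub}, Ctx.rep w (fun i => (u i).1) z → Ctx.rep w ua a → Ctx.rep w ub b →
      (TransGen (fun a b : Fin (len w) → Ctx.Γ α X => ∃ x : Z × X × X,
          Ctx.rep w (fun i => ((u i).1, a i, b i)) x ∧ R w x.1 x.2.1 x.2.2) ua ub ↔
        TransGen (fun a b => InDom w b ∧ R w z a b) a b) := by
    intro z a b ua ub hz ha hb
    constructor
    · intro h
      induction h generalizing b with
      | single h =>
        obtain ⟨⟨z', a', b'⟩, ⟨hz', ha', hb'⟩, hR⟩ := h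
        obtain rfl := Ctx.functional hz hz'
        obtain rfl := Ctx.functional ha ha'
        obtain rfl := Ctx.functional hb hb'
        exact .single ⟨⟨_, hb⟩, hR⟩
      | tail _ h ih =>
        obtain ⟨⟨z', a', b'⟩, ⟨hz', ha', hb'⟩, hR⟩ := h
        obtain rfl := Ctx.functional hz hz'
        obtain rfl := Ctx.functional hb hb'
        exact (ih ha').tail ⟨⟨_, hb⟩, hR⟩
    · intro h
      induction h generalizing ub with
      | single h => exact .single ⟨⟨z, a, _⟩, ⟨hz, ha, hb⟩, h.2⟩
      | tail hac h ih =>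
        obtain ⟨v, hv⟩ : InDom w _ := by
          rcases hac with h | ⟨_, h⟩ <;> exact h.1
        exact (ih hv).tail ⟨⟨z, _, _⟩, ⟨hz, hv, hb⟩, h.2⟩
  constructor
  · rintro ⟨⟨p, hp⟩, h⟩
    exact ⟨p, hp, (key hp.1 hp.2.1 hp.2.2).1 h⟩
  · rintro ⟨p, hp, h⟩
    exact ⟨⟨p, hp⟩, (key hp.1 hp.2.1 hp.2.2).2 h⟩

theorem rtg {R : List α → Z → X → X → Prop}
    (hR : Dfn fun w (p : Z × X × X) => R w p.1 p.2.1 p.2.2)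
    (heq : Dfn fun (_ : List α) (p : X × X) => p.1 = p.2) {f g : Z → X} (hf : Proj α f)
    (hg : Proj α g)
    (hdom : ∀ w z x y, InDom w z → InDom w x → R w z x y → InDom w y) :
    Dfn fun w z => ReflTransGen (R w z) (f z) (g z) := by
  refine ((heq.comp (f := fun z => (f z, g z)) (by fun_prop)).or
    ((transGen hR).comp (f := fun z => (z, f z, g z)) (by fun_prop))).congr fun w z hz => ?_
  have key : TransGen (fun a b => InDom w b ∧ R w z a b) (f z) (g z) ↔
      TransGen (R w z) (f z) (g z) := by
    constructor
    · exact TransGen.mono (fun a b h => h.2) _ _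
    · intro h
      have : ∀ {b}, TransGen (R w z) (f z) b →
          TransGen (fun a b => InDom w b ∧ R w z a b) (f z) b ∧ InDom w b := by
        intro b h
        induction h with
        | single h =>
          have := hdom w z _ _ hz (hf.inDom hz) h
          exact ⟨.single ⟨this, h⟩, this⟩
        | tail _ h ih =>
          have := hdom w z _ _ hz ih.2 h
          exact ⟨ih.1.tail ⟨this, h⟩, this⟩
      exact (this h).1
  rw [reflTransGen_iff_eq_or_transGen]
  simp only [key, eq_comm]

theorem of_rec {P : List α → X → Prop} {P' : ∀ w : List α, (Fin (len w) → Ctx.Γ α X) → Prop}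
    (h : Rec P') (total : ∀ (w : List α) (u : Fin (len w) → Ctx.Γ α X), ∃ x : X, Ctx.rep w u x)
    (hiff : ∀ (w : List α) u (x : X), Ctx.rep w u x → (P' w u ↔ P w x)) : Dfn P :=
  h.congr fun w u => ⟨fun h => let ⟨x, hx⟩ := total w u; ⟨x, hx, (hiff w u x hx).1 h⟩,
    fun ⟨x, hx, h⟩ => (hiff w u x hx).2 h⟩

end Dfn

theorem Rec.rgl {Γ : Type} [Finite Γ] [Nonempty Γ] {P : ∀ L, (Fin L → Γ) → Prop} (h : Rgl P) :
    Rec fun (w : List α) (u : Fin (len w) → Γ) => P _ u :=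
  Rec.base (fun _ => 0) (K := fun _ => P) fun _ => h

/-- Elements of a finite type are represented by constant words. -/
@[reducible] def Ctx.ofFinite (α A : Type) [Finite A] [Nonempty A] : Ctx α A where
  Γ := A
  fin := inferInstance
  ne := inferInstance
  rep w u a := ∀ i, u i = a
  functional {w u x y} h h' := (h ⟨0, len_pos w⟩).symm.trans (h' ⟨0, len_pos w⟩)
  valid := by
    have : Rgl fun L (u : Fin L → A) => ∃ x, ∀ i, u i = x := by
      have h : ∀ s : Finset A, Rgl fun L (u : Fin L → A) => ∃ x ∈ s, ∀ i, u i = x := by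
        classical
        intro s
        induction s using Finset.induction_on with
        | empty => exact (Rgl.const False).congr fun L u => by simp
        | insert a s _ ih => exact ((Rgl.all (· = a)).or ih).congr fun L u => by simp
      have := Fintype.ofFinite A
      exact (h Finset.univ).congr fun L u => by simp
    exact Rec.rgl this

instance : Ctx α Unit := Ctx.ofFinite α Unit
instance : Ctx α Bool := Ctx.ofFinite α Bool

/-- Words as objects. -/
structure Word (Γ : Type) where
  toList : List Γ

instance {Γ : Type} [Finite Γ] [Nonempty Γ] : Ctx α (Word Γ) where
  Γ := Γ
  fin := inferInstance
  ne := inferInstance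
  rep w u x := x = ⟨List.ofFn u⟩
  functional h h' := h.trans h'.symm
  valid := (Rec.rgl (Rgl.const True)).congr fun w u => by simp

/-! ### Numbers as objects -/

/-- A representation of the numbers below some bound. -/
class NumCtx (α : Type) extends Ctx α ℕ where
  bound : List α → ℕ
  bound_pos : ∀ w, 0 < bound w
  inDom_iff : ∀ w (n : ℕ), InDom w n ↔ n < bound w
  eq : Dfn fun (_ : List α) (p : ℕ × ℕ) => p.1 = p.2
  succ : Dfn fun (_ : List α) (p : ℕ × ℕ) => p.2 = p.1 + 1
  zero : Dfn fun (_ : List α) (n : ℕ) => n = 0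
  last : Dfn fun w (n : ℕ) => n = bound w - 1

theorem val_add_one_lt {B L : ℕ} (u : Fin L → Fin B) (h : ∃ i, (u i : ℕ) + 1 < B) :
    val u + 1 < B ^ L := by
  have key : ∀ l : List (Fin B), (∃ a ∈ l, (a : ℕ) + 1 < B) → listVal l + 1 < B ^ l.length := by
    intro l
    induction l with
    | nil => simp
    | cons a l ih =>
      intro h
      have ha := a.2
      rw [listVal_cons, List.length_cons, pow_succ]
      by_cases h' : (a : ℕ) + 1 < B
      · have := listVal_lt l
        nlinarith
      · have h2 : ∃ a ∈ l, (a : ℕ) + 1 < B := by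
          obtain ⟨b, hb, hb'⟩ := h
          rcases List.mem_cons.1 hb with rfl | hb
          · exact absurd hb' h'
          · exact ⟨b, hb, hb'⟩
        have := ih h2
        nlinarith
  have := key (List.ofFn u) (by simpa using h)
  simpa [val] using this

theorem val_last {B L : ℕ} (u : Fin L → Fin B) (h : ∀ i, (u i : ℕ) + 1 = B) :
    val u + 1 = B ^ L := by
  have key : ∀ l : List (Fin B), (∀ a ∈ l, (a : ℕ) + 1 = B) → listVal l + 1 = B ^ l.length := by
    intro l
    induction l with
    | nil => simp
    | cons a l ih =>
      intro h
      have h1 := h a (by simp)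
      have h2 := ih fun b hb => h b (by simp [hb])
      rw [listVal_cons, List.length_cons, pow_succ, ← h2, add_mul]
      nlinarith
  have := key (List.ofFn u) (by simpa using h)
  simpa [val] using this

/-- Numbers in positional notation. -/
@[reducible] def numCtx (α : Type) (B : ℕ) (hB : 2 ≤ B) : NumCtx α :=
  have : NeZero B := ⟨by omega⟩
  let C : Ctx α ℕ := {
    Γ := Fin B
    fin := inferInstance
    ne := inferInstance
    rep := fun w u n => n = val u
    functional := fun h h' => h.trans h'.symm
    valid := (Rec.rgl (Rgl.const True)).congr fun w u => by simp }
  { C with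
    bound := fun w => B ^ len w
    bound_pos := fun w => by positivity
    inDom_iff := fun w n => ⟨fun ⟨u, hu⟩ => hu ▸ val_lt u, fun h =>
      let ⟨u, hu⟩ := exists_val_eq h; ⟨u, hu.symm⟩⟩
    eq := by
      refine Dfn.of_rec (Rec.rgl (Rgl.all fun d : Fin B × Fin B => d.1 = d.2))
        (fun w u => ⟨(_, _), rfl, rfl⟩) ?_
      rintro w u ⟨x, y⟩ ⟨rfl, rfl⟩
      exact ⟨fun h => congrArg val (funext h), fun h => congrFun (val_injective h)⟩
    succ := by
      refine Dfn.of_rec (Rec.rgl (Rgl.succ B)) (fun w u => ⟨(_, _), rfl, rfl⟩) ?_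
      rintro w u ⟨x, y⟩ ⟨rfl, rfl⟩
      exact Iff.rfl
    zero := by
      refine Dfn.of_rec (Rec.rgl (Rgl.all fun d : Fin B => (d : ℕ) = 0)) (fun w u => ⟨_, rfl⟩) ?_
      rintro w u x rfl
      exact (val_eq_zero (by omega) u).symm
    last := by
      refine Dfn.of_rec (Rec.rgl (Rgl.all fun d : Fin B => (d : ℕ) + 1 = B))
        (fun w u => ⟨_, rfl⟩) ?_
      rintro w u x rfl
      constructor
      · intro h
        have := val_last u h
        omega
      · intro h i
        by_contra hi
        have := val_add_one_lt u ⟨i, lt_of_le_of_ne (u i).2 hi⟩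
        omega }

end NLSpace

/-! ### Closure under complement -/

namespace NLSpace

open Relation

/-! ### Inductive counting -/

section Counting

open Classical in
/-- The number of elements of `A` below `m`. -/
noncomputable def cnt (A : ℕ → Prop) (m : ℕ) : ℕ := Nat.count A m

theorem cnt_zero (A : ℕ → Prop) : cnt A 0 = 0 := by classical exact Nat.count_zero A

theorem cnt_succ_pos {A : ℕ → Prop} {m : ℕ} (h : A m) : cnt A (m + 1) = cnt A m + 1 := by
  classical simp [cnt, Nat.count_succ, h]

theorem cnt_succ_neg {A : ℕ → Prop} {m : ℕ} (h : ¬ A m) : cnt A (m + 1) = cnt A m := by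
  classical simp [cnt, Nat.count_succ, h]

theorem cnt_le (A : ℕ → Prop) (m : ℕ) : cnt A m ≤ m := by classical exact Nat.count_le _

theorem cnt_mono {A A' : ℕ → Prop} {m : ℕ} (h : ∀ i < m, A i → A' i) : cnt A m ≤ cnt A' m := by
  induction m with
  | zero => simp [cnt_zero]
  | succ m ih =>
    have ih := ih fun i hi => h i (by omega)
    by_cases hA : A m
    · rw [cnt_succ_pos hA, cnt_succ_pos (h m (by omega) hA)]; omega
    · rw [cnt_succ_neg hA]
      by_cases hA' : A' m
      · rw [cnt_succ_pos hA']; omega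
      · rwa [cnt_succ_neg hA']

/-- The pigeonhole argument behind inductive counting: a subset that is not smaller exhausts the
set. -/
theorem imp_of_cnt_le {A A' : ℕ → Prop} {m : ℕ} (h : ∀ i < m, A i → A' i)
    (hle : cnt A' m ≤ cnt A m) : ∀ i < m, A' i → A i := by
  induction m with
  | zero => intro i hi; omega
  | succ m ih =>
    have h' : ∀ i < m, A i → A' i := fun i hi => h i (by omega)
    have hm := cnt_mono h'
    intro i hi hi'
    by_cases hA : A m
    · rw [cnt_succ_pos hA, cnt_succ_pos (h m (by omega) hA)] at hle
      rcases Nat.lt_succ_iff_lt_or_eq.1 hi with hi | rfl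
      · exact ih h' (by omega) i hi hi'
      · exact hA
    · rw [cnt_succ_neg hA] at hle
      by_cases hA' : A' m
      · rw [cnt_succ_pos hA'] at hle; omega
      · rw [cnt_succ_neg hA'] at hle
        rcases Nat.lt_succ_iff_lt_or_eq.1 hi with hi | rfl
        · exact ih h' hle i hi hi'
        · exact absurd hi' hA'

theorem cnt_congr {A A' : ℕ → Prop} {m : ℕ} (h : ∀ i < m, A i ↔ A' i) : cnt A m = cnt A' m :=
  le_antisymm (cnt_mono fun i hi => (h i hi).1) (cnt_mono fun i hi => (h i hi).2)

/-- Going through the numbers below `M`, the counter may be increased when `A` holds and may be left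
unchanged when `B` holds. -/
def CountStep (M : ℕ) (A B : ℕ → Prop) (p q : ℕ × ℕ) : Prop :=
  q.1 < M ∧ q.2 < M ∧ q.1 = p.1 + 1 ∧ ((q.2 = p.2 + 1 ∧ A p.1) ∨ (q.2 = p.2 ∧ B p.1))

/-- If both membership and non-membership can be certified, every element is decided and the final
count is forced. -/
theorem rtg_countStep_exact {M : ℕ} {A B : ℕ → Prop} {m c : ℕ} (hm : m < M)
    (hAB : ∀ i < m, B i ↔ ¬ A i) :
    ReflTransGen (CountStep M A B) (0, 0) (m, c) ↔ c = cnt A m := by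
  induction m generalizing c with
  | zero =>
    rw [cnt_zero]
    constructor
    · intro h
      rcases ReflTransGen.cases_tail h with h | ⟨b, -, h⟩
      · exact (Prod.mk.inj h).2
      · simp [CountStep] at h
    · rintro rfl; exact .refl
  | succ m ih =>
    have ih := fun c => ih (c := c) (by omega) fun i hi => hAB i (by omega)
    have hB := hAB m (by omega)
    constructor
    · intro h
      rcases ReflTransGen.cases_tail h with h | ⟨⟨b, c'⟩, hb, -, -, h1, h2⟩
      · simp at h
      · obtain rfl : m = b := by simpa using h1
        obtain rfl := (ih c').1 hb
        rcases h2 with ⟨h2, hA⟩ | ⟨h2, hA⟩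
        · rw [cnt_succ_pos hA]; exact h2
        · rw [cnt_succ_neg (hB.1 hA)]; exact h2
    · rintro rfl
      refine .tail ((ih _).2 rfl) ⟨hm, (cnt_le A _).trans_lt hm, rfl, ?_⟩
      by_cases hA : A m
      · exact Or.inl ⟨cnt_succ_pos hA, hA⟩
      · exact Or.inr ⟨cnt_succ_neg hA, hB.2 hA⟩

/-- Elements may be passed over at will, so a count is only a lower bound; in return only membership
in `A` has to be certified. -/
theorem rtg_countStep_lazy {M : ℕ} {A : ℕ → Prop} {m c : ℕ} (hm : m < M) :
    ReflTransGen (CountStep M A fun _ => True) (0, 0) (m, c) ↔ c ≤ cnt A m := by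
  induction m generalizing c with
  | zero =>
    rw [cnt_zero]
    constructor
    · intro h
      rcases ReflTransGen.cases_tail h with h | ⟨b, -, h⟩
      · exact (Prod.mk.inj h).2.le
      · simp [CountStep] at h
    · intro h
      obtain rfl : c = 0 := by omega
      exact .refl
  | succ m ih =>
    have ih := fun c => ih (c := c) (by omega)
    constructor
    · intro h
      rcases ReflTransGen.cases_tail h with h | ⟨⟨b, c'⟩, hb, -, -, h1, h2⟩
      · simp at h
      · obtain rfl : m = b := by simpa using h1
        have := (ih c').1 hb
        dsimp only at h2 ⊢
        have hle : cnt A m ≤ cnt A (m + 1) := by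
          by_cases hA : A m
          · rw [cnt_succ_pos hA]; omega
          · rw [cnt_succ_neg hA]
        rcases h2 with ⟨h2, hA⟩ | ⟨h2, -⟩
        · rw [cnt_succ_pos hA]; omega
        · omega
    · intro h
      have hc : c < M := (h.trans (cnt_le A _)).trans_lt hm
      by_cases hle : c ≤ cnt A m
      · exact .tail ((ih _).2 hle) ⟨hm, hc, rfl, Or.inr ⟨rfl, trivial⟩⟩
      · have hA : A m := by
          by_contra hA
          rw [cnt_succ_neg hA] at h
          exact hle h
        rw [cnt_succ_pos hA] at h
        exact .tail ((ih (c - 1)).2 (by omega)) ⟨hm, hc, rfl, Or.inl ⟨by simp only; omega, hA⟩⟩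

variable (S : ℕ → Prop) (E : ℕ → ℕ → Prop)

/-- The points that are reached from `S` in less than `d` steps. -/
def Ball : ℕ → ℕ → Prop
  | 0 => fun _ => False
  | d + 1 => fun y => S y ∨ ∃ x, Ball d x ∧ E x y

theorem Ball.succ {S E} {d y : ℕ} (h : Ball S E d y) : Ball S E (d + 1) y := by
  induction d generalizing y with
  | zero => exact h.elim
  | succ d ih => exact h.imp_right fun ⟨x, hx, hxy⟩ => ⟨x, ih hx, hxy⟩

theorem ball_of_reach {x y : ℕ} (hx : S x) (h : ReflTransGen E x y) : ∃ d, Ball S E d y := by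
  induction h with
  | refl => exact ⟨1, Or.inl hx⟩
  | tail _ h ih => exact ih.imp' Nat.succ fun d hd => Or.inr ⟨_, hd, h⟩

theorem reach_of_ball {d y : ℕ} (h : Ball S E d y) : ∃ x, S x ∧ ReflTransGen E x y := by
  induction d generalizing y with
  | zero => exact h.elim
  | succ d ih =>
    rcases h with h | ⟨z, hz, h⟩
    · exact ⟨y, h, .refl⟩
    · exact (ih hz).imp fun x hx => ⟨hx.1, hx.2.tail h⟩

/-- Walking backwards from `y` while counting down turns membership in a ball into reachability
between pairs of numbers, which a system can follow. -/
theorem ball_iff_rtg {d y : ℕ} : Ball S E d y ↔ ∃ q : ℕ × ℕ,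
    ReflTransGen (fun p q : ℕ × ℕ => p.1 = q.1 + 1 ∧ E q.2 p.2) (d, y) q ∧
      (∃ e, q.1 = e + 1) ∧ S q.2 := by
  constructor
  · intro h
    induction d generalizing y with
    | zero => exact h.elim
    | succ d ih =>
      rcases h with h | ⟨x, hx, h⟩
      · exact ⟨_, .refl, ⟨d, rfl⟩, h⟩
      · obtain ⟨q, h1, h2⟩ := ih hx
        exact ⟨q, .head ⟨rfl, h⟩ h1, h2⟩
  · rintro ⟨q, h, ⟨e, he⟩, hq⟩
    have : ∀ p : ℕ × ℕ, ReflTransGen (fun p q : ℕ × ℕ => p.1 = q.1 + 1 ∧ E q.2 p.2) p q →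
        Ball S E p.1 p.2 := by
      intro p hp
      induction hp using ReflTransGen.head_induction_on with
      | refl => rw [he]; exact Or.inl hq
      | head h _ ih => rw [h.1]; exact Or.inr ⟨_, ih, h.2⟩
    exact this _ h

variable (M : ℕ)

/-- Given that there are `c` points in `Ball d`, the point `y` is not in `Ball (d + 1)`. -/
def NotInNext (d c y : ℕ) : Prop :=
  ¬ S y ∧ ReflTransGen (CountStep M (fun i => Ball S E d i ∧ ¬ E i y) fun _ => True) (0, 0) (M - 1, c)

/-- Given that there are `c` points in `Ball d`, there are `c'` points in `Ball (d + 1)`. -/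
def NextCount (d c c' : ℕ) : Prop :=
  ReflTransGen (CountStep M (fun i => S i ∨ ∃ x, Ball S E d x ∧ E x i) fun i => NotInNext S E M d c i)
    (0, 0) (M - 1, c')

variable {S E M}

/-- The heart of inductive counting. When the exact size of a ball is known, exhibiting that many
members without an edge to `y` exhibits all members, so none of them has such an edge. All points
lie below `M - 1`, which leaves room for a counter running from `0` to `M - 1`. -/
theorem notInNext_iff (hM : 0 < M) {d y : ℕ} (hE : ∀ x y, E x y → x + 1 < M ∧ y + 1 < M)
    (hS : ∀ x, S x → x + 1 < M) :
    NotInNext S E M d (cnt (Ball S E d) (M - 1)) y ↔ ¬ Ball S E (d + 1) y := by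
  have hb : ∀ x, Ball S E d x → x < M - 1 := by
    intro x hx
    rcases d with _ | d
    · exact hx.elim
    · rcases hx with hx | ⟨z, -, h⟩
      · have := hS x hx; omega
      · have := (hE z x h).2; omega
  rw [NotInNext, rtg_countStep_lazy (by omega), Ball]
  constructor
  · rintro ⟨h1, h2⟩ (h | ⟨x, hx, h⟩)
    · exact h1 h
    · exact (imp_of_cnt_le (fun i _ h => h.1) h2 x (hb x hx) hx).2 h
  · intro h
    refine ⟨fun h' => h (Or.inl h'), cnt_mono fun i _ hi => ⟨hi, fun h' => h (Or.inr ⟨i, hi, h'⟩)⟩⟩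

theorem nextCount_iff (hM : 0 < M) {d c' : ℕ} (hE : ∀ x y, E x y → x + 1 < M ∧ y + 1 < M)
    (hS : ∀ x, S x → x + 1 < M) :
    NextCount S E M d (cnt (Ball S E d) (M - 1)) c' ↔ c' = cnt (Ball S E (d + 1)) (M - 1) := by
  rw [NextCount, rtg_countStep_exact (by omega)]
  · rfl
  · intro i _
    exact notInNext_iff hM hE hS

theorem rtg_nextCount_iff (hM : 0 < M) {d c : ℕ} (hd : d < M)
    (hE : ∀ x y, E x y → x + 1 < M ∧ y + 1 < M) (hS : ∀ x, S x → x + 1 < M) :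
    ReflTransGen (fun p q : ℕ × ℕ => q.1 < M ∧ q.2 < M ∧ q.1 = p.1 + 1 ∧ NextCount S E M p.1 p.2 q.2)
      (0, 0) (d, c) ↔ c = cnt (Ball S E d) (M - 1) := by
  induction d generalizing c with
  | zero =>
    have : cnt (Ball S E 0) (M - 1) = 0 := by
      have h0 : cnt (fun _ => False) (M - 1) = 0 := by
        classical simp [cnt, Nat.count_eq_card_filter_range]
      exact (cnt_congr fun i _ => Iff.rfl).trans h0
    rw [this]
    constructor
    · intro h
      rcases ReflTransGen.cases_tail h with h | ⟨b, -, h⟩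
      · exact (Prod.mk.inj h).2
      · simp at h
    · rintro rfl; exact .refl
  | succ d ih =>
    have ih := fun c => ih (c := c) (by omega)
    constructor
    · intro h
      rcases ReflTransGen.cases_tail h with h | ⟨⟨b, c'⟩, hb, -, -, h1, h2⟩
      · simp at h
      · obtain rfl : d = b := by simpa using h1
        obtain rfl := (ih c').1 hb
        exact (nextCount_iff hM hE hS).1 h2
    · rintro rfl
      refine .tail ((ih _).2 rfl) ⟨hd, ?_, rfl, (nextCount_iff hM hE hS).2 rfl⟩
      exact (cnt_le _ _).trans_lt (by omega)

/-- The criterion of Immerman and Szelepcsényi for non-reachability. -/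
theorem not_reach_iff (hM : 0 < M) (hE : ∀ x y, E x y → x + 1 < M ∧ y + 1 < M)
    (hS : ∀ x, S x → x + 1 < M) (F : ℕ → Prop) :
    (¬ ∃ x y, S x ∧ ReflTransGen E x y ∧ F y) ↔ ∃ d c, d < M ∧ c < M ∧
      ReflTransGen (fun p q : ℕ × ℕ => q.1 < M ∧ q.2 < M ∧ q.1 = p.1 + 1 ∧
        NextCount S E M p.1 p.2 q.2) (0, 0) (d, c) ∧ NextCount S E M d c c ∧
      ReflTransGen (CountStep M (fun i => Ball S E d i ∧ ¬ F i) fun _ => True) (0, 0) (M - 1, c) := by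
  have hb : ∀ d x, Ball S E d x → x < M - 1 := by
    intro d x hx
    rcases d with _ | d
    · exact hx.elim
    · rcases hx with hx | ⟨z, -, h⟩
      · have := hS x hx; omega
      · have := (hE z x h).2; omega
  constructor
  · intro h
    -- The balls increase and have at most `M - 1` points, so their sizes cannot grow `M` times.
    obtain ⟨d, hd, hstable⟩ : ∃ d < M,
        cnt (Ball S E (d + 1)) (M - 1) = cnt (Ball S E d) (M - 1) := by
      by_contra! hne
      have : ∀ d ≤ M, d ≤ cnt (Ball S E d) (M - 1) := by
        intro d
        induction d with
        | zero => intro _; exact Nat.zero_le _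
        | succ d ih =>
          intro hd
          have h1 := ih (by omega)
          have h2 := hne d (by omega)
          have h3 : cnt (Ball S E d) (M - 1) ≤ cnt (Ball S E (d + 1)) (M - 1) :=
            cnt_mono fun i _ h => h.succ
          omega
      have h1 := this M le_rfl
      have h2 := cnt_le (Ball S E M) (M - 1)
      omega
    refine ⟨d, _, hd, (cnt_le _ _).trans_lt (by omega), (rtg_nextCount_iff hM hd hE hS).2 rfl,
      (nextCount_iff hM hE hS).2 hstable.symm, (rtg_countStep_lazy (by omega)).2 ?_⟩
    refine cnt_mono fun i _ hi => ⟨hi, fun hF => h ?_⟩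
    obtain ⟨x, hx, hxi⟩ := reach_of_ball S E hi
    exact ⟨x, i, hx, hxi, hF⟩
  · rintro ⟨d, c, hd, -, h1, h2, h3⟩ ⟨x, y, hx, hxy, hF⟩
    obtain rfl := (rtg_nextCount_iff hM hd hE hS).1 h1
    have h2 := (nextCount_iff hM hE hS).1 h2
    rw [rtg_countStep_lazy (by omega)] at h3
    -- Once two consecutive balls have the same size they coincide, and then the ball contains
    -- everything reachable.
    have hsub : ∀ k i, Ball S E k i → Ball S E d i := by
      intro k
      induction k with
      | zero => intro i h; exact h.elim
      | succ k ih =>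
        intro i h
        have h' : Ball S E (d + 1) i := h.imp_right fun ⟨x, hx, hxi⟩ => ⟨x, ih x hx, hxi⟩
        exact imp_of_cnt_le (fun i _ h => h.succ) h2.symm.le i (hb _ _ h') h'
    obtain ⟨k, hk⟩ := ball_of_reach S E hx hxy
    have hy := hsub k y hk
    exact (imp_of_cnt_le (fun i _ h => h.1) h3 y (hb _ _ hy) hy).2 hF

end Counting

theorem Dfn.eq_prod {α X Y : Type} [Ctx α X] [Ctx α Y]
    (hX : Dfn fun (_ : List α) (p : X × X) => p.1 = p.2)
    (hY : Dfn fun (_ : List α) (p : Y × Y) => p.1 = p.2) :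
    Dfn fun (_ : List α) (p : (X × Y) × X × Y) => p.1 = p.2 :=
  ((hX.comp (f := fun p : (X × Y) × X × Y => (p.1.1, p.2.1)) (by fun_prop)).and
    (hY.comp (f := fun p : (X × Y) × X × Y => (p.1.2, p.2.2)) (by fun_prop))).congr
      fun w p _ => (Prod.ext_iff (x := p.1) (y := p.2)).symm

/-! ### Closure under complementation -/

section Complement

variable {α Z : Type} [NumCtx α] [Ctx α Z]

open NumCtx

theorem Dfn.eq_num_prod : Dfn fun (_ : List α) (p : (ℕ × ℕ) × ℕ × ℕ) => p.1 = p.2 :=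
  eq_prod NumCtx.eq NumCtx.eq

/-- For an abstract representation of numbers, the constant zero is not known to act letter by
letter. It enters as a quantified number that satisfies `zero`. -/
theorem Dfn.rtg_from_zero {R : List α → Z → ℕ × ℕ → ℕ × ℕ → Prop}
    (hR : Dfn fun w (p : Z × (ℕ × ℕ) × ℕ × ℕ) => R w p.1 p.2.1 p.2.2)
    (hdom : ∀ w z x y, R w z x y → y.1 < bound w ∧ y.2 < bound w) :
    Dfn fun w (p : Z × ℕ × ℕ) => ReflTransGen (R w p.1) (0, 0) p.2 := by
  have h1 : Dfn fun w (p : (Z × ℕ × ℕ) × ℕ) => ReflTransGen (R w p.1.1) (p.2, p.2) p.1.2 :=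
    Dfn.rtg (R := fun w p => R w p.1.1)
      (hR.comp (f := fun p : ((Z × ℕ × ℕ) × ℕ) × (ℕ × ℕ) × ℕ × ℕ => (p.1.1.1, p.2.1, p.2.2))
        (by fun_prop)) Dfn.eq_num_prod (f := fun p : (Z × ℕ × ℕ) × ℕ => (p.2, p.2))
      (g := fun p : (Z × ℕ × ℕ) × ℕ => p.1.2) (by fun_prop) (by fun_prop)
      (fun w z x y _ _ h => inDom_prod.2 ⟨(inDom_iff w _).2 (hdom _ _ _ _ h).1,
        (inDom_iff w _).2 (hdom _ _ _ _ h).2⟩)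
  refine ((h1.and (NumCtx.zero.comp (f := fun p : (Z × ℕ × ℕ) × ℕ => p.2)
    (by fun_prop))).exDom (P := fun w x y => ReflTransGen (R w x.1) (y, y) x.2 ∧ y = 0)).congr
    fun w p _ => ?_
  constructor
  · rintro ⟨_, -, h, rfl⟩; exact h
  · intro h; exact ⟨0, (inDom_iff w 0).2 (bound_pos w), h, rfl⟩

theorem Dfn.countStep {A B : List α → Z → ℕ → Prop} (hA : Dfn fun w (p : Z × ℕ) => A w p.1 p.2)
    (hB : Dfn fun w (p : Z × ℕ) => B w p.1 p.2) :
    Dfn fun w (p : Z × ℕ) =>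
      ReflTransGen (CountStep (bound w) (A w p.1) (B w p.1)) (0, 0) (bound w - 1, p.2) := by
  have h1 : Dfn fun w (p : Z × (ℕ × ℕ) × ℕ × ℕ) =>
      CountStep (bound w) (A w p.1) (B w p.1) p.2.1 p.2.2 := by
    refine ((NumCtx.succ.comp (f := fun p : Z × (ℕ × ℕ) × ℕ × ℕ => (p.2.1.1, p.2.2.1))
      (by fun_prop)).and (((NumCtx.succ.comp (f := fun p : Z × (ℕ × ℕ) × ℕ × ℕ => (p.2.1.2, p.2.2.2))
      (by fun_prop)).and (hA.comp (f := fun p : Z × (ℕ × ℕ) × ℕ × ℕ => (p.1, p.2.1.1))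
      (by fun_prop))).or ((NumCtx.eq.comp (f := fun p : Z × (ℕ × ℕ) × ℕ × ℕ => (p.2.2.2, p.2.1.2))
      (by fun_prop)).and (hB.comp (f := fun p : Z × (ℕ × ℕ) × ℕ × ℕ => (p.1, p.2.1.1))
      (by fun_prop))))).congr fun w p hp => ?_
    simp only [inDom_prod, inDom_iff] at hp
    simp only [CountStep, hp, true_and]
  have h2 := Dfn.rtg_from_zero (R := fun w z => CountStep (bound w) (A w z) (B w z)) h1
    fun w z x y h => ⟨h.1, h.2.1⟩
  refine (((h2.comp (f := fun p : (Z × ℕ) × ℕ => (p.1.1, p.2, p.1.2)) (by fun_prop)).and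
    (NumCtx.last.comp (f := fun p : (Z × ℕ) × ℕ => p.2) (by fun_prop))).exDom
    (P := fun w x y => ReflTransGen (CountStep (bound w) (A w x.1) (B w x.1)) (0, 0) (y, x.2) ∧
      y = bound w - 1)).congr fun w p _ => ?_
  constructor
  · rintro ⟨_, -, h, rfl⟩; exact h
  · intro h
    exact ⟨_, (inDom_iff w _).2 (Nat.sub_lt (bound_pos w) one_pos), h, rfl⟩

variable {S : List α → Z → ℕ → Prop} {E : List α → ℕ → ℕ → Prop} {F : List α → ℕ → Prop}

theorem Dfn.ball (hS : Dfn fun w (p : Z × ℕ) => S w p.1 p.2)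
    (hE : Dfn fun w (p : ℕ × ℕ) => E w p.1 p.2)
    (hE' : ∀ w x y, E w x y → x + 1 < bound w ∧ y + 1 < bound w) :
    Dfn fun w (p : Z × ℕ × ℕ) => Ball (S w p.1) (E w) p.2.1 p.2.2 := by
  have h1 : Dfn fun w (p : (Z × ℕ × ℕ) × ℕ × ℕ) =>
      ReflTransGen (fun p q : ℕ × ℕ => p.1 = q.1 + 1 ∧ E w q.2 p.2) p.1.2 p.2 := by
    refine Dfn.rtg (R := fun w _ p q => p.1 = q.1 + 1 ∧ E w q.2 p.2)
      ((NumCtx.succ.comp (f := fun p : ((Z × ℕ × ℕ) × ℕ × ℕ) × (ℕ × ℕ) × ℕ × ℕ =>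
        (p.2.2.1, p.2.1.1)) (by fun_prop)).and
      (hE.comp (f := fun p : ((Z × ℕ × ℕ) × ℕ × ℕ) × (ℕ × ℕ) × ℕ × ℕ =>
        (p.2.2.2, p.2.1.2)) (by fun_prop))) Dfn.eq_num_prod
      (f := fun p : (Z × ℕ × ℕ) × ℕ × ℕ => p.1.2) (g := fun p : (Z × ℕ × ℕ) × ℕ × ℕ => p.2)
      (by fun_prop) (by fun_prop) fun w z x y _ hx h => ?_
    rw [inDom_prod, inDom_iff, inDom_iff] at hx ⊢
    have := (hE' _ _ _ h.2).1
    omega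
  have h2 : Dfn fun (_ : List α) (n : ℕ) => ∃ e, n = e + 1 :=
    Dfn.ex (P := fun _ n e => n = e + 1)
      (NumCtx.succ.comp (f := fun p : ℕ × ℕ => (p.2, p.1)) (by fun_prop))
      (by intro w x y hx h; rw [inDom_iff] at hx ⊢; omega)
  refine ((h1.and ((h2.comp (f := fun p : (Z × ℕ × ℕ) × ℕ × ℕ => p.2.1) (by fun_prop)).and
    (hS.comp (f := fun p : (Z × ℕ × ℕ) × ℕ × ℕ => (p.1.1, p.2.2)) (by fun_prop)))).ex
    (P := fun w (p : Z × ℕ × ℕ) (q : ℕ × ℕ) =>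
      ReflTransGen (fun p q : ℕ × ℕ => p.1 = q.1 + 1 ∧ E w q.2 p.2) p.2 q ∧
        (∃ e, q.1 = e + 1) ∧ S w p.1 q.2) ?_).congr fun w p _ => (ball_iff_rtg _ _).symm
  rintro w p q hp ⟨h, -⟩
  have hp := (inDom_prod.1 hp).2
  induction h with
  | refl => exact hp
  | tail _ h ih =>
    rw [inDom_prod, inDom_iff, inDom_iff] at ih ⊢
    have := (hE' _ _ _ h.2).1
    omega

theorem Dfn.notInNext (hS : Dfn fun w (p : Z × ℕ) => S w p.1 p.2)
    (hS_not : Dfn fun w (p : Z × ℕ) => ¬ S w p.1 p.2) (hE : Dfn fun w (p : ℕ × ℕ) => E w p.1 p.2)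
    (hE_not : Dfn fun w (p : ℕ × ℕ) => ¬ E w p.1 p.2)
    (hE' : ∀ w x y, E w x y → x + 1 < bound w ∧ y + 1 < bound w) :
    Dfn fun w (p : Z × ℕ × ℕ × ℕ) =>
      NotInNext (S w p.1) (E w) (bound w) p.2.1 p.2.2.1 p.2.2.2 := by
  refine (hS_not.comp (f := fun p : Z × ℕ × ℕ × ℕ => (p.1, p.2.2.2)) (by fun_prop)).and ?_
  exact (Dfn.countStep (Z := Z × ℕ × ℕ × ℕ)
    (A := fun w p i => Ball (S w p.1) (E w) p.2.1 i ∧ ¬ E w i p.2.2.2) (B := fun _ _ _ => True)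
    (((Dfn.ball hS hE hE').comp (f := fun p : (Z × ℕ × ℕ × ℕ) × ℕ => (p.1.1, p.1.2.1, p.2))
      (by fun_prop)).and (hE_not.comp (f := fun p : (Z × ℕ × ℕ × ℕ) × ℕ => (p.2, p.1.2.2.2))
      (by fun_prop))) Dfn.true).comp (f := fun p : Z × ℕ × ℕ × ℕ => (p, p.2.2.1)) (by fun_prop)

theorem Dfn.nextCount (hS : Dfn fun w (p : Z × ℕ) => S w p.1 p.2)
    (hS_not : Dfn fun w (p : Z × ℕ) => ¬ S w p.1 p.2) (hE : Dfn fun w (p : ℕ × ℕ) => E w p.1 p.2)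
    (hE_not : Dfn fun w (p : ℕ × ℕ) => ¬ E w p.1 p.2)
    (hE' : ∀ w x y, E w x y → x + 1 < bound w ∧ y + 1 < bound w) :
    Dfn fun w (p : Z × ℕ × ℕ × ℕ) =>
      NextCount (S w p.1) (E w) (bound w) p.2.1 p.2.2.1 p.2.2.2 := by
  refine (Dfn.countStep (Z := Z × ℕ × ℕ × ℕ)
    (A := fun w p i => S w p.1 i ∨ ∃ x, Ball (S w p.1) (E w) p.2.1 x ∧ E w x i)
    (B := fun w p i => NotInNext (S w p.1) (E w) (bound w) p.2.1 p.2.2.1 i) ?_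
    ((Dfn.notInNext hS hS_not hE hE_not hE').comp
      (f := fun p : (Z × ℕ × ℕ × ℕ) × ℕ => (p.1.1, p.1.2.1, p.1.2.2.1, p.2)) (by fun_prop))).comp
    (f := fun p : Z × ℕ × ℕ × ℕ => (p, p.2.2.2)) (by fun_prop)
  refine (hS.comp (f := fun p : (Z × ℕ × ℕ × ℕ) × ℕ => (p.1.1, p.2)) (by fun_prop)).or ?_
  refine Dfn.ex (X := (Z × ℕ × ℕ × ℕ) × ℕ)
    (P := fun w p x => Ball (S w p.1.1) (E w) p.1.2.1 x ∧ E w x p.2)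
    (((Dfn.ball hS hE hE').comp (f := fun p : ((Z × ℕ × ℕ × ℕ) × ℕ) × ℕ => (p.1.1.1, p.1.1.2.1, p.2))
      (by fun_prop)).and (hE.comp (f := fun p : ((Z × ℕ × ℕ × ℕ) × ℕ) × ℕ => (p.2, p.1.2))
      (by fun_prop))) ?_
  intro w x y _ h
  have := (hE' _ _ _ h.2).1
  exact (inDom_iff w _).2 (by omega)

/-- Complementation is not yet available, so the negations of `S`, `E` and `F` are assumed. They
pose no problem in the application, where these are regular conditions, consulting at most one input
letter. -/
theorem Dfn.not_reach (hS : Dfn fun w (p : Z × ℕ) => S w p.1 p.2)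
    (hS_not : Dfn fun w (p : Z × ℕ) => ¬ S w p.1 p.2) (hE : Dfn fun w (p : ℕ × ℕ) => E w p.1 p.2)
    (hE_not : Dfn fun w (p : ℕ × ℕ) => ¬ E w p.1 p.2) (hF_not : Dfn fun w (n : ℕ) => ¬ F w n)
    (hE' : ∀ w x y, E w x y → x + 1 < bound w ∧ y + 1 < bound w)
    (hS' : ∀ w z x, S w z x → x + 1 < bound w) :
    Dfn fun w z => ¬ ∃ x y, S w z x ∧ ReflTransGen (E w) x y ∧ F w y := by
  have hN := Dfn.nextCount hS hS_not hE hE_not hE'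
  have h1 : Dfn fun w (p : Z × ℕ × ℕ) =>
      ReflTransGen (fun q r : ℕ × ℕ => r.1 < bound w ∧ r.2 < bound w ∧ r.1 = q.1 + 1 ∧
        NextCount (S w p.1) (E w) (bound w) q.1 q.2 r.2) (0, 0) p.2 := by
    refine Dfn.rtg_from_zero (R := fun w z (q r : ℕ × ℕ) => r.1 < bound w ∧ r.2 < bound w ∧
      r.1 = q.1 + 1 ∧ NextCount (S w z) (E w) (bound w) q.1 q.2 r.2) ?_
      fun w z x y h => ⟨h.1, h.2.1⟩
    refine ((NumCtx.succ.comp (f := fun p : Z × (ℕ × ℕ) × ℕ × ℕ => (p.2.1.1, p.2.2.1))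
      (by fun_prop)).and (hN.comp (f := fun p : Z × (ℕ × ℕ) × ℕ × ℕ =>
        (p.1, p.2.1.1, p.2.1.2, p.2.2.2)) (by fun_prop))).congr fun w p hp => ?_
    simp only [inDom_prod, inDom_iff] at hp
    simp only [hp, true_and]
  have h2 : Dfn fun w (p : Z × ℕ × ℕ) => ReflTransGen (CountStep (bound w)
      (fun i => Ball (S w p.1) (E w) p.2.1 i ∧ ¬ F w i) fun _ => True) (0, 0)
      (bound w - 1, p.2.2) :=
    (Dfn.countStep (Z := Z × ℕ × ℕ) (A := fun w p i => Ball (S w p.1) (E w) p.2.1 i ∧ ¬ F w i)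
      (B := fun _ _ _ => True)
      (((Dfn.ball hS hE hE').comp (f := fun p : (Z × ℕ × ℕ) × ℕ => (p.1.1, p.1.2.1, p.2))
        (by fun_prop)).and (hF_not.comp (f := fun p : (Z × ℕ × ℕ) × ℕ => p.2) (by fun_prop)))
      Dfn.true).comp (f := fun p : Z × ℕ × ℕ => (p, p.2.2)) (by fun_prop)
  refine ((h1.and ((hN.comp (f := fun p : Z × ℕ × ℕ => (p.1, p.2.1, p.2.2, p.2.2))
    (by fun_prop)).and h2)).exDom (X := Z) (Y := ℕ × ℕ) (P := fun w z p => ReflTransGen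
      (fun q r : ℕ × ℕ => r.1 < bound w ∧ r.2 < bound w ∧ r.1 = q.1 + 1 ∧
        NextCount (S w z) (E w) (bound w) q.1 q.2 r.2) (0, 0) p ∧
      NextCount (S w z) (E w) (bound w) p.1 p.2 p.2 ∧ ReflTransGen (CountStep (bound w)
      (fun i => Ball (S w z) (E w) p.1 i ∧ ¬ F w i) fun _ => True) (0, 0)
      (bound w - 1, p.2))).congr fun w z _ => ?_
  rw [not_reach_iff (bound_pos w) (hE' w) (hS' w z)]
  simp only [Prod.exists, inDom_prod, inDom_iff, and_assoc]

end Complement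

end NLSpace

namespace NLSpace

open Relation

/-- Predicates that depend on the input only through one letter, at a position held by the word, and
are otherwise regular. -/
theorem Rec.base_not {α Γ : Type} [Finite Γ] [Nonempty Γ] (pos : Γ → Fin 2)
    {K : Option α → ∀ L, (Fin L → Γ) → Prop} (hK : ∀ a, Rgl (K a)) :
    Rec fun w (u : Fin (len w) → Γ) => ¬ K (w[val fun i => pos (u i)]?) _ u :=
  Rec.base pos (K := fun a L u => ¬ K a L u) fun a => (hK a).not

/-- The theorem of Immerman and Szelepcsényi for regular transition systems. -/
theorem Rec.not {α Γ : Type} [Finite Γ] [Nonempty Γ] {P : ∀ w : List α, (Fin (len w) → Γ) → Prop}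
    (h : Rec P) : Rec fun w u => ¬ P w u := by
  obtain ⟨T, hT⟩ := h
  have := T.finΔ
  have := T.nonemptyΔ
  obtain ⟨b, ⟨e⟩⟩ := Finite.exists_equiv_fin T.Δ
  have hb : 0 < b := by
    obtain ⟨d⟩ := T.nonemptyΔ
    exact (e d).pos
  -- Configurations become numbers in base `b + 1`, although there are only `b` letters. The unused
  -- top digit keeps these numbers below the last one, as the counting argument requires.
  let code : T.Δ → Fin (b + 1) := fun d => (e d).castSucc
  let dec : Fin (b + 1) → T.Δ := fun i => if h : (i : ℕ) < b then e.symm ⟨i, h⟩ else e.symm ⟨0, hb⟩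
  have dec_code : ∀ d, dec (code d) = d := by
    intro d
    simp [dec, code]
  have code_dec : ∀ i : Fin (b + 1), (i : ℕ) < b → code (dec i) = i := by
    intro i hi
    ext
    simp [dec, code, hi]
  have code_lt : ∀ d, (code d : ℕ) < b := fun d => by simp [code]
  let N : NumCtx α := numCtx α (b + 1) (by omega)
  -- the number of a configuration
  let num : ∀ {L}, (Fin L → T.Δ) → ℕ := fun x => val fun i => code (x i)
  have num_iff : ∀ {L} (u : Fin L → Fin (b + 1)) (Q : (Fin L → T.Δ) → Prop),
      (∃ x, val u = num x ∧ Q x) ↔ (∀ i, (u i : ℕ) < b) ∧ Q fun i => dec (u i) := by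
    intro L u Q
    constructor
    · rintro ⟨x, hx, hQ⟩
      obtain rfl := val_injective hx
      refine ⟨fun i => code_lt _, ?_⟩
      simpa only [dec_code] using hQ
    · rintro ⟨h, hQ⟩
      exact ⟨_, congrArg val (funext fun i => (code_dec _ (h i)).symm), hQ⟩
  have num_inj : ∀ {L} {x y : Fin L → T.Δ}, num x = num y → x = y := by
    intro L x y h
    have := val_injective h
    funext i
    rw [← dec_code (x i), ← dec_code (y i)]
    exact congrArg dec (congrFun this i)
  have num_lt : ∀ (w : List α) (x : Fin (len w) → T.Δ), num x + 1 < (b + 1) ^ len w := fun w x =>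
    val_add_one_lt _ ⟨⟨0, len_pos w⟩, Nat.succ_lt_succ (code_lt _)⟩
  -- the reachability problem in terms of numbers
  let S : List α → Word Γ → ℕ → Prop := fun w z n =>
    ∃ x : Fin (len w) → T.Δ, n = num x ∧ T.I _ x ∧ z.toList = List.ofFn fun i => T.π (x i)
  let E : List α → ℕ → ℕ → Prop := fun w m n =>
    ∃ x : Fin (len w) → T.Δ, m = num x ∧ ∃ y, n = num y ∧ T.Step w x y
  let F : List α → ℕ → Prop := fun w n => ∃ x : Fin (len w) → T.Δ, n = num x ∧ T.F _ x
  have regS : Rgl fun L (u : Fin L → Γ × Fin (b + 1)) => (∀ i, ((u i).2 : ℕ) < b) ∧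
      T.I L (fun i => dec (u i).2) ∧ ∀ i, (u i).1 = T.π (dec (u i).2) :=
    (Rgl.all fun d : Γ × Fin (b + 1) => (d.2 : ℕ) < b).and
      ((T.regI.comp fun d : Γ × Fin (b + 1) => dec d.2).and
        (Rgl.all fun d : Γ × Fin (b + 1) => d.1 = T.π (dec d.2)))
  have regF : Rgl fun L (u : Fin L → Fin (b + 1)) => (∀ i, (u i : ℕ) < b) ∧
      T.F L fun i => dec (u i) :=
    (Rgl.all fun d : Fin (b + 1) => (d : ℕ) < b).and (T.regF.comp dec)
  have regE : ∀ a, Rgl fun L (u : Fin L → Fin (b + 1) × Fin (b + 1)) => (∀ i, ((u i).1 : ℕ) < b) ∧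
      (∀ i, ((u i).2 : ℕ) < b) ∧ T.K a L fun i => (dec (u i).1, dec (u i).2) := fun a =>
    (Rgl.all fun d : Fin (b + 1) × Fin (b + 1) => (d.1 : ℕ) < b).and
      ((Rgl.all fun d : Fin (b + 1) × Fin (b + 1) => (d.2 : ℕ) < b).and
        ((T.regK a).comp fun d : Fin (b + 1) × Fin (b + 1) => (dec d.1, dec d.2)))
  have eqS : ∀ (w : List α) (u : Fin (len w) → Γ × Fin (b + 1)) (x : Word Γ × ℕ), Ctx.rep w u x →
      (((∀ i, ((u i).2 : ℕ) < b) ∧ T.I _ (fun i => dec (u i).2) ∧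
        ∀ i, (u i).1 = T.π (dec (u i).2)) ↔ S w x.1 x.2) := by
    rintro w u ⟨z, n⟩ ⟨rfl, rfl⟩
    rw [← num_iff (fun i => (u i).2) fun x => T.I _ x ∧ ∀ i, (u i).1 = T.π (x i)]
    refine exists_congr fun x => and_congr_right fun _ => and_congr_right fun _ => ?_
    rw [List.ofFn_inj, funext_iff]
  have eqF : ∀ (w : List α) (u : Fin (len w) → Fin (b + 1)) (n : ℕ), Ctx.rep w u n →
      (((∀ i, (u i : ℕ) < b) ∧ T.F _ fun i => dec (u i)) ↔ F w n) := by
    rintro w u n rfl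
    exact (num_iff u fun x => T.F _ x).symm
  have eqE : ∀ (w : List α) (u : Fin (len w) → Fin (b + 1) × Fin (b + 1)) (x : ℕ × ℕ),
      Ctx.rep w u x → (((∀ i, ((u i).1 : ℕ) < b) ∧ (∀ i, ((u i).2 : ℕ) < b) ∧
        T.K (w[val fun i => T.pos (dec (u i).1)]?) _ fun i => (dec (u i).1, dec (u i).2)) ↔
          E w x.1 x.2) := by
    rintro w u ⟨m, n⟩ ⟨rfl, rfl⟩
    have h1 := num_iff (fun i => (u i).1) fun x => ∃ y, (val fun i => (u i).2) = num y ∧ T.Step w x y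
    have h2 := num_iff (fun i => (u i).2) fun y => T.Step w (fun i => dec (u i).1) y
    exact (h1.trans (and_congr_right fun _ => h2)).symm
  have dS := Dfn.of_rec (X := Word Γ × ℕ) (P := fun w x => S w x.1 x.2) (Rec.rgl regS) (fun w u => ⟨(_, _), rfl, rfl⟩) eqS
  have dS' := Dfn.of_rec (X := Word Γ × ℕ) (P := fun w x => ¬ S w x.1 x.2) (Rec.rgl regS.not) (fun w u => ⟨(_, _), rfl, rfl⟩)
    fun w u x hx => not_congr (eqS w u x hx)
  have dF' := Dfn.of_rec (X := ℕ) (P := fun w x => ¬ F w x) (Rec.rgl regF.not) (fun w u => ⟨_, rfl⟩)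
    fun w u x hx => not_congr (eqF w u x hx)
  have dE := Dfn.of_rec (X := ℕ × ℕ) (P := fun w x => E w x.1 x.2)
    (Rec.base (α := α) (fun d : Fin (b + 1) × Fin (b + 1) => T.pos (dec d.1)) regE)
    (fun w u => ⟨(_, _), rfl, rfl⟩) eqE
  have dE' := Dfn.of_rec (X := ℕ × ℕ) (P := fun w x => ¬ E w x.1 x.2)
    (Rec.base_not (α := α) (fun d : Fin (b + 1) × Fin (b + 1) => T.pos (dec d.1)) regE)
    (fun w u => ⟨(_, _), rfl, rfl⟩) fun w u x hx => not_congr (eqE w u x hx)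
  have key := Dfn.not_reach (S := S) (E := E) (F := F) dS dS' dE dE' dF'
    (by rintro w _ _ ⟨x, rfl, y, rfl, -⟩; exact ⟨num_lt w x, num_lt w y⟩)
    (by rintro w _ _ ⟨x, rfl, -⟩; exact num_lt w x)
  refine Rec.congr key fun w u => ?_
  have hrep : (∃ x : Word Γ, Ctx.rep w u x ∧ ¬ ∃ m n, S w x m ∧ ReflTransGen (E w) m n ∧ F w n) ↔
      ¬ ∃ m n, S w ⟨List.ofFn u⟩ m ∧ ReflTransGen (E w) m n ∧ F w n :=
    ⟨fun ⟨x, hx, h⟩ => by obtain rfl := hx; exact h, fun h => ⟨_, rfl, h⟩⟩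
  rw [hrep, hT]
  refine not_congr ?_
  constructor
  · rintro ⟨_, _, ⟨x, rfl, hI, hu⟩, hr, y, rfl, hF⟩
    refine ⟨x, y, fun i => (congrFun (List.ofFn_injective hu) i).symm, hI, ?_, hF⟩
    have : ∀ {n}, ReflTransGen (E w) (num x) n → ∃ y, n = num y ∧ ReflTransGen (T.Step w) x y := by
      intro n h
      induction h with
      | refl => exact ⟨x, rfl, .refl⟩
      | tail _ h ih =>
        obtain ⟨y, rfl, hy⟩ := ih
        obtain ⟨y', hy', z, rfl, hz⟩ := h
        obtain rfl := num_inj hy'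
        exact ⟨z, rfl, hy.tail hz⟩
    obtain ⟨y', hy', h⟩ := this hr
    obtain rfl := num_inj hy'
    exact h
  · rintro ⟨x, y, hu, hI, hr, hF⟩
    refine ⟨num x, num y, ⟨x, rfl, hI, ?_⟩, ?_, y, rfl, hF⟩
    · simp only [hu]
    · exact reflTransGen_map num (fun a c h => ⟨a, rfl, c, rfl, h⟩) hr

variable {α X Y Z : Type} [Ctx α X] [Ctx α Y] [Ctx α Z]

namespace Dfn

/-- Complementing a recognizable set of words also admits words that represent nothing; they are
removed by intersection with the valid ones. -/
theorem not {P : List α → X → Prop} (h : Dfn P) : Dfn fun w x => ¬ P w x := by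
  refine ((Ctx.valid (α := α) (X := X)).and (Rec.not h)).congr fun w u => ?_
  constructor
  · rintro ⟨⟨x, hx⟩, h⟩
    exact ⟨x, hx, fun hP => h ⟨x, hx, hP⟩⟩
  · rintro ⟨x, hx, h⟩
    exact ⟨⟨x, hx⟩, fun ⟨y, hy, hP⟩ => h (Ctx.functional hy hx ▸ hP)⟩

theorem imp {P Q : List α → X → Prop} (hP : Dfn P) (hQ : Dfn Q) : Dfn fun w x => P w x → Q w x :=
  (hP.not.or hQ).congr fun w x _ => by tauto

theorem false : Dfn fun (_ : List α) (_ : X) => False := Dfn.true.not.congr fun w x _ => by simp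

theorem allDom {P : List α → X → Y → Prop} (hP : Dfn fun w (p : X × Y) => P w p.1 p.2) :
    Dfn fun w x => ∀ y, InDom w y → P w x y :=
  (Dfn.not (Dfn.exDom (P := fun w x y => ¬ P w x y) hP.not)).congr fun w x _ => by
    push Not; rfl

end Dfn

end NLSpace

/-! ### Arithmetic, and infixes of the input -/

namespace NLSpace

open Relation

instance {α : Type} : NumCtx α := numCtx α 2 le_rfl

variable {α X X' Y Z : Type} [Ctx α X] [Ctx α Y] [Ctx α Z]

theorem inDom_nat {w : List α} {n : ℕ} : InDom w n ↔ n < 2 ^ len w := NumCtx.inDom_iff w n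

theorem inDom_of_le {w : List α} {n : ℕ} (h : n ≤ w.length) : InDom w n := by
  have := length_lt_two_pow_len w
  exact inDom_nat.2 (by omega)

theorem inDom_mono {w : List α} {m n : ℕ} (h : m ≤ n) (hn : InDom w n) : InDom w m :=
  inDom_nat.2 (h.trans_lt (inDom_nat.1 hn))

namespace Dfn

theorem exFinite {ι : Type} [Finite ι] {P : ι → List α → X → Prop} (h : ∀ i, Dfn (P i)) :
    Dfn fun w x => ∃ i, P i w x := by
  classical
  have := Fintype.ofFinite ι
  have key : ∀ s : Finset ι, Dfn fun w x => ∃ i ∈ s, P i w x := by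
    intro s
    induction s using Finset.induction_on with
    | empty => exact Dfn.false.congr fun w x _ => by simp
    | insert i s _ ih => exact ((h i).or ih).congr fun w x _ => by simp
  exact (key Finset.univ).congr fun w x _ => by simp

theorem numSucc {f g : X → ℕ} (hf : Proj α f) (hg : Proj α g) :
    Dfn fun (_ : List α) x => g x = f x + 1 :=
  NumCtx.succ.comp (f := fun x => (f x, g x)) (by fun_prop)

theorem numZero {f : X → ℕ} (hf : Proj α f) : Dfn fun (_ : List α) x => f x = 0 :=
  NumCtx.zero.comp hf

theorem numLt {f g : X → ℕ} (hf : Proj α f) (hg : Proj α g) :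
    Dfn fun (_ : List α) x => f x < g x := by
  have h : Dfn fun (_ : List α) (p : Unit × ℕ × ℕ) => p.2.1 < p.2.2 := by
    refine (Dfn.transGen (R := fun _ (_ : Unit) m n => n = m + 1)
      (numSucc (by fun_prop) (by fun_prop))).congr fun w p hp => ?_
    obtain ⟨_, m, n⟩ := p
    simp only [inDom_prod, inDom_nat] at hp ⊢
    constructor
    · intro h
      induction h with
      | single h => omega
      | tail _ h ih =>
        have := ih ⟨hp.1, hp.2.1, by omega⟩
        omega
    · intro h
      obtain ⟨k, rfl⟩ := Nat.exists_eq_add_of_lt h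
      induction k with
      | zero => exact .single ⟨hp.2.2, rfl⟩
      | succ k ih => exact .tail (ih ⟨hp.1, hp.2.1, by omega⟩ (by omega)) ⟨hp.2.2, by omega⟩
  have h' : Dfn fun (_ : List α) (p : ℕ × ℕ) => p.1 < p.2 := by
    refine (Dfn.exDom (Y := Unit) (P := fun _ (p : ℕ × ℕ) _ => p.1 < p.2)
      (h.comp (f := fun p : (ℕ × ℕ) × Unit => (p.2, p.1)) (by fun_prop))).congr fun w p _ => ?_
    exact ⟨fun ⟨_, _, h⟩ => h, fun h => ⟨(), ⟨fun _ => (), fun _ => rfl⟩, h⟩⟩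
  exact h'.comp (f := fun x => (f x, g x)) (by fun_prop)

theorem numDouble {f g : X → ℕ} (hf : Proj α f) (hg : Proj α g) :
    Dfn fun (_ : List α) x => g x = 2 * f x := by
  -- Doubling is tested by subtracting one from the first and two from the second number until both
  -- vanish together. The end point is a pair `(o, o)`, and `o = 0` is imposed afterwards.
  have h : Dfn fun (_ : List α) (p : (ℕ × ℕ) × ℕ) =>
      ReflTransGen (fun p q : ℕ × ℕ => p.1 = q.1 + 1 ∧ ∃ m, p.2 = m + 1 ∧ m = q.2 + 1) p.1
        (p.2, p.2) := by
    refine Dfn.rtg (Z := (ℕ × ℕ) × ℕ) (f := fun p => p.1) (g := fun p => (p.2, p.2))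
      (R := fun _ _ (p q : ℕ × ℕ) => p.1 = q.1 + 1 ∧ ∃ m, p.2 = m + 1 ∧ m = q.2 + 1)
      ((numSucc (by fun_prop) (by fun_prop)).and (Dfn.ex (X := ((ℕ × ℕ) × ℕ) × (ℕ × ℕ) × ℕ × ℕ)
        (P := fun _ p m => p.2.1.2 = m + 1 ∧ m = p.2.2.2 + 1)
        ((numSucc (by fun_prop) (by fun_prop)).and (numSucc (by fun_prop) (by fun_prop)))
        fun w x y hx h => ?_)) Dfn.eq_num_prod (by fun_prop) (by fun_prop) fun w z x y _ hx h => ?_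
    · simp only [inDom_prod] at hx
      exact inDom_mono (by omega) hx.2.1.2
    · obtain ⟨h, m, h1, h2⟩ := h
      simp only [inDom_prod] at hx ⊢
      exact ⟨inDom_mono (by omega) hx.1, inDom_mono (by omega) hx.2⟩
  have h' : Dfn fun (_ : List α) (p : ℕ × ℕ) => p.2 = 2 * p.1 := by
    refine ((h.and (numZero (f := fun p : (ℕ × ℕ) × ℕ => p.2) (by fun_prop))).ex
      (P := fun (_ : List α) (p : ℕ × ℕ) o => ReflTransGen (fun p q : ℕ × ℕ =>
        p.1 = q.1 + 1 ∧ ∃ m, p.2 = m + 1 ∧ m = q.2 + 1) p (o, o) ∧ o = 0)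
      (fun w x y _ h => inDom_of_le (by omega))).congr fun w p _ => ?_
    obtain ⟨m, n⟩ := p
    constructor
    · rintro ⟨_, h, rfl⟩
      have : ∀ p : ℕ × ℕ, ReflTransGen (fun p q : ℕ × ℕ =>
          p.1 = q.1 + 1 ∧ ∃ m, p.2 = m + 1 ∧ m = q.2 + 1) p (0, 0) → p.2 = 2 * p.1 := by
        intro p h
        induction h using ReflTransGen.head_induction_on with
        | refl => rfl
        | head h _ ih => obtain ⟨h1, m, h2, h3⟩ := h; omega
      exact this _ h
    · rintro h
      dsimp only at h
      subst h
      refine ⟨0, ?_, rfl⟩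
      clear * -
      induction m with
      | zero => exact .refl
      | succ m ih => exact .head (b := (m, 2 * m)) ⟨rfl, 2 * m + 1, rfl, rfl⟩ ih
  exact h'.comp (f := fun x => (f x, g x)) (by fun_prop)

theorem letter (o : Option α) {f : X → ℕ} (hf : Proj α f) : Dfn fun w x => w[f x]? = o := by
  have h : Dfn fun (w : List α) (n : ℕ) => w[n]? = o := by
    refine Dfn.of_rec (Rec.base (α := α) (Γ := Fin 2) id (K := fun a _ _ => a = o)
      fun a => Rgl.const _) (fun w u => ⟨_, rfl⟩) ?_
    rintro w u n rfl
    exact Iff.rfl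
  exact h.comp hf

end Dfn

/-! ### Infixes of the input as objects -/

/-- The infix of `w` with a given position and (at most) a given length. -/
def slice (w : List α) (p : ℕ × ℕ) : List α := (w.drop p.1).take p.2

/-- Two numbers stand for a possibly long word, which is what makes terms and literals fit into
logarithmic space. Every infix, and nothing else, is represented, in general in several ways. -/
instance : Ctx α (List α) where
  Γ := Fin 2 × Fin 2
  fin := inferInstance
  ne := inferInstance
  rep w u s := s = slice w (val fun i => (u i).1, val fun i => (u i).2)
  functional h h' := h.trans h'.symm
  valid := (Rec.rgl (Rgl.const True)).congr fun w u => by simp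

theorem slice_infix (w : List α) (p : ℕ × ℕ) : slice w p <:+: w :=
  ((w.drop p.1).take_prefix p.2).isInfix.trans (w.drop_suffix p.1).isInfix

theorem inDom_list {w s : List α} : InDom w s ↔ s <:+: w := by
  constructor
  · rintro ⟨u, rfl⟩
    exact slice_infix _ _
  · rintro ⟨a, b, rfl⟩
    have h := length_lt_two_pow_len (a ++ s ++ b)
    have h' : (a ++ s ++ b).length = a.length + s.length + b.length := by simp [add_assoc]
    obtain ⟨u, hu⟩ := exists_val_eq (B := 2) (L := len (a ++ s ++ b)) (n := a.length) (by omega)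
    obtain ⟨v, hv⟩ := exists_val_eq (B := 2) (L := len (a ++ s ++ b)) (n := s.length) (by omega)
    refine ⟨fun i => (u i, v i), ?_⟩
    change s = slice _ (val u, val v)
    simp [slice, hu, hv]

theorem slice_eq_nil {w : List α} {p : ℕ × ℕ} : slice w p = [] ↔ p.2 = 0 ∨ w[p.1]? = none := by
  simp [slice]

theorem slice_eq_cons {w : List α} {p : ℕ × ℕ} {a : α} {t : List α} : slice w p = a :: t ↔
    w[p.1]? = some a ∧ ∃ q : ℕ × ℕ, q.1 = p.1 + 1 ∧ p.2 = q.2 + 1 ∧ slice w q = t := by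
  obtain ⟨n, l⟩ := p
  rcases l with _ | l
  · simp [slice]
  · have hd : slice w (n, l + 1) = match w[n]? with
        | none => []
        | some b => b :: slice w (n + 1, l) := by
      by_cases h : n < w.length
      · rw [List.getElem?_eq_getElem h]
        unfold slice
        dsimp only
        rw [List.drop_eq_getElem_cons h, List.take_succ_cons]
      · simp [slice, List.drop_eq_nil_of_le (Nat.le_of_not_lt h), h]
    rw [hd]
    rcases w[n]? with _ | b
    · simp
    · simp only [List.cons.injEq, Option.some.injEq]
      refine and_congr_right fun _ => ⟨fun h => ⟨(n + 1, l), rfl, rfl, h⟩, ?_⟩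
      rintro ⟨⟨n', l'⟩, h1, h2, h3⟩
      dsimp only at h1 h2
      obtain rfl : l' = l := by omega
      subst h1
      exact h3

/-- Objects whose equality is definable. -/
class EqCtx (α X : Type) [Ctx α X] : Prop where
  eq : Dfn fun (_ : List α) (p : X × X) => p.1 = p.2

instance : EqCtx α ℕ := ⟨NumCtx.eq⟩

instance [EqCtx α X] [EqCtx α Y] : EqCtx α (X × Y) := ⟨Dfn.eq_prod EqCtx.eq EqCtx.eq⟩

theorem EqCtx.ofFinite (A : Type) [Finite A] [Nonempty A] :
    @EqCtx α A (Ctx.ofFinite α A) := by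
  let _ : Ctx α A := Ctx.ofFinite α A
  refine ⟨((Ctx.valid (α := α) (X := A × A)).and
    (Rec.rgl (Rgl.all fun d : A × A => d.1 = d.2))).congr fun w u => ?_⟩
  constructor
  · rintro ⟨⟨p, hp⟩, h⟩
    exact ⟨p, hp, ((hp.1 ⟨0, len_pos w⟩).symm.trans (h ⟨0, len_pos w⟩)).trans (hp.2 ⟨0, len_pos w⟩)⟩
  · rintro ⟨p, hp, h⟩
    exact ⟨⟨p, hp⟩, fun i => ((hp.1 i).trans h).trans (hp.2 i).symm⟩

@[fun_prop] theorem Proj.not {f : X → Bool} (hf : Proj α f) : Proj α fun x => !(f x) := by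
  obtain ⟨g, hg⟩ := hf
  exact ⟨fun c => !(g c : Bool), fun w u x h i => congrArg Bool.not (hg w u x h i)⟩

instance : EqCtx α Bool := .ofFinite Bool

@[fun_prop] theorem Proj.constFinite {A : Type} [Finite A] [Nonempty A] (a : A) :
    @Proj α X A _ (Ctx.ofFinite α A) fun _ => a :=
  let _ : Ctx α A := Ctx.ofFinite α A
  ⟨fun _ => a, fun _ _ _ _ _ => rfl⟩

theorem val_zero (L : ℕ) : val (fun _ : Fin L => (0 : Fin 2)) = 0 := (val_eq_zero (by omega) _).2 (by simp)

@[fun_prop] theorem Proj.zero : Proj α fun _ : X => 0 :=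
  ⟨fun _ => (0 : Fin 2), fun _ _ _ _ => (val_zero _).symm⟩

@[fun_prop] theorem Proj.nil : Proj α fun _ : X => ([] : List α) :=
  ⟨fun _ => ((0 : Fin 2), (0 : Fin 2)), fun w _ _ _ =>
    (show [] = slice w (val fun _ => 0, val fun _ => 0) by simp [val_zero, slice])⟩

/-- `s` is a concatenation of words from `P`. -/
def Star (P : List α → Prop) (s : List α) : Prop := ∃ l : List (List α), (∀ x ∈ l, P x) ∧ s = l.flatten

/-- `s` is a concatenation of `n` words from `P`. -/
def CountedStar (P : List α → Prop) (s : List α) (n : ℕ) : Prop :=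
  ∃ l : List (List α), (∀ x ∈ l, P x) ∧ s = l.flatten ∧ l.length = n

theorem countedStar_iff {P : List α → Prop} {s : List α} {n : ℕ} : CountedStar P s n ↔
    ReflTransGen (fun p q : List α × ℕ => (∃ x t, p.1 = x ++ t ∧ P x ∧ t = q.1) ∧ p.2 = q.2 + 1)
      (s, n) ([], 0) := by
  constructor
  · rintro ⟨l, h, rfl, rfl⟩
    induction l with
    | nil => exact .refl
    | cons x l ih =>
      exact .head (b := (l.flatten, l.length)) ⟨⟨x, _, rfl, h x (by simp), rfl⟩, rfl⟩
        (ih fun y hy => h y (by simp [hy]))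
  · intro h
    generalize hp : (s, n) = p at h
    induction h using ReflTransGen.head_induction_on generalizing s n with
    | refl => cases hp; exact ⟨[], by simp⟩
    | head h _ ih =>
      subst hp
      obtain ⟨⟨x, t, h1, h2, h3⟩, h4⟩ := h
      obtain ⟨l, h5, h6, h7⟩ := ih rfl
      exact ⟨x :: l, by simpa [h2] using h5, by simp_all, by simp_all⟩

theorem star_iff {P : List α → Prop} {s : List α} : Star P s ↔
    ReflTransGen (fun p q : List α => ∃ x t, p = x ++ t ∧ P x ∧ t = q) s [] := by
  constructor
  · rintro ⟨l, h, rfl⟩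
    induction l with
    | nil => exact .refl
    | cons x l ih =>
      exact .head (b := l.flatten) ⟨x, _, rfl, h x (by simp), rfl⟩
        (ih fun y hy => h y (by simp [hy]))
  · intro h
    induction h using ReflTransGen.head_induction_on with
    | refl => exact ⟨[], by simp⟩
    | head h _ ih =>
      obtain ⟨x, t, h1, h2, rfl⟩ := h
      obtain ⟨l, h5, h6⟩ := ih
      exact ⟨x :: l, by simpa [h2] using h5, by simp_all⟩

namespace Dfn

/-- Infixes may be replaced by their positions and lengths. -/
theorem slice_iff {P : List α → List α × X → Prop} :
    Dfn (fun w (p : (ℕ × ℕ) × X) => P w (slice w p.1, p.2)) ↔ Dfn P := by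
  refine iff_of_eq (congrArg Rec (funext fun w => funext fun u => propext ?_))
  constructor
  · rintro ⟨⟨⟨m, n⟩, x⟩, ⟨⟨rfl, rfl⟩, hx⟩, h⟩
    exact ⟨(_, x), ⟨rfl, hx⟩, h⟩
  · rintro ⟨⟨s, x⟩, ⟨rfl, hx⟩, h⟩
    exact ⟨((_, _), x), ⟨⟨rfl, rfl⟩, hx⟩, h⟩

theorem eq [EqCtx α Y] {f g : X → Y} (hf : Proj α f) (hg : Proj α g) :
    Dfn fun (_ : List α) x => f x = g x :=
  EqCtx.eq.comp (f := fun x => (f x, g x)) (by fun_prop)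

theorem rtgOn [EqCtx α X] {R : List α → X → X → Prop}
    (hR : Dfn fun w (p : X × X) => R w p.1 p.2)
    (hdom : ∀ w x y, InDom w x → R w x y → InDom w y) {f g : Z → X} (hf : Proj α f)
    (hg : Proj α g) : Dfn fun w z => ReflTransGen (R w) (f z) (g z) :=
  Dfn.rtg (R := fun w _ => R w) (hR.comp (f := fun p : Z × X × X => p.2) (by fun_prop)) EqCtx.eq
    hf hg fun w _ => fun x y _ => hdom w x y

variable [Finite α]

/-- Different occurrences of a word are compared letter by letter, advancing both positions until
nothing is left of either. -/
theorem slice_eq_slice : Dfn fun (w : List α) (p : (ℕ × ℕ) × ℕ × ℕ) => slice w p.1 = slice w p.2 := by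
  let R : List α → (ℕ × ℕ) × ℕ × ℕ → (ℕ × ℕ) × ℕ × ℕ → Prop := fun w p q =>
    (∃ a, w[p.1.1]? = some a ∧ w[p.2.1]? = some a) ∧ q.1.1 = p.1.1 + 1 ∧ p.1.2 = q.1.2 + 1 ∧
      q.2.1 = p.2.1 + 1 ∧ p.2.2 = q.2.2 + 1
  have h0 : Dfn fun (w : List α) (n : ℕ × ℕ) => slice w n = [] :=
    ((numZero (f := fun n : ℕ × ℕ => n.2) (by fun_prop)).or
      (letter none (f := fun n : ℕ × ℕ => n.1) (by fun_prop))).congr fun w n _ => slice_eq_nil.symm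
  have hdom : ∀ (w : List α) x y, InDom w x → R w x y → InDom w y := by
    rintro w ⟨⟨a, b⟩, c, d⟩ ⟨⟨a', b'⟩, c', d'⟩ hx ⟨⟨s, h1, h2⟩, h5, h3, h6, h4⟩
    dsimp only at h1 h2 h3 h4 h5 h6
    subst h5 h6
    simp only [inDom_prod] at hx ⊢
    refine ⟨⟨inDom_of_le ?_, inDom_mono (Nat.le.intro h3.symm) hx.1.2⟩,
      ⟨inDom_of_le ?_, inDom_mono (Nat.le.intro h4.symm) hx.2.2⟩⟩
    · exact (List.getElem?_eq_some_iff.1 h1).1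
    · exact (List.getElem?_eq_some_iff.1 h2).1
  have hR : Dfn fun (w : List α) (p : ((ℕ × ℕ) × ℕ × ℕ) × (ℕ × ℕ) × ℕ × ℕ) => R w p.1 p.2 :=
    (exFinite fun a => (letter (some a) (by fun_prop)).and (letter (some a) (by fun_prop))).and
      ((numSucc (by fun_prop) (by fun_prop)).and ((numSucc (by fun_prop) (by fun_prop)).and
        ((numSucc (by fun_prop) (by fun_prop)).and (numSucc (by fun_prop) (by fun_prop)))))
  have h := (rtgOn (Z := ((ℕ × ℕ) × ℕ × ℕ) × (ℕ × ℕ) × ℕ × ℕ) hR hdom (f := Prod.fst) (g := Prod.snd)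
    (by fun_prop) (by fun_prop)).and ((h0.comp (f := fun p => p.2.1) (by fun_prop)).and
      (h0.comp (f := fun p => p.2.2) (by fun_prop)))
  refine (Dfn.exDom (P := fun w p q => ReflTransGen (R w) p q ∧ slice w q.1 = [] ∧ slice w q.2 = [])
    h).congr fun w p hp => ?_
  constructor
  · rintro ⟨q, -, h, h1, h2⟩
    induction h using ReflTransGen.head_induction_on with
    | refl => exact h1.trans h2.symm
    | @head p r h _ ih =>
      obtain ⟨⟨a, ha, hb⟩, h3, h4, h5, h6⟩ := h
      rw [slice_eq_cons.2 ⟨ha, r.1, h3, h4, rfl⟩, slice_eq_cons.2 ⟨hb, r.2, h5, h6, rfl⟩,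
        ih (hdom w _ _ hp ⟨⟨a, ha, hb⟩, h3, h4, h5, h6⟩)]
  · intro h
    generalize hs : slice w p.1 = s at h
    induction s generalizing p with
    | nil => exact ⟨p, hp, .refl, hs, h.symm⟩
    | cons a s ih =>
      obtain ⟨ha, q, h1, h2, h3⟩ := slice_eq_cons.1 hs
      obtain ⟨hb, r, h4, h5, h6⟩ := slice_eq_cons.1 h.symm
      have hst : R w p (q, r) := ⟨⟨a, ha, hb⟩, h1, h2, h4, h5⟩
      obtain ⟨o, ho, h7, h8⟩ := ih (q, r) (hdom _ _ _ hp hst) h3 h6.symm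
      exact ⟨o, ho, .head hst h7, h8⟩

end Dfn

variable [Finite α]

instance : EqCtx α (List α) := by
  refine ⟨Dfn.slice_iff.1 ?_⟩
  have h := Dfn.slice_eq_slice (α := α)
  refine Dfn.congr (Dfn.comp (Dfn.slice_iff (P := fun w p => p.1 = slice w p.2).1 h)
    (f := fun p : (ℕ × ℕ) × List α => (p.2, p.1)) (by fun_prop)) fun w p _ => eq_comm

namespace Dfn

theorem eqNil {f : X → List α} (hf : Proj α f) : Dfn fun (_ : List α) x => f x = [] :=
  .eq hf (by fun_prop)

theorem eqCons (a : α) {f g : X → List α} (hf : Proj α f) (hg : Proj α g) :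
    Dfn fun (_ : List α) x => f x = a :: g x := by
  have h : Dfn fun (w : List α) (p : (ℕ × ℕ) × List α) => slice w p.1 = a :: p.2 := by
    have h1 : Dfn fun (w : List α) (p : (ℕ × ℕ) × List α) => slice w p.1 = p.2 :=
      (Dfn.slice_iff (P := fun w (p : List α × List α) => p.1 = p.2)).2 EqCtx.eq
    refine ((letter (some a) (f := fun p : (ℕ × ℕ) × List α => p.1.1) (by fun_prop)).and
      (Dfn.ex (P := fun w (p : (ℕ × ℕ) × List α) (q : ℕ × ℕ) =>
        w[p.1.1]? = some a ∧ q.1 = p.1.1 + 1 ∧ p.1.2 = q.2 + 1 ∧ slice w q = p.2)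
        ((letter _ (by fun_prop)).and ((numSucc (by fun_prop) (by fun_prop)).and
          ((numSucc (by fun_prop) (by fun_prop)).and
            (h1.comp (f := fun p : ((ℕ × ℕ) × List α) × ℕ × ℕ => (p.2, p.1.2)) (by fun_prop)))))
        fun w p q hp h => ?_)).congr
        fun w p _ => ?_
    · simp only [inDom_prod] at hp ⊢
      rw [h.2.1]
      exact ⟨inDom_of_le (List.getElem?_eq_some_iff.1 h.1).1,
        inDom_mono (Nat.le.intro h.2.2.1.symm) hp.1.2⟩
    · rw [slice_eq_cons]
      exact ⟨fun ⟨h, q, _, h'⟩ => ⟨h, q, h'⟩, fun ⟨h, q, h'⟩ => ⟨h, q, h, h'⟩⟩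
  exact (Dfn.slice_iff (P := fun w (p : List α × List α) => p.1 = a :: p.2).1 h).comp
    (f := fun x => (f x, g x)) (by fun_prop)

/-- The first letters of `f x` and `g x` are removed in parallel; when `g x` is used up, `h x` must
remain. -/
theorem eqAppend {f g h : X → List α} (hf : Proj α f) (hg : Proj α g) (hh : Proj α h) :
    Dfn fun (_ : List α) x => f x = g x ++ h x := by
  have key : ∀ p q : List α × List α, ReflTransGen (fun p q : List α × List α =>
      ∃ a, p.1 = a :: q.1 ∧ p.2 = a :: q.2) p q → ∃ s, p.1 = s ++ q.1 ∧ p.2 = s ++ q.2 := by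
    intro p q h
    induction h using ReflTransGen.head_induction_on with
    | refl => exact ⟨[], rfl, rfl⟩
    | head h _ ih =>
      obtain ⟨a, h1, h2⟩ := h
      obtain ⟨s, h3, h4⟩ := ih
      exact ⟨a :: s, by simp [h1, h3], by simp [h2, h4]⟩
  refine (rtgOn (R := fun _ (p q : List α × List α) => ∃ a, p.1 = a :: q.1 ∧ p.2 = a :: q.2)
    (exFinite fun a => (eqCons a (by fun_prop) (by fun_prop)).and
      (eqCons a (by fun_prop) (by fun_prop))) ?_ (f := fun x => (f x, g x))
    (g := fun x => (h x, [])) (by fun_prop) (by fun_prop)).congr fun w x _ => ?_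
  · rintro w ⟨a, b⟩ ⟨c, d⟩ hx ⟨s, h1, h2⟩
    simp only [inDom_prod, inDom_list] at hx ⊢
    exact ⟨((c.suffix_cons s).isInfix.trans (h1 ▸ hx.1)),
      ((d.suffix_cons s).isInfix.trans (h2 ▸ hx.2))⟩
  · constructor
    · intro h
      obtain ⟨s, h1, h2⟩ := key _ _ h
      simp only [List.append_nil] at h2
      rw [h2, ← h1]
    · intro e
      generalize f x = s at e
      generalize g x = t at e
      subst e
      induction t with
      | nil => exact .refl
      | cons a t ih => exact .head (b := (t ++ h x, t)) ⟨a, rfl, rfl⟩ ih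

theorem exAppend {f : X → List α} {P : List α → X → List α → List α → Prop} (hf : Proj α f)
    (hP : Dfn fun w (p : (X × List α) × List α) => P w p.1.1 p.1.2 p.2) :
    Dfn fun w x => ∃ s t, f x = s ++ t ∧ P w x s t := by
  refine Dfn.ex (P := fun w x s => ∃ t, f x = s ++ t ∧ P w x s t)
    (Dfn.ex (P := fun w (p : X × List α) t => f p.1 = p.2 ++ t ∧ P w p.1 p.2 t)
      ((eqAppend (by fun_prop) (by fun_prop) (by fun_prop)).and hP) ?_) ?_
  · rintro w ⟨x, s⟩ t hx ⟨h, -⟩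
    have := hf.inDom (inDom_prod.1 hx).1
    rw [inDom_list] at this ⊢
    dsimp only at h
    exact (h ▸ (List.suffix_append s t).isInfix).trans this
  · rintro w x s hx ⟨t, h, -⟩
    have := hf.inDom hx
    rw [inDom_list] at this ⊢
    exact (h ▸ (List.prefix_append s t).isInfix).trans this

theorem exCons {f : X → List α} {P : List α → X → List α → Prop} (a : α) (hf : Proj α f)
    (hP : Dfn fun w (p : X × List α) => P w p.1 p.2) :
    Dfn fun w x => ∃ t, f x = a :: t ∧ P w x t := by
  refine Dfn.ex (P := fun w x t => f x = a :: t ∧ P w x t)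
    ((eqCons a (by fun_prop) (by fun_prop)).and hP) ?_
  rintro w x t hx ⟨h, -⟩
  have := hf.inDom hx
  rw [inDom_list] at this ⊢
  exact (h ▸ (List.suffix_cons a t).isInfix).trans this

/-- The whole input is the only one of its infixes that contains all of them. -/
theorem eqInput {f : X → List α} (hf : Proj α f) : Dfn fun w x => f x = w := by
  refine (Dfn.allDom (P := fun (_ : List α) x y => ∃ s t, f x = s ++ t ∧ ∃ u v, t = u ++ v ∧ u = y)
    (exAppend (by fun_prop) (exAppend (by fun_prop) (.eq (by fun_prop) (by fun_prop))))).congr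
    fun w x hx => ?_
  constructor
  · intro h
    obtain ⟨s, t, h1, u, v, rfl, rfl⟩ := h w (inDom_list.2 (List.infix_refl w))
    have h2 : u <:+: f x := ⟨s, v, by simp [h1]⟩
    have h3 : f x <:+: u := inDom_list.1 (hf.inDom hx)
    exact h3.sublist.antisymm h2.sublist
  · rintro h y hy
    obtain ⟨s, t, h'⟩ := inDom_list.1 hy
    exact ⟨s, _, by rw [h, ← h', List.append_assoc], y, t, rfl, rfl⟩

end Dfn

namespace Dfn

theorem star {P : List α → List α → Prop} (hP : Dfn P) {f : X → List α} (hf : Proj α f) :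
    Dfn fun w x => Star (P w) (f x) := by
  refine (rtgOn (R := fun w p q => ∃ x t, p = x ++ t ∧ P w x ∧ t = q)
    (exAppend (by fun_prop) ((hP.comp (by fun_prop)).and (.eq (by fun_prop) (by fun_prop)))) ?_ hf
    (g := fun _ => []) (by fun_prop)).congr fun w x _ => star_iff.symm
  rintro w x y hx ⟨s, t, h, -, rfl⟩
  rw [inDom_list] at hx ⊢
  exact (h ▸ (List.suffix_append s t).isInfix).trans hx

theorem countedStar {P : List α → List α → Prop} (hP : Dfn P) {f : X → List α} (hf : Proj α f)
    {g : X → ℕ} (hg : Proj α g) : Dfn fun w x => CountedStar (P w) (f x) (g x) := by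
  refine (rtgOn (R := fun w (p q : List α × ℕ) => (∃ x t, p.1 = x ++ t ∧ P w x ∧ t = q.1) ∧
      p.2 = q.2 + 1)
    ((exAppend (by fun_prop) ((hP.comp (by fun_prop)).and (.eq (by fun_prop) (by fun_prop)))).and
      (numSucc (by fun_prop) (by fun_prop))) ?_ (f := fun x => (f x, g x))
    (g := fun _ => ([], 0)) (by fun_prop) (by fun_prop)).congr fun w x _ => countedStar_iff.symm
  rintro w x y hx ⟨⟨s, t, h, -, h'⟩, hn⟩
  rw [inDom_prod, inDom_list] at hx ⊢
  subst h'
  exact ⟨(h ▸ (List.suffix_append s _).isInfix).trans hx.1,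
    inDom_mono (Nat.le.intro hn.symm) hx.2⟩

end Dfn

/-- Objects given by their encodings in the input. -/
@[reducible] def Ctx.ofEncode (enc : X' → List α) (good : X' → Prop)
    (inj : ∀ x y, enc x = enc y → x = y)
    (h : Dfn fun (_ : List α) s => ∃ x, good x ∧ enc x = s) : Ctx α X' where
  Γ := Ctx.Γ α (List α)
  fin := inferInstance
  ne := inferInstance
  rep w u x := good x ∧ Ctx.rep w u (enc x)
  functional h h' := inj _ _ (Ctx.functional h.2 h'.2)
  valid := Rec.congr h fun w u => by
    constructor
    · rintro ⟨_, h1, x, h2, rfl⟩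
      exact ⟨x, h2, h1⟩
    · rintro ⟨x, h1, h2⟩
      exact ⟨_, h2, x, h1, rfl⟩

end NLSpace

/-! ### Unique readability of the encoding -/

namespace SO2

/-! ### Unique readability -/

/-- The word does not start with a digit. -/
def NoDigit (s : List Sym) : Prop := ∀ a ∈ s.head?, a ≠ .zero ∧ a ≠ .one

theorem noDigit_cons {a : Sym} (s : List Sym) (h : a ≠ .zero ∧ a ≠ .one) : NoDigit (a :: s) := by
  intro b hb
  simp only [List.head?_cons, Option.mem_def, Option.some.injEq] at hb
  exact hb ▸ h

theorem digits_append_inj {l l' : List Bool} {s s' : List Sym} (hs : NoDigit s) (hs' : NoDigit s')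
    (h : (l.map fun b => if b then Sym.one else .zero) ++ s =
      (l'.map fun b => if b then Sym.one else .zero) ++ s') : l = l' ∧ s = s' := by
  induction l generalizing l' with
  | nil =>
    cases l' with
    | nil => exact ⟨rfl, h⟩
    | cons b l' =>
      simp only [List.map_nil, List.nil_append, List.map_cons, List.cons_append] at h
      subst h
      have := hs _ rfl
      cases b <;> simp at this
  | cons a l ih =>
    cases l' with
    | nil =>
      simp only [List.map_nil, List.nil_append, List.map_cons, List.cons_append] at h
      subst h
      have := hs' _ rfl
      cases a <;> simp at this
    | cons b l' =>
      simp only [List.map_cons, List.cons_append, List.cons.injEq] at h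
      obtain ⟨rfl, rfl⟩ := ih h.2
      refine ⟨?_, rfl⟩
      cases a <;> cases b <;> simp_all

theorem bits_inj {m n : ℕ} (h : m.bits = n.bits) : m = n := by
  rw [← Nat.ofDigits_digits 2 m, ← Nat.ofDigits_digits 2 n, Nat.digits_two_eq_bits,
    Nat.digits_two_eq_bits, h]

theorem encodeNat_append_inj {m n : ℕ} {s t : List Sym} (hs : NoDigit s) (ht : NoDigit t)
    (h : encodeNat m ++ s = encodeNat n ++ t) : m = n ∧ s = t :=
  (digits_append_inj hs ht h).imp_left bits_inj

theorem encodeFVar_append_inj {f g : FVar} {s t : List Sym} (hs : NoDigit s) (ht : NoDigit t)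
    (h : encodeFVar f ++ s = encodeFVar g ++ t) : f = g ∧ s = t := by
  simp only [encodeFVar, List.append_assoc, List.cons_append] at h
  obtain ⟨h1, h2⟩ := encodeNat_append_inj (noDigit_cons _ (by decide)) (noDigit_cons _ (by decide)) h
  obtain ⟨h3, h4⟩ := encodeNat_append_inj hs ht (List.cons.inj h2).2
  cases f
  cases g
  simp_all

/-- `F` describes what may follow a list, `G` what may follow a single item. As no item begins like
a word in `F`, the end of the list is recognizable. -/
theorem flatMap_append_inj {X : Type} {enc : X → List Sym} {F G : List Sym → Prop}
    (h : ∀ x y s t, G s → G t → enc x ++ s = enc y ++ t → x = y ∧ s = t)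
    (hG : ∀ x s, G (enc x ++ s)) (hFG : ∀ s, F s → G s) (hF : ∀ x s, ¬ F (enc x ++ s))
    {l l' : List X} {s t : List Sym} (hs : F s) (ht : F t)
    (hl : l.flatMap enc ++ s = l'.flatMap enc ++ t) : l = l' ∧ s = t := by
  have hG' : ∀ (l : List X) s, F s → G (l.flatMap enc ++ s) := by
    intro l s hs
    cases l with
    | nil => exact hFG _ hs
    | cons x l =>
      rw [List.flatMap_cons, List.append_assoc]
      exact hG x _
  induction l generalizing l' with
  | nil =>
    cases l' with
    | nil => exact ⟨rfl, hl⟩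
    | cons y l' =>
      simp only [List.flatMap_nil, List.nil_append, List.flatMap_cons, List.append_assoc] at hl
      exact absurd (hl ▸ hs) (hF _ _)
  | cons x l ih =>
    cases l' with
    | nil =>
      simp only [List.flatMap_nil, List.nil_append, List.flatMap_cons, List.append_assoc] at hl
      exact absurd (hl ▸ ht) (hF _ _)
    | cons y l' =>
      simp only [List.flatMap_cons, List.append_assoc] at hl
      obtain ⟨rfl, h2⟩ := h x y _ _ (hG' l _ hs) (hG' l' _ ht) hl
      obtain ⟨rfl, h4⟩ := ih h2
      exact ⟨rfl, h4⟩

theorem encodeNat_append_head (n : ℕ) (a : Sym) (s : List Sym) :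
    ∃ b t, encodeNat n ++ a :: s = b :: t ∧ (b = .zero ∨ b = .one ∨ b = a) := by
  unfold encodeNat
  rcases n.bits with _ | ⟨b, l⟩
  · exact ⟨a, s, rfl, by simp⟩
  · exact ⟨_, _, rfl, by cases b <;> simp⟩

theorem Term.encode_append_head (t : Term) (s : List Sym) :
    ∃ b r, t.encode ++ s = b :: r ∧ (b = .zero ∨ b = .one ∨ b = .sep) := by
  cases t with
  | app f a =>
    simp only [Term.encode, encodeFVar, List.append_assoc, List.cons_append]
    exact encodeNat_append_head _ _ _

theorem Term.encode_app (f : FVar) (a : Fin f.arity → Term) (s : List Sym) :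
    (Term.app f a).encode ++ s =
      encodeFVar f ++ .lpar :: ((List.ofFn a).flatMap Term.encode ++ .rpar :: s) := by
  simp [Term.encode, List.flatMap, List.map_ofFn, Function.comp_def]

theorem Term.encode_append_inj {t t' : Term} {s s' : List Sym}
    (h : t.encode ++ s = t'.encode ++ s') : t = t' ∧ s = s' := by
  induction t generalizing t' s s' with
  | app f a ih =>
    cases t' with
    | app g b =>
      rw [Term.encode_app, Term.encode_app] at h
      obtain ⟨rfl, h2⟩ := encodeFVar_append_inj (noDigit_cons _ (by decide))
        (noDigit_cons _ (by decide)) h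
      -- The arity is part of the head, so once the heads agree both argument lists have the same
      -- length and need no separators.
      have key : ∀ (l l' : List Term) (r r' : List Sym), l.length = l'.length →
          (∀ t ∈ l, ∀ t' s s', t.encode ++ s = t'.encode ++ s' → t = t' ∧ s = s') →
          l.flatMap Term.encode ++ r = l'.flatMap Term.encode ++ r' → l = l' ∧ r = r' := by
        intro l
        induction l with
        | nil =>
          intro l' r r' hl _ h
          obtain rfl := List.length_eq_zero_iff.1 hl.symm
          exact ⟨rfl, h⟩
        | cons x l ihl =>
          intro l' r r' hl hx h
          obtain ⟨y, l', rfl⟩ := List.exists_cons_of_length_eq_add_one hl.symm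
          simp only [List.flatMap_cons, List.append_assoc] at h
          obtain ⟨rfl, h2⟩ := hx x (by simp) _ _ _ h
          obtain ⟨rfl, h3⟩ := ihl l' r r' (by simpa using hl) (fun t ht => hx t (by simp [ht])) h2
          exact ⟨rfl, h3⟩
      obtain ⟨h3, h4⟩ := key _ _ _ _ (by simp) (by
        intro t ht
        obtain ⟨i, rfl⟩ := List.mem_ofFn.1 ht
        intro t' s s' h
        exact ih i h) (List.cons.inj h2).2
      exact ⟨by rw [List.ofFn_injective h3], (List.cons.inj h4).2⟩

theorem Term.encode_inj {t t' : Term} (h : t.encode = t'.encode) : t = t' :=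
  (Term.encode_append_inj (s := []) (s' := []) (by rw [h])).1

theorem encodeFVar_inj {f g : FVar} (h : encodeFVar f = encodeFVar g) : f = g :=
  (encodeFVar_append_inj (s := []) (t := []) (by simp [NoDigit]) (by simp [NoDigit]) (by rw [h])).1

theorem flatMap_term_inj {l l' : List Term} {s s' : List Sym}
    (h : l.flatMap Term.encode ++ .rpar :: s = l'.flatMap Term.encode ++ .rpar :: s') :
    l = l' ∧ s = s' := by
  obtain ⟨h1, h2⟩ := flatMap_append_inj (F := fun s => s.head? = some .rpar) (G := fun _ => True)
    (fun x y s t _ _ => Term.encode_append_inj) (fun _ _ => trivial) (fun _ _ => trivial)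
    (fun x s hs => by
      obtain ⟨b, r, h, hb⟩ := x.encode_append_head s
      rw [h] at hs
      simp only [List.head?_cons, Option.some.injEq] at hs
      subst hs
      simp at hb) rfl rfl h
  exact ⟨h1, (List.cons.inj h2).2⟩

theorem Literal.encode_append_head (l : Literal) (s : List Sym) :
    ∃ b r, l.encode ++ s = b :: r ∧ b ≠ .clause := by
  obtain ⟨_ | _, t⟩ := l
  · exact ⟨_, _, rfl, by decide⟩
  · obtain ⟨b, r, h, hb⟩ := t.encode_append_head s
    exact ⟨b, r, h, by rintro rfl; simp at hb⟩

theorem Literal.encode_append_inj {l l' : Literal} {s s' : List Sym}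
    (h : l.encode ++ s = l'.encode ++ s') : l = l' ∧ s = s' := by
  have hneg : ∀ (t : Term) s r, t.encode ++ s ≠ Sym.neg :: r := by
    intro t s r h
    obtain ⟨b, r', h', hb⟩ := t.encode_append_head s
    rw [h'] at h
    simp_all
  obtain ⟨_ | _, t⟩ := l <;> obtain ⟨_ | _, t'⟩ := l'
  · obtain ⟨rfl, h2⟩ := Term.encode_append_inj (List.cons.inj h).2
    exact ⟨rfl, h2⟩
  · exact absurd h.symm (hneg _ _ _)
  · exact absurd h (hneg _ _ _)
  · obtain ⟨rfl, h2⟩ := Term.encode_append_inj (t := t) (t' := t') h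
    exact ⟨rfl, h2⟩

/-- The word is empty or starts a new clause. -/
def ClauseEnd (s : List Sym) : Prop := ∀ a ∈ s.head?, a = .clause

theorem encodeClause_append_inj {C C' : List Literal} {s s' : List Sym} (hs : ClauseEnd s)
    (hs' : ClauseEnd s') (h : encodeClause C ++ s = encodeClause C' ++ s') : C = C' ∧ s = s' :=
  flatMap_append_inj (F := ClauseEnd) (G := fun _ => True)
    (fun x y s t _ _ => Literal.encode_append_inj) (fun _ _ => trivial) (fun _ _ => trivial)
    (fun x s hs => by
      obtain ⟨b, r, h, hb⟩ := x.encode_append_head s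
      rw [h] at hs
      exact hb (hs b rfl)) hs hs' (List.cons.inj h).2

theorem encodeQuant_append_inj {p p' : Quant × FVar} {s s' : List Sym} (hs : NoDigit s)
    (hs' : NoDigit s') (h : encodeQuant p ++ s = encodeQuant p' ++ s') : p = p' ∧ s = s' := by
  obtain ⟨q, f⟩ := p
  obtain ⟨q', f'⟩ := p'
  simp only [encodeQuant, List.cons_append, List.cons.injEq] at h
  obtain ⟨rfl, h2⟩ := encodeFVar_append_inj hs hs' h.2
  refine ⟨?_, h2⟩
  cases q <;> cases q' <;> simp_all

theorem PrenexCNF.encode_inj {φ ψ : PrenexCNF} (h : φ.encode = ψ.encode) : φ = ψ := by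
  have hc : ∀ l : List (List Literal), ClauseEnd (l.flatMap encodeClause) := by
    rintro (_ | ⟨C, l⟩) a ha
    · simp at ha
    · simp only [List.flatMap_cons, encodeClause, List.cons_append, List.head?_cons,
        Option.mem_def, Option.some.injEq] at ha
      exact ha.symm
  obtain ⟨h1, h2⟩ := flatMap_append_inj (F := ClauseEnd) (G := NoDigit)
    (fun x y s t => encodeQuant_append_inj)
    (fun x s => noDigit_cons _ (by rcases x with ⟨_ | _, _⟩ <;> simp))
    (fun s hs a ha => by rw [hs a ha]; decide)
    (fun x s hs => by
      have := hs _ rfl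
      rcases x with ⟨_ | _, _⟩ <;> simp at this)
    (hc _) (hc _) h
  have h3 := (flatMap_append_inj (l := φ.clauses) (l' := ψ.clauses) (F := fun s => s = []) (G := ClauseEnd) (s := []) (t := [])
    (fun x y s t => encodeClause_append_inj) (fun x s a ha => by simpa [encodeClause, eq_comm] using ha)
    (fun s hs => by simp [hs, ClauseEnd]) (fun x s hs => by simp [encodeClause] at hs) rfl rfl
    (by rw [h2])).1
  exact congrArg₂ PrenexCNF.mk h1 h3

end SO2

namespace SO2

open NLSpace Relation

/-! ### Definability of the syntax -/

section General

variable {α X Y : Type} [Ctx α X] [Ctx α Y]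

/-- Dual to `Dfn.ex`: only counterexamples have to be represented. -/
theorem _root_.NLSpace.Dfn.forall {P : List α → X → Y → Prop}
    (hP : Dfn fun w (p : X × Y) => P w p.1 p.2)
    (hdom : ∀ w x y, InDom w x → ¬ P w x y → InDom w y) : Dfn fun w x => ∀ y, P w x y :=
  (Dfn.allDom hP).congr fun w x hx =>
    ⟨fun h y => by_contra fun hP => hP (h y (hdom w x y hx hP)), fun h y _ => h y⟩

theorem _root_.NLSpace.Dfn.forallFinite {ι : Type} [Finite ι] {P : ι → List α → X → Prop}
    (h : ∀ i, Dfn (P i)) : Dfn fun w x => ∀ i, P i w x :=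
  (Dfn.exFinite fun i => (h i).not).not.congr fun w x _ => by push Not; rfl

theorem _root_.NLSpace.Dfn.eqConst [Finite α] (l : List α) {f : X → List α} (hf : Proj α f) :
    Dfn fun (_ : List α) x => f x = l := by
  induction l generalizing X with
  | nil => exact .eqNil hf
  | cons a l ih =>
    exact (Dfn.exCons (P := fun _ _ t => t = l) a hf (ih (by fun_prop))).congr fun w x _ => by simp

theorem _root_.NLSpace.Dfn.input [Finite α] {P : List α → X → List α → Prop}
    (hP : Dfn fun w (p : X × List α) => P w p.1 p.2) : Dfn fun w x => P w x w :=
  (Dfn.ex (P := fun w x s => s = w ∧ P w x s) ((Dfn.eqInput (by fun_prop)).and hP)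
    fun w x s _ h => inDom_list.2 (h.1 ▸ List.infix_rfl)).congr fun w x _ => by simp

end General

variable {X : Type} [Ctx Sym X]

/-- The most significant digit comes last, so the absence of superfluous zeros means that a nonempty
word ends in a one. -/
theorem exists_encodeNat {s : List Sym} : (∃ n, encodeNat n = s) ↔
    s = [] ∨ ∃ x y, s = x ++ y ∧ Star (fun a => a = [.zero] ∨ a = [.one]) x ∧ y = [.one] := by
  have hstar : ∀ {x}, Star (fun a => a = [Sym.zero] ∨ a = [.one]) x ↔
      ∃ l : List Bool, x = l.map fun b => if b then Sym.one else .zero := by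
    intro x
    constructor
    · rintro ⟨l, h, rfl⟩
      induction l with
      | nil => exact ⟨[], rfl⟩
      | cons a l ih =>
        obtain ⟨m, hm⟩ := ih fun x hx => h x (by simp [hx])
        rw [List.flatten_cons, hm]
        rcases h a (by simp) with rfl | rfl
        · exact ⟨false :: m, rfl⟩
        · exact ⟨true :: m, rfl⟩
    · rintro ⟨l, rfl⟩
      refine ⟨l.map fun b => if b then [Sym.one] else [.zero], ?_, ?_⟩
      · intro x hx
        obtain ⟨b, -, rfl⟩ := List.mem_map.1 hx
        cases b <;> simp
      · induction l with
        | nil => rfl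
        | cons b l ih => cases b <;> simp [← ih]
  have hbits : ∀ l : List Bool, ∃ n : ℕ, n.bits = l ++ [true] := by
    intro l
    induction l with
    | nil => exact ⟨1, Nat.one_bits⟩
    | cons b l ih =>
      obtain ⟨n, hn⟩ := ih
      refine ⟨Nat.bit b n, ?_⟩
      rw [Nat.bits_append_bit, hn, List.cons_append]
      rintro rfl
      simp at hn
  constructor
  · rintro ⟨n, rfl⟩
    induction n using Nat.binaryRec' with
    | zero => exact .inl rfl
    | bit b n hn ih =>
      right
      have he : encodeNat (Nat.bit b n) = (if b then Sym.one else .zero) :: encodeNat n := by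
        simp [encodeNat, Nat.bits_append_bit _ _ hn]
      rw [he]
      rcases ih with h | ⟨x, y, h, hx, rfl⟩
      · obtain rfl : n = 0 := bits_inj (by simpa [encodeNat] using h)
        rw [hn rfl, h]
        exact ⟨[], [.one], rfl, ⟨[], by simp⟩, rfl⟩
      · obtain ⟨l, rfl⟩ := hstar.1 hx
        exact ⟨_, _, by rw [h, ← List.cons_append]; rfl, hstar.2 ⟨b :: l, rfl⟩, rfl⟩
  · rintro (rfl | ⟨x, y, rfl, hx, rfl⟩)
    · exact ⟨0, by simp [encodeNat]⟩
    · obtain ⟨l, rfl⟩ := hstar.1 hx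
      obtain ⟨n, hn⟩ := hbits l
      exact ⟨n, by simp [encodeNat, hn]⟩

theorem dfn_exists_encodeNat {f : X → List Sym} (hf : Proj Sym f) :
    Dfn fun (_ : List Sym) x => ∃ n, encodeNat n = f x := by
  have h : Dfn fun (_ : List Sym) (a : List Sym) => a = [.zero] ∨ a = [.one] :=
    (Dfn.eqConst _ (by fun_prop)).or (.eqConst _ (by fun_prop))
  exact ((Dfn.eqNil hf).or (Dfn.exAppend hf ((Dfn.star h (by fun_prop)).and
    (Dfn.eqConst _ (by fun_prop))))).congr fun w x _ => exists_encodeNat.symm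

/-- A word and a number are consumed together, one digit against one halving. The condition that the
number is nonzero rules out superfluous zeros. -/
theorem eq_encodeNat_iff {s : List Sym} {n : ℕ} : s = encodeNat n ↔
    ReflTransGen (fun p q : List Sym × ℕ => (p.1 = .zero :: q.1 ∧ p.2 = 2 * q.2 ∧ ¬ p.2 = 0) ∨
      (p.1 = .one :: q.1 ∧ ∃ m, p.2 = m + 1 ∧ m = 2 * q.2)) (s, n) ([], 0) := by
  have hbit : ∀ {b : Bool} {n : ℕ}, (n = 0 → b = true) →
      encodeNat (Nat.bit b n) = (if b then Sym.one else .zero) :: encodeNat n := by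
    intro b n hn
    simp [encodeNat, Nat.bits_append_bit _ _ hn]
  constructor
  · rintro rfl
    induction n using Nat.binaryRec' with
    | zero => exact .refl
    | bit b n hn ih =>
      refine .head (b := (encodeNat n, n)) ?_ ih
      rw [hbit hn]
      cases b
      · refine .inl ⟨rfl, by simp, ?_⟩
        have : n ≠ 0 := fun h => by simpa using hn h
        simpa [Nat.bit_false] using this
      · exact .inr ⟨rfl, 2 * n, by simp, rfl⟩
  · intro h
    generalize hp : (s, n) = p at h
    induction h using ReflTransGen.head_induction_on generalizing s n with
    | refl => cases hp; simp [encodeNat]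
    | @head _ q h _ ih =>
      subst hp
      obtain ⟨t, m⟩ := q
      have h1 := ih rfl
      subst h1
      rcases h with ⟨h2, h3, h4⟩ | ⟨h2, k, h3, h4⟩
      · dsimp only at h2 h3 h4
        have := hbit (b := false) (n := m) (by omega)
        rw [show Nat.bit false m = n by rw [h3, Nat.bit_false]] at this
        rw [this, h2]
        rfl
      · dsimp only at h2 h3 h4
        have := hbit (b := true) (n := m) (by simp)
        rw [show Nat.bit true m = n by rw [h3, h4, Nat.bit_true]] at this
        rw [this, h2]
        rfl

theorem dfn_eq_encodeNat {f : X → List Sym} (hf : Proj Sym f) {g : X → ℕ} (hg : Proj Sym g) :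
    Dfn fun (_ : List Sym) x => f x = encodeNat (g x) := by
  refine (Dfn.rtgOn (R := fun _ (p q : List Sym × ℕ) =>
    (p.1 = .zero :: q.1 ∧ p.2 = 2 * q.2 ∧ ¬ p.2 = 0) ∨
      (p.1 = .one :: q.1 ∧ ∃ m, p.2 = m + 1 ∧ m = 2 * q.2)) ?_ ?_ (f := fun x => (f x, g x))
      (g := fun _ => ([], 0)) (by fun_prop) (by fun_prop)).congr fun w x _ => eq_encodeNat_iff.symm
  · refine ((Dfn.eqCons _ (by fun_prop) (by fun_prop)).and ((Dfn.numDouble (by fun_prop)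
      (by fun_prop)).and (Dfn.numZero (by fun_prop)).not)).or ((Dfn.eqCons _ (by fun_prop)
      (by fun_prop)).and (Dfn.ex (P := fun _ (p : (List Sym × ℕ) × List Sym × ℕ) m =>
        p.1.2 = m + 1 ∧ m = 2 * p.2.2) ((Dfn.numSucc (by fun_prop) (by fun_prop)).and
        (Dfn.numDouble (by fun_prop) (by fun_prop))) ?_))
    rintro w p m hp ⟨h, -⟩
    simp only [inDom_prod] at hp
    exact inDom_mono (by omega) hp.1.2
  · rintro w ⟨s, n⟩ ⟨t, m⟩ hp h
    simp only [inDom_prod, inDom_list] at hp ⊢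
    rcases h with ⟨h1, h2, h3⟩ | ⟨h1, k, h2, h3⟩
    · dsimp only at h1 h2
      exact ⟨(h1 ▸ List.suffix_cons _ t).isInfix.trans hp.1, inDom_mono (by omega) hp.2⟩
    · dsimp only at h1 h2 h3
      exact ⟨(h1 ▸ List.suffix_cons _ t).isInfix.trans hp.1, inDom_mono (by omega) hp.2⟩

/-- The encodings of function variables. -/
def IsFVar (s : List Sym) : Prop := ∃ f, encodeFVar f = s

theorem dfn_isFVar {f : X → List Sym} (hf : Proj Sym f) :
    Dfn fun (_ : List Sym) x => IsFVar (f x) := by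
  refine (Dfn.exAppend (P := fun _ _ s t => (∃ n, encodeNat n = s) ∧ ∃ r, t = .sep :: r ∧
    ∃ n, encodeNat n = r) hf ((dfn_exists_encodeNat (by fun_prop)).and
      (Dfn.exCons _ (by fun_prop) (dfn_exists_encodeNat (by fun_prop))))).congr fun w x _ => ?_
  constructor
  · rintro ⟨_, _, h, ⟨m, rfl⟩, _, rfl, n, rfl⟩
    exact ⟨⟨n, m⟩, h.symm⟩
  · rintro ⟨g, h⟩
    exact ⟨_, _, h.symm, ⟨_, rfl⟩, _, rfl, _, rfl⟩

instance : Ctx Sym FVar := .ofEncode encodeFVar (fun _ => True) (fun _ _ => encodeFVar_inj)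
  ((dfn_isFVar Proj.id).congr fun w s _ => by simp [IsFVar])

@[fun_prop] theorem proj_encodeFVar {f : X → FVar} (hf : Proj Sym f) :
    Proj Sym fun x => encodeFVar (f x) :=
  .comp ⟨fun a => a, fun _ _ _ h => h.2⟩ hf

theorem inDom_fVar {w : List Sym} {f : FVar} : InDom w f ↔ encodeFVar f <:+: w := by
  rw [← inDom_list]
  exact exists_congr fun u => iff_of_eq (true_and _)

/-- The arguments are propositional. -/
def Term.Flat (t : Term) : Prop := ∀ a ∈ t.args, a.head.arity = 0

/-- The encodings of propositional variables as terms. -/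
def IsProp (s : List Sym) : Prop := ∃ t : Term, t.head.arity = 0 ∧ t.encode = s

theorem dfn_isProp {f : X → List Sym} (hf : Proj Sym f) :
    Dfn fun (_ : List Sym) x => IsProp (f x) := by
  -- Arity `0` is written as the empty word, so nothing stands between the separator and the
  -- parenthesis.
  refine (Dfn.exAppend (P := fun _ _ s t => (∃ n, encodeNat n = s) ∧ t = [.sep, .lpar, .rpar])
    hf ((dfn_exists_encodeNat (by fun_prop)).and (Dfn.eqConst _ (by fun_prop)))).congr
    fun w x _ => ?_
  have key : ∀ n (a : Fin (FVar.mk 0 n).arity → Term),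
      (Term.app ⟨0, n⟩ a).encode = encodeNat n ++ [.sep, .lpar, .rpar] := by
    intro n a
    simp [Term.encode, encodeFVar, encodeNat]
  constructor
  · rintro ⟨_, _, h, ⟨n, rfl⟩, rfl⟩
    exact ⟨.app ⟨0, n⟩ Fin.elim0, rfl, by rw [h, key]⟩
  · rintro ⟨⟨⟨_, n⟩, a⟩, rfl, h⟩
    exact ⟨_, _, (key n a ▸ h).symm, ⟨n, rfl⟩, rfl⟩

/-- The encodings of terms with propositional arguments. -/
def IsTerm (s : List Sym) : Prop := ∃ t : Term, t.Flat ∧ t.encode = s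

theorem flatten_enc {X : Type} {good : X → Prop} {enc : X → List Sym} {l : List (List Sym)}
    (h : ∀ s ∈ l, ∃ x, good x ∧ enc x = s) :
    ∃ l' : List X, (∀ x ∈ l', good x) ∧ l'.flatMap enc = l.flatten ∧ l'.length = l.length := by
  induction l with
  | nil => exact ⟨[], by simp⟩
  | cons s l ih =>
    obtain ⟨l', h1, h2, h3⟩ := ih fun y hy => h y (by simp [hy])
    obtain ⟨x, hx, rfl⟩ := h s (by simp)
    exact ⟨x :: l', by simpa [hx] using h1, by simp [h2], by simp [h3]⟩

theorem map_enc {X : Type} {good : X → Prop} {enc : X → List Sym} {l : List X}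
    (h : ∀ x ∈ l, good x) : ∀ s ∈ l.map enc, ∃ x, good x ∧ enc x = s := by
  intro s hs
  obtain ⟨x, hx, rfl⟩ := List.mem_map.1 hs
  exact ⟨x, h x hx, rfl⟩

theorem dfn_isTerm {f : X → List Sym} (hf : Proj Sym f) :
    Dfn fun (_ : List Sym) x => IsTerm (f x) := by
  refine (Dfn.exAppend (P := fun _ _ s t => (∃ n, encodeNat n = s) ∧ ∃ r, t = .sep :: r ∧
    ∃ a b, r = a ++ b ∧ ∃ c, b = .lpar :: c ∧ ∃ d e, c = d ++ e ∧ e = [.rpar] ∧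
      ∃ n, a = encodeNat n ∧ CountedStar IsProp d n) hf
    ((dfn_exists_encodeNat (by fun_prop)).and (Dfn.exCons _ (by fun_prop)
      (Dfn.exAppend (by fun_prop) (Dfn.exCons _ (by fun_prop) (Dfn.exAppend (by fun_prop)
        ((Dfn.eqConst _ (by fun_prop)).and (Dfn.ex (Y := ℕ) ((dfn_eq_encodeNat (by fun_prop)
          (by fun_prop)).and (Dfn.countedStar (dfn_isProp Proj.id) (by fun_prop)
          (by fun_prop))) ?_)))))))).congr fun w x hx => ?_
  -- Every argument takes up at least one letter, so the number of arguments is bounded by the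
  -- length of the input and is represented.
  · rintro w ⟨⟨_, d⟩, e⟩ n hx ⟨-, l, h1, h2, rfl⟩
    refine inDom_of_le ?_
    simp only [inDom_prod, inDom_list] at hx
    refine le_trans ?_ hx.1.2.length_le
    dsimp only at h2
    rw [h2]
    clear * - h1
    induction l with
    | nil => simp
    | cons x l ih =>
      have := ih fun y hy => h1 y (by simp [hy])
      obtain ⟨t, -, rfl⟩ := h1 x (by simp)
      obtain ⟨b, r, h, -⟩ := t.encode_append_head []
      rw [List.append_nil] at h
      simp only [List.flatten_cons, List.length_append, List.length_cons, h]
      omega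
  · constructor
    · rintro ⟨_, _, h, ⟨m, rfl⟩, _, rfl, _, _, rfl, _, rfl, d, _, rfl, rfl, n, rfl, l, h1, rfl, rfl⟩
      obtain ⟨l', h2, h3, h4⟩ := flatten_enc h1
      rw [h, ← h4, ← h3]
      refine ⟨.app ⟨l'.length, m⟩ fun i => l'[i], ?_, ?_⟩
      · rintro _ ⟨i, rfl⟩
        exact h2 _ (List.getElem_mem _)
      · have := Term.encode_app ⟨l'.length, m⟩ (fun i => l'[i]) []
        rw [List.append_nil] at this
        rw [this, show (List.ofFn fun i : Fin l'.length => l'[i]) = l' from List.ofFn_getElem]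
        simp [encodeFVar]
    · rintro ⟨⟨⟨n, m⟩, a⟩, h1, h2⟩
      have := Term.encode_app ⟨n, m⟩ a []
      rw [List.append_nil, h2] at this
      refine ⟨_, _, this.trans (by simp only [encodeFVar, List.append_assoc, List.cons_append]; rfl),
        ⟨m, rfl⟩, _, rfl, _, _, rfl, _, rfl, _, _, rfl, rfl, n, rfl, (List.ofFn a).map Term.encode,
        map_enc ?_, rfl, by simp⟩
      intro t ht
      exact h1 t (List.mem_ofFn.1 ht)

/-- Only terms with propositional arguments are represented. These are all the terms that occur in
simple formulae, and their encodings can be recognized without a stack. -/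
instance : Ctx Sym Term := .ofEncode Term.encode Term.Flat (fun _ _ => Term.encode_inj)
  (dfn_isTerm Proj.id)

@[fun_prop] theorem proj_encodeTerm {f : X → Term} (hf : Proj Sym f) :
    Proj Sym fun x => (f x).encode :=
  .comp ⟨fun a => a, fun _ _ _ h => h.2⟩ hf

theorem inDom_term {w : List Sym} {t : Term} : InDom w t ↔ t.Flat ∧ t.encode <:+: w := by
  rw [← inDom_list]
  exact exists_and_left

instance : EqCtx Sym Term := ⟨(Dfn.eq (f := fun p : Term × Term => p.1.encode)
  (g := fun p => p.2.encode) (by fun_prop) (by fun_prop)).congr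
    fun w p _ => ⟨Term.encode_inj, congrArg _⟩⟩

instance : Ctx Sym Literal where
  Γ := Ctx.Γ Sym (Bool × Term)
  fin := inferInstance
  ne := inferInstance
  rep w u l := Ctx.rep w u (l.pos, l.atom)
  functional h h' := by
    have := Ctx.functional h h'
    simp only [Prod.mk.injEq] at this
    exact congrArg₂ Literal.mk this.1 this.2
  valid := (Ctx.valid (α := Sym) (X := Bool × Term)).congr fun w u =>
    ⟨fun ⟨p, h⟩ => ⟨⟨p.1, p.2⟩, h⟩, fun ⟨l, h⟩ => ⟨(l.pos, l.atom), h⟩⟩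

@[fun_prop] theorem proj_pos {f : X → Literal} (hf : Proj Sym f) : Proj Sym fun x => (f x).pos :=
  Proj.fst (f := fun x => ((f x).pos, (f x).atom)) (.comp ⟨fun a => a, fun _ _ _ h => h⟩ hf)

@[fun_prop] theorem proj_atom {f : X → Literal} (hf : Proj Sym f) : Proj Sym fun x => (f x).atom :=
  Proj.snd (f := fun x => ((f x).pos, (f x).atom)) (.comp ⟨fun a => a, fun _ _ _ h => h⟩ hf)

@[fun_prop] theorem proj_neg {f : X → Literal} (hf : Proj Sym f) : Proj Sym fun x => (f x).neg := by
  obtain ⟨g, hg⟩ : Proj Sym fun x => (!(f x).pos, (f x).atom) := by fun_prop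
  exact ⟨g, hg⟩

theorem inDom_bool {w : List Sym} (b : Bool) : InDom w b := ⟨fun _ => b, fun _ => rfl⟩

theorem inDom_literal {w : List Sym} {l : Literal} : InDom w l ↔ InDom w l.atom :=
  (inDom_prod (p := (l.pos, l.atom))).trans (and_iff_right (inDom_bool _))

instance : EqCtx Sym Literal := ⟨((Dfn.eq (f := fun p : Literal × Literal => p.1.pos)
  (g := fun p => p.2.pos) (by fun_prop) (by fun_prop)).and (Dfn.eq (f := fun p => p.1.atom)
  (g := fun p => p.2.atom) (by fun_prop) (by fun_prop))).congr
    fun w p _ => ⟨fun h => congrArg₂ Literal.mk h.1 h.2, fun h => by rw [h]; exact ⟨rfl, rfl⟩⟩⟩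

/-! ### Definability of the structure of terms -/

theorem dfn_head : Dfn fun (_ : List Sym) (p : Term × FVar) => p.1.head = p.2 := by
  refine (Dfn.exAppend (f := fun p : Term × FVar => p.1.encode) (P := fun _ p s t =>
    s = encodeFVar p.2 ∧ ∃ r, t = .lpar :: r ∧ True) (by fun_prop)
    ((Dfn.eq (by fun_prop) (by fun_prop)).and (Dfn.exCons _ (by fun_prop) Dfn.true))).congr
    fun w p _ => ?_
  obtain ⟨⟨f, a⟩, g⟩ := p
  have h := Term.encode_app f a []
  rw [List.append_nil] at h
  dsimp only [Term.head]
  rw [h]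
  constructor
  · rintro ⟨_, _, h, rfl, r, rfl, -⟩
    exact (encodeFVar_append_inj (noDigit_cons _ (by decide)) (noDigit_cons _ (by decide)) h).1
  · rintro rfl
    exact ⟨_, _, rfl, rfl, _, rfl, trivial⟩

theorem dfn_mem_args : Dfn fun (_ : List Sym) (p : Term × Term) => p.1 ∈ p.2.args := by
  refine (Dfn.exAppend (f := fun p : Term × Term => p.2.encode) (P := fun _ p s t =>
    IsFVar s ∧ ∃ r, t = .lpar :: r ∧ ∃ a r', r = a ++ r' ∧ Star IsProp a ∧ ∃ b r'', r' = b ++ r'' ∧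
      (b = p.1.encode ∧ IsProp b) ∧ ∃ c d, r'' = c ++ d ∧ Star IsProp c ∧ d = [.rpar]) (by fun_prop)
    ((dfn_isFVar (by fun_prop)).and (Dfn.exCons _ (by fun_prop) (Dfn.exAppend (by fun_prop)
      ((Dfn.star (dfn_isProp Proj.id) (by fun_prop)).and (Dfn.exAppend (by fun_prop)
        (((Dfn.eq (by fun_prop) (by fun_prop)).and (dfn_isProp (by fun_prop))).and (Dfn.exAppend
          (by fun_prop) ((Dfn.star (dfn_isProp Proj.id) (by fun_prop)).and
            (Dfn.eqConst _ (by fun_prop))))))))))).congr fun w p hp => ?_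
  have hflat := (inDom_term.1 (inDom_prod.1 hp).2).1
  obtain ⟨t, ⟨f, a⟩⟩ := p
  have h := Term.encode_app f a []
  rw [List.append_nil] at h
  dsimp only at hflat ⊢
  rw [h]
  constructor
  · rintro ⟨_, _, h, ⟨g, rfl⟩, _, rfl, _, _, rfl, ⟨l1, h1, rfl⟩, _, _, rfl, ⟨rfl, -⟩, _, _, rfl,
      ⟨l2, h2, rfl⟩, rfl⟩
    obtain ⟨rfl, h'⟩ := encodeFVar_append_inj (noDigit_cons _ (by decide))
      (noDigit_cons _ (by decide)) h
    obtain ⟨l1', -, h3, -⟩ := flatten_enc h1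
    obtain ⟨l2', -, h4, -⟩ := flatten_enc h2
    rw [← h3, ← h4] at h'
    have := (flatMap_term_inj (l := List.ofFn a) (l' := l1' ++ t :: l2') (s := []) (s' := [])
      ((List.cons.inj h').2.trans (by simp))).1
    exact List.mem_ofFn.1 (this ▸ by simp)
  · intro ht
    obtain ⟨l1, l2, h⟩ := List.append_of_mem (List.mem_ofFn.2 ht)
    have hp : ∀ x ∈ List.ofFn a, x.head.arity = 0 := fun x hx => hflat x (List.mem_ofFn.1 hx)
    rw [h] at hp ⊢
    exact ⟨_, _, rfl, ⟨f, rfl⟩, _, rfl, l1.flatMap Term.encode, _, by simp,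
      ⟨_, map_enc fun x hx => hp x (by simp [hx]), rfl⟩, t.encode, _, rfl,
      ⟨rfl, t, hp t (by simp), rfl⟩, l2.flatMap Term.encode, _, rfl,
      ⟨_, map_enc fun x hx => hp x (by simp [hx]), rfl⟩, rfl⟩

end SO2

/-! ### Reading a formula off the input -/

namespace SO2

open NLSpace Relation

/-! ### Decoding -/

variable {X : Type} [Ctx Sym X]

/-- The clauses with one or two literals whose atoms have propositional arguments. -/
def FlatKrom (C : List Literal) : Prop := (C ≠ [] ∧ C.length ≤ 2) ∧ ∀ l ∈ C, l.atom.Flat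

def IsLiteral (s : List Sym) : Prop := ∃ l : Literal, l.atom.Flat ∧ l.encode = s

def IsClause (s : List Sym) : Prop := ∃ C, FlatKrom C ∧ encodeClause C = s

def IsQuant (s : List Sym) : Prop := ∃ p, True ∧ encodeQuant p = s

theorem dfn_eq_encode {f : X → List Sym} (hf : Proj Sym f) {g : X → Literal} (hg : Proj Sym g) :
    Dfn fun (_ : List Sym) x => f x = (g x).encode := by
  refine (((Dfn.eq (f := fun x => (g x).pos) (g := fun _ => true) (by fun_prop) (by fun_prop)).and
    (Dfn.eq (f := f) (g := fun x => (g x).atom.encode) (by fun_prop) (by fun_prop))).or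
    ((Dfn.eq (f := fun x => (g x).pos) (g := fun _ => false) (by fun_prop) (by fun_prop)).and
      (Dfn.eqCons (f := f) (g := fun x => (g x).atom.encode) .neg (by fun_prop)
        (by fun_prop)))).congr fun w x _ => ?_
  rcases g x with ⟨_ | _, t⟩ <;> simp [Literal.encode]

theorem dfn_isLiteral {f : X → List Sym} (hf : Proj Sym f) :
    Dfn fun (_ : List Sym) x => IsLiteral (f x) := by
  refine ((dfn_isTerm hf).or (Dfn.exCons (P := fun _ _ t => IsTerm t) .neg hf
    (dfn_isTerm (by fun_prop)))).congr fun w x _ => ?_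
  constructor
  · rintro (⟨t, h1, h2⟩ | ⟨_, h, t, h1, rfl⟩)
    · exact ⟨⟨true, t⟩, h1, h2⟩
    · exact ⟨⟨false, t⟩, h1, h.symm⟩
  · rintro ⟨⟨_ | _, t⟩, h1, h2⟩
    · exact .inr ⟨_, h2.symm, t, h1, rfl⟩
    · exact .inl ⟨t, h1, h2⟩

theorem dfn_isClause {f : X → List Sym} (hf : Proj Sym f) :
    Dfn fun (_ : List Sym) x => IsClause (f x) := by
  refine (Dfn.exCons (P := fun _ _ t => IsLiteral t ∨ ∃ a b, t = a ++ b ∧ IsLiteral a ∧ IsLiteral b)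
    .clause hf ((dfn_isLiteral (by fun_prop)).or (Dfn.exAppend (by fun_prop)
      ((dfn_isLiteral (by fun_prop)).and (dfn_isLiteral (by fun_prop)))))).congr fun w x _ => ?_
  constructor
  · rintro ⟨_, h, ⟨l, h1, rfl⟩ | ⟨_, _, rfl, ⟨l, h1, rfl⟩, ⟨l', h2, rfl⟩⟩⟩
    · exact ⟨[l], by simp [FlatKrom, h1], by simp [h, encodeClause]⟩
    · exact ⟨[l, l'], by simp [FlatKrom, h1, h2], by simp [h, encodeClause]⟩
  · rintro ⟨_ | ⟨l, _ | ⟨l', _ | ⟨l'', C⟩⟩⟩, ⟨⟨h1, h2⟩, h3⟩, h4⟩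
    · exact absurd rfl h1
    · exact ⟨_, h4.symm, .inl ⟨l, h3 l (by simp), by simp⟩⟩
    · exact ⟨_, h4.symm, .inr ⟨l.encode, l'.encode, by simp, ⟨l, h3 l (by simp), rfl⟩, l',
        h3 l' (by simp), rfl⟩⟩
    · simp at h2

theorem dfn_eq_encodeQuant (q : Quant) {f : X → List Sym} (hf : Proj Sym f) {g : X → FVar}
    (hg : Proj Sym g) : Dfn fun (_ : List Sym) x => f x = encodeQuant (q, g x) := by
  cases q
  · exact Dfn.eqCons (g := fun x => encodeFVar (g x)) .ex hf (by fun_prop)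
  · exact Dfn.eqCons (g := fun x => encodeFVar (g x)) .all hf (by fun_prop)

theorem dfn_isQuant {f : X → List Sym} (hf : Proj Sym f) :
    Dfn fun (_ : List Sym) x => IsQuant (f x) := by
  refine ((Dfn.exCons (P := fun _ _ t => IsFVar t) .ex hf (dfn_isFVar (by fun_prop))).or
    (Dfn.exCons (P := fun _ _ t => IsFVar t) .all hf (dfn_isFVar (by fun_prop)))).congr
    fun w x _ => ?_
  constructor
  · rintro (⟨_, h, g, rfl⟩ | ⟨_, h, g, rfl⟩)
    · exact ⟨(.ex, g), trivial, h.symm⟩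
    · exact ⟨(.all, g), trivial, h.symm⟩
  · rintro ⟨⟨_ | _, g⟩, -, h⟩
    · exact .inl ⟨_, h.symm, g, rfl⟩
    · exact .inr ⟨_, h.symm, g, rfl⟩

/-- Formulae all of whose clauses are flat and Krom. -/
def PrenexCNF.FlatKrom (φ : PrenexCNF) : Prop := ∀ C ∈ φ.clauses, SO2.FlatKrom C

/-- The formula is encoded by the word. -/
def WF (w : List Sym) : Prop := ∃ φ : PrenexCNF, φ.FlatKrom ∧ φ.encode = w

open Classical in
/-- The formula encoded by a word; the empty formula if there is none. -/
noncomputable def decode (w : List Sym) : PrenexCNF := if h : WF w then h.choose else ⟨[], []⟩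

theorem decode_encode {φ : PrenexCNF} (h : φ.FlatKrom) : decode φ.encode = φ := by
  have hw : WF φ.encode := ⟨φ, h, rfl⟩
  rw [decode, dif_pos hw]
  exact PrenexCNF.encode_inj hw.choose_spec.2

theorem flatKrom_decode (w : List Sym) : (decode w).FlatKrom := by
  by_cases hw : WF w
  · rw [decode, dif_pos hw]
    exact hw.choose_spec.1
  · rw [decode, dif_neg hw]
    intro C hC
    simp at hC

theorem encode_decode {w : List Sym} (hw : WF w) : (decode w).encode = w := by
  rw [decode, dif_pos hw]
  exact hw.choose_spec.2

theorem decode_of_not_wf {w : List Sym} (hw : ¬ WF w) : decode w = ⟨[], []⟩ := by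
  rw [decode, dif_neg hw]

theorem dfn_wf : Dfn fun (w : List Sym) (_ : X) => WF w := by
  refine (Dfn.input (P := fun _ _ w => ∃ s t, w = s ++ t ∧ Star IsQuant s ∧ Star IsClause t)
    (Dfn.exAppend (by fun_prop) ((Dfn.star (dfn_isQuant Proj.id) (by fun_prop)).and
      (Dfn.star (dfn_isClause Proj.id) (by fun_prop))))).congr fun w _ _ => ?_
  constructor
  · rintro ⟨_, _, rfl, ⟨l, h1, rfl⟩, ⟨l', h2, rfl⟩⟩
    obtain ⟨m, -, h3, -⟩ := flatten_enc h1
    obtain ⟨m', h4, h5, -⟩ := flatten_enc h2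
    exact ⟨⟨m, m'⟩, h4, by rw [← h3, ← h5]; rfl⟩
  · rintro ⟨φ, h, rfl⟩
    exact ⟨_, _, rfl, ⟨_, map_enc fun _ _ => trivial, rfl⟩, ⟨_, map_enc h, rfl⟩⟩

/-- By unique readability any decomposition of the input into quantifiers followed by clauses is the
decomposition of the decoded formula, so it may simply be guessed. -/
theorem quantAt_iff {w : List Sym} {i : ℕ} {q : Quant} {f : FVar} : (decode w).QuantAt i q f ↔
    ∃ a r, w = a ++ r ∧ CountedStar IsQuant a i ∧ ∃ b r', r = b ++ r' ∧ b = encodeQuant (q, f) ∧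
      ∃ c d, r' = c ++ d ∧ Star IsQuant c ∧ Star IsClause d := by
  constructor
  · intro h
    by_cases hw : WF w
    · obtain ⟨φ, hφ, rfl⟩ := hw
      rw [decode_encode hφ] at h
      obtain ⟨hi, h'⟩ := List.getElem?_eq_some_iff.1 h
      refine ⟨(φ.quants.take i).flatMap encodeQuant, _, ?_,
        ⟨_, map_enc fun _ _ => trivial, rfl, by simp; omega⟩, _, _, rfl, rfl,
        (φ.quants.drop (i + 1)).flatMap encodeQuant, φ.clauses.flatMap encodeClause, rfl,
        ⟨_, map_enc fun _ _ => trivial, rfl⟩, ⟨_, map_enc hφ, rfl⟩⟩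
      rw [PrenexCNF.encode]
      conv_lhs => rw [← List.take_append_drop i φ.quants, List.drop_eq_getElem_cons hi, h']
      simp
    · rw [decode_of_not_wf hw] at h
      simp [PrenexCNF.QuantAt] at h
  · rintro ⟨_, _, rfl, ⟨l1, h1, rfl, rfl⟩, _, _, rfl, rfl, _, _, rfl, ⟨l2, h2, rfl⟩, ⟨l3, h3, rfl⟩⟩
    obtain ⟨m1, -, h4, h5⟩ := flatten_enc h1
    obtain ⟨m2, -, h6, -⟩ := flatten_enc h2
    obtain ⟨m3, h7, h8, -⟩ := flatten_enc h3
    have hφ : (PrenexCNF.mk (m1 ++ (q, f) :: m2) m3).FlatKrom := h7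
    have := decode_encode hφ
    rw [← h4, ← h6, ← h8, ← h5]
    simp only [PrenexCNF.encode, List.flatMap_append, List.flatMap_cons, List.append_assoc] at this
    rw [this]
    simp [PrenexCNF.QuantAt]

theorem mem_clauses_iff {w : List Sym} {C : List Literal} : C ∈ (decode w).clauses ↔
    ∃ a r, w = a ++ r ∧ Star IsQuant a ∧ ∃ b r', r = b ++ r' ∧ Star IsClause b ∧
      ∃ c d, r' = c ++ d ∧ (c = encodeClause C ∧ IsClause c) ∧ Star IsClause d := by
  constructor
  · intro h
    by_cases hw : WF w
    · obtain ⟨φ, hφ, rfl⟩ := hw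
      rw [decode_encode hφ] at h
      obtain ⟨l1, l2, h'⟩ := List.append_of_mem h
      have hφ' := hφ
      rw [PrenexCNF.FlatKrom, h'] at hφ'
      refine ⟨φ.quants.flatMap encodeQuant, _, rfl, ⟨_, map_enc fun _ _ => trivial, rfl⟩,
        l1.flatMap encodeClause, _, by rw [h', List.flatMap_append], ⟨_, map_enc fun x hx => hφ' x
          (by simp [hx]), rfl⟩, _, _, List.flatMap_cons, ⟨rfl, C, hφ C h, rfl⟩, ⟨_, map_enc fun x hx => hφ' x
          (by simp [hx]), rfl⟩⟩
    · rw [decode_of_not_wf hw] at h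
      simp at h
  · rintro ⟨_, _, rfl, ⟨l1, h1, rfl⟩, _, _, rfl, ⟨l2, h2, rfl⟩, _, _, rfl, ⟨rfl, C', hC, hC'⟩,
      ⟨l3, h3, rfl⟩⟩
    obtain ⟨rfl, -⟩ := encodeClause_append_inj (C := C') (C' := C) (s := []) (s' := []) (by simp [ClauseEnd])
      (by simp [ClauseEnd]) (by rw [hC'])
    obtain ⟨m1, -, h4, -⟩ := flatten_enc h1
    obtain ⟨m2, h5, h6, -⟩ := flatten_enc h2
    obtain ⟨m3, h7, h8, -⟩ := flatten_enc h3
    have hφ : (PrenexCNF.mk m1 (m2 ++ C' :: m3)).FlatKrom := by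
      intro D hD
      rcases List.mem_append.1 hD with hD | hD
      · exact h5 D hD
      · rcases List.mem_cons.1 hD with rfl | hD
        · exact hC
        · exact h7 D hD
    have := decode_encode hφ
    rw [← h4, ← h6, ← h8]
    simp only [PrenexCNF.encode, List.flatMap_append, List.flatMap_cons] at this
    rw [this]
    simp

/-! ### Domains -/

theorem infix_encode_of_mem {w : List Sym} {C : List Literal} {l : Literal}
    (hC : C ∈ (decode w).clauses) (hl : l ∈ C) : l.atom.encode <:+: w := by
  obtain ⟨a, _, rfl, -, b, _, rfl, -, _, d, rfl, ⟨rfl, -⟩, -⟩ := mem_clauses_iff.1 hC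
  have h1 : l.atom.encode <:+: l.encode := by
    rcases l with ⟨_ | _, t⟩
    · exact (List.suffix_cons _ _).isInfix
    · exact List.infix_rfl
  obtain ⟨l1, l2, rfl⟩ := List.append_of_mem hl
  have h2 : l.encode <:+: encodeClause (l1 ++ l :: l2) :=
    ⟨.clause :: l1.flatMap Literal.encode, l2.flatMap Literal.encode, by simp [encodeClause]⟩
  exact (h1.trans h2).trans ⟨a ++ b, d, by simp⟩

theorem inDom_of_mem {w : List Sym} {C : List Literal} {l : Literal}
    (hC : C ∈ (decode w).clauses) (hl : l ∈ C) : InDom w l :=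
  inDom_literal.2 (inDom_term.2 ⟨(flatKrom_decode w C hC).2 l hl, infix_encode_of_mem hC hl⟩)

theorem length_quants_le (w : List Sym) : (decode w).quants.length ≤ w.length := by
  by_cases hw : WF w
  · obtain ⟨φ, hφ, rfl⟩ := hw
    rw [decode_encode hφ, PrenexCNF.encode, List.length_append]
    refine le_trans ?_ (Nat.le_add_right _ _)
    induction φ.quants with
    | nil => simp
    | cons p l ih =>
      simp only [List.flatMap_cons, encodeQuant, List.length_append, List.length_cons]
      omega
  · simp [decode_of_not_wf hw]

theorem inDom_of_quantAt {w : List Sym} {i : ℕ} {q : Quant} {f : FVar}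
    (h : (decode w).QuantAt i q f) : InDom w i ∧ InDom w f := by
  refine ⟨inDom_of_le ((List.getElem?_eq_some_iff.1 h).1.le.trans (length_quants_le w)), ?_⟩
  obtain ⟨a, _, rfl, -, _, r, rfl, rfl, -⟩ := quantAt_iff.1 h
  have h1 : encodeFVar f <:+: encodeQuant (q, f) := (List.suffix_cons _ _).isInfix
  exact inDom_fVar.2 (h1.trans ⟨a, r, by simp⟩)

theorem inDom_arg {w : List Sym} {t a : Term} (ht : InDom w t) (ha : a ∈ t.args) : InDom w a := by
  obtain ⟨h1, h2⟩ := inDom_term.1 ht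
  refine inDom_term.2 ⟨?_, List.IsInfix.trans ?_ h2⟩
  · have := h1 a ha
    rcases a with ⟨⟨_, n⟩, b⟩
    obtain rfl : _ = 0 := this
    rintro _ ⟨i, -⟩
    exact i.elim0
  · obtain ⟨f, b⟩ := t
    obtain ⟨l1, l2, h⟩ := List.append_of_mem (List.mem_ofFn.2 ha)
    have := Term.encode_app f b []
    rw [h, List.append_nil] at this
    exact ⟨encodeFVar f ++ .lpar :: l1.flatMap Term.encode, l2.flatMap Term.encode ++ [.rpar],
      by rw [this]; simp⟩

theorem inDom_head {w : List Sym} {t : Term} (ht : InDom w t) : InDom w t.head := by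
  obtain ⟨h1, h2⟩ := inDom_term.1 ht
  refine inDom_fVar.2 (List.IsInfix.trans ?_ h2)
  obtain ⟨f, b⟩ := t
  have := Term.encode_app f b []
  rw [List.append_nil] at this
  rw [this]
  exact (List.prefix_append _ _).isInfix

/-! ### Definability of the structure of the formula -/

theorem dfn_quantAt (q : Quant) {f : X → ℕ} (hf : Proj Sym f) {g : X → FVar} (hg : Proj Sym g) :
    Dfn fun w x => (decode w).QuantAt (f x) q (g x) := by
  refine (Dfn.input (P := fun _ x w => ∃ a r, w = a ++ r ∧ CountedStar IsQuant a (f x) ∧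
    ∃ b r', r = b ++ r' ∧ b = encodeQuant (q, g x) ∧
      ∃ c d, r' = c ++ d ∧ Star IsQuant c ∧ Star IsClause d)
    (Dfn.exAppend (by fun_prop) ((Dfn.countedStar (dfn_isQuant Proj.id) (by fun_prop)
      (by fun_prop)).and (Dfn.exAppend (by fun_prop) ((dfn_eq_encodeQuant q (by fun_prop)
      (by fun_prop)).and (Dfn.exAppend (by fun_prop) ((Dfn.star (dfn_isQuant Proj.id)
      (by fun_prop)).and (Dfn.star (dfn_isClause Proj.id) (by fun_prop))))))))).congr
    fun w x _ => quantAt_iff.symm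

theorem dfn_mem_clauses {C : X → List Literal}
    (hC : Dfn fun (_ : List Sym) (p : X × List Sym) => p.2 = encodeClause (C p.1)) :
    Dfn fun w x => C x ∈ (decode w).clauses := by
  have hC' : ∀ {Y : Type} [Ctx Sym Y] {f : Y → X} {g : Y → List Sym}, Proj Sym f → Proj Sym g →
      Dfn fun (_ : List Sym) y => g y = encodeClause (C (f y)) :=
    fun {_ _ f g} _ _ => hC.comp (f := fun y => (f y, g y)) (by fun_prop)
  refine (Dfn.input (P := fun _ x w => ∃ a r, w = a ++ r ∧ Star IsQuant a ∧ ∃ b r', r = b ++ r' ∧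
      Star IsClause b ∧ ∃ c d, r' = c ++ d ∧ (c = encodeClause (C x) ∧ IsClause c) ∧ Star IsClause d)
    (Dfn.exAppend (by fun_prop) ((Dfn.star (dfn_isQuant Proj.id) (by fun_prop)).and
      (Dfn.exAppend (by fun_prop) ((Dfn.star (dfn_isClause Proj.id) (by fun_prop)).and
        (Dfn.exAppend (by fun_prop) (((hC' (by fun_prop) (by fun_prop)).and (dfn_isClause (by fun_prop))).and
          (Dfn.star (dfn_isClause Proj.id) (by fun_prop))))))))).congr
    fun w x _ => mem_clauses_iff.symm

theorem dfn_unit_clause {f : X → Literal} (hf : Proj Sym f) :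
    Dfn fun w x => [f x] ∈ (decode w).clauses := by
  refine dfn_mem_clauses ((Dfn.exCons (f := fun p : X × List Sym => p.2)
    (P := fun _ p t => t = (f p.1).encode) .clause
    (by fun_prop) (dfn_eq_encode (by fun_prop) (by fun_prop))).congr fun w x _ => ?_)
  simp [encodeClause]

theorem dfn_pair_clause {f g : X → Literal} (hf : Proj Sym f) (hg : Proj Sym g) :
    Dfn fun w x => [f x, g x] ∈ (decode w).clauses := by
  refine dfn_mem_clauses ((Dfn.exCons (f := fun p : X × List Sym => p.2)
    (P := fun _ p t => ∃ a b, t = a ++ b ∧ a = (f p.1).encode ∧ b = (g p.1).encode) .clause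
    (by fun_prop) (Dfn.exAppend (by fun_prop) ((dfn_eq_encode (by fun_prop) (by fun_prop)).and
      (dfn_eq_encode (by fun_prop) (by fun_prop))))).congr fun w x _ => ?_)
  simp [encodeClause]

end SO2

/-! ### The syntactic class and the graph criterion in definable form -/

namespace SO2

open NLSpace Relation

namespace PrenexCNF

variable {φ : PrenexCNF}

/-! ### Elementary reformulations -/

theorem block_zero : φ.block 0 = 0 := by simp [block]

/-- Some quantifier occurs at exactly one of the two positions. -/
def Change (φ : PrenexCNF) (i j : ℕ) : Prop :=
  ¬ ∀ q, (∃ f, φ.QuantAt i q f) ↔ ∃ f, φ.QuantAt j q f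

theorem change_iff {i j : ℕ} :
    φ.Change i j ↔ (φ.quants[i]?).map Prod.fst ≠ (φ.quants[j]?).map Prod.fst := by
  refine not_congr ?_
  rw [Option.ext_iff]
  simp [QuantAt]

theorem block_succ (i : ℕ) : (φ.Change i (i + 1) ∧ φ.block (i + 1) = φ.block i + 1) ∨
    (¬ φ.Change i (i + 1) ∧ φ.block (i + 1) = φ.block i) := by
  rw [change_iff]
  unfold block
  rw [Finset.range_add_one, Finset.filter_insert]
  split_ifs with h
  · left
    rw [Finset.card_insert_of_notMem (by simp)]
    exact ⟨h, rfl⟩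
  · exact .inr ⟨h, rfl⟩

theorem block_le (i : ℕ) : φ.block i ≤ i := by
  induction i with
  | zero => simp [block_zero]
  | succ i ih => rcases φ.block_succ i with h | h <;> omega

/-- The number of alternations is verified by walking back along the prefix, where every step
compares two neighbouring positions only. -/
theorem block_iff {i b : ℕ} : φ.block i = b ↔
    ReflTransGen (fun p q : ℕ × ℕ => p.1 = q.1 + 1 ∧
      ((φ.Change q.1 p.1 ∧ p.2 = q.2 + 1) ∨ (¬ φ.Change q.1 p.1 ∧ p.2 = q.2))) (i, b) (0, 0) := by
  constructor
  · rintro rfl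
    induction i with
    | zero => rw [block_zero]
    | succ i ih => exact .head (b := (i, φ.block i)) ⟨rfl, φ.block_succ i⟩ ih
  · intro h
    generalize hp : (i, b) = p at h
    induction h using ReflTransGen.head_induction_on generalizing i b with
    | refl => cases hp; exact block_zero
    | @head _ q h _ ih =>
      subst hp
      obtain ⟨j, c⟩ := q
      obtain ⟨h1, h2⟩ := h
      dsimp only at h1 h2
      subst h1
      have := ih rfl
      rcases φ.block_succ j with h | h <;> rcases h2 with h2 | h2
      · omega
      · exact absurd h.1 h2.1
      · exact absurd h2.1 h.1
      · omega

theorem mem_subterms_self (t : Term) : t ∈ t.subterms := by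
  cases t
  simp [Term.subterms]

theorem BraidedUSK.flatKrom (h : φ.BraidedUSK) : φ.FlatKrom := fun C hC =>
  ⟨h.krom C hC, fun l hl => h.simple _ ⟨C, hC, l, hl, mem_subterms_self _⟩⟩

theorem mem_subterms_iff {s t : Term} (hs : s.Flat) : t ∈ s.subterms ↔ t = s ∨ t ∈ s.args := by
  obtain ⟨f, a⟩ := s
  have : ∀ i, (a i).subterms = {a i} := by
    intro i
    have h : (a i).head.arity = 0 := hs _ ⟨i, rfl⟩
    rcases ha : a i with ⟨⟨_, n⟩, b⟩
    rw [ha] at h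
    obtain rfl : _ = 0 := h
    have : IsEmpty (Fin (FVar.mk 0 n).arity) := inferInstanceAs (IsEmpty (Fin 0))
    simp [Term.subterms]
  simp only [Term.subterms, this, Term.args, Set.mem_union, Set.mem_singleton_iff, Set.mem_iUnion,
    Set.mem_range, eq_comm]

/-- Clauses are not among the represented objects; with at most two literals in a clause,
quantification over literals replaces quantification over clauses. -/
theorem mem_terms_iff (h : φ.FlatKrom) {t : Term} : t ∈ φ.terms ↔
    ∃ l : Literal, ([l] ∈ φ.clauses ∨ ∃ l', [l, l'] ∈ φ.clauses ∨ [l', l] ∈ φ.clauses) ∧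
      (t = l.atom ∨ t ∈ l.atom.args) := by
  constructor
  · rintro ⟨C, hC, l, hl, ht⟩
    rw [mem_subterms_iff ((h C hC).2 l hl)] at ht
    refine ⟨l, ?_, ht⟩
    obtain ⟨⟨h1, h2⟩, -⟩ := h C hC
    rcases C with _ | ⟨l1, _ | ⟨l2, _ | ⟨l3, C⟩⟩⟩
    · exact absurd rfl h1
    · obtain rfl := List.mem_singleton.1 hl
      exact .inl hC
    · rcases List.mem_cons.1 hl with rfl | hl
      · exact .inr ⟨l2, .inl hC⟩
      · obtain rfl := List.mem_singleton.1 hl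
        exact .inr ⟨l1, .inr hC⟩
    · simp at h2
  · rintro ⟨l, hl, ht⟩
    obtain ⟨C, hC, hl⟩ : ∃ C ∈ φ.clauses, l ∈ C := by
      rcases hl with hl | ⟨l', hl | hl⟩
      · exact ⟨_, hl, by simp⟩
      · exact ⟨_, hl, by simp⟩
      · exact ⟨_, hl, by simp⟩
    exact ⟨C, hC, l, hl, (mem_subterms_iff ((h C hC).2 l hl)).2 ht⟩

theorem distinctQuants_iff : φ.DistinctQuants ↔
    ∀ f i j q q', φ.QuantAt i q f → φ.QuantAt j q' f → i = j := by
  unfold DistinctQuants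
  rw [List.nodup_iff_injective_getElem]
  constructor
  · intro h f i j q q' hi hj
    obtain ⟨hi, hi'⟩ := List.getElem?_eq_some_iff.1 hi
    obtain ⟨hj, hj'⟩ := List.getElem?_eq_some_iff.1 hj
    have := @h ⟨i, by simpa using hi⟩ ⟨j, by simpa using hj⟩ (by simp [hi', hj'])
    exact congrArg Fin.val this
  · rintro h ⟨i, hi⟩ ⟨j, hj⟩ hij
    simp only [List.getElem_map] at hij
    have hi' : i < φ.quants.length := by simpa using hi
    have hj' : j < φ.quants.length := by simpa using hj
    exact Fin.ext (h φ.quants[i].2 i j φ.quants[i].1 φ.quants[j].1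
      (List.getElem?_eq_some_iff.2 ⟨hi', rfl⟩) (List.getElem?_eq_some_iff.2 ⟨hj', by rw [hij]⟩))

theorem mem_quants_iff {f : FVar} : f ∈ φ.quants.map Prod.snd ↔ ∃ i q, φ.QuantAt i q f := by
  constructor
  · intro h
    obtain ⟨⟨q, g⟩, h', rfl⟩ := List.mem_map.1 h
    obtain ⟨i, hi⟩ := List.mem_iff_getElem?.1 h'
    exact ⟨i, q, hi⟩
  · rintro ⟨i, q, h⟩
    exact List.mem_map.2 ⟨(q, f), List.mem_iff_getElem?.2 ⟨i, h⟩, rfl⟩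

/-- Being Krom and simple is already enforced when the input is parsed; what remains quantifies over
terms, variables and positions only. -/
theorem braidedUSK_iff (h : φ.FlatKrom) : φ.BraidedUSK ↔
    (∀ f i j q q', φ.QuantAt i q f → φ.QuantAt j q' f → i = j) ∧
    (∀ t, t ∈ φ.terms → ∃ i q, φ.QuantAt i q t.head) ∧
    (∀ s t, s ∈ φ.terms → t ∈ φ.terms → s.head = t.head → s = t) ∧
    ∀ t a i j q q', t ∈ φ.terms → a ∈ t.args → φ.QuantAt i q t.head → φ.QuantAt j q' a.head →
      i < j ∧ φ.block j ≤ φ.block i + (match q with | .ex => 1 | .all => 2) := by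
  constructor
  · intro hφ
    exact ⟨distinctQuants_iff.1 hφ.distinct, fun t ht => mem_quants_iff.1 (hφ.closed t ht),
      fun s t hs ht => hφ.unique s hs t ht, fun t a i j q q' ht ha => hφ.braided t ht a ha i j q q'⟩
  · rintro ⟨h1, h2, h3, h4⟩
    refine ⟨distinctQuants_iff.2 h1, fun t ht => mem_quants_iff.2 (h2 t ht),
      fun s hs t ht => h3 s t hs ht, ?_, fun C hC => (h C hC).1,
      fun t ht a ha i j q q' => h4 t a i j q q' ht ha⟩
    rintro t ⟨C, hC, l, hl, ht⟩ a ha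
    have hf := (h C hC).2 l hl
    rcases (mem_subterms_iff hf).1 ht with rfl | ht
    · exact hf a ha
    · have := hf t ht
      obtain ⟨⟨_, n⟩, b⟩ := t
      obtain rfl : _ = 0 := this
      obtain ⟨i, -⟩ := ha
      exact i.elim0

/-- The literals lie on a common cycle. -/
def Conn (φ : PrenexCNF) (l l' : Literal) : Prop := φ.Path l l' ∧ φ.Path l' l

/-- The components of two vertices depend on each other. -/
def Dep (φ : PrenexCNF) (l l' : Literal) : Prop := (l ∈ φ.vertices ∧ l' ∈ φ.vertices) ∧
  ∃ u v, φ.Conn l u ∧ φ.Conn l' v ∧ φ.IsUniversal u.atom.head ∧ φ.DependsOn u v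

theorem Conn.symm {l l' : Literal} (h : φ.Conn l l') : φ.Conn l' l := And.symm h

theorem Conn.trans {l l' l'' : Literal} (h : φ.Conn l l') (h' : φ.Conn l' l'') : φ.Conn l l'' :=
  ⟨h.1.trans h'.1, h'.2.trans h.2⟩

theorem Conn.refl (l : Literal) : φ.Conn l l := ⟨.refl, .refl⟩

theorem Edge.mem_vertices {l l' : Literal} (h : φ.Edge l l') : l ∈ φ.vertices ∧ l' ∈ φ.vertices := by
  rcases h with h | h | ⟨h, rfl⟩
  · exact ⟨⟨_, h, l.neg, by simp, mem_subterms_self _⟩, ⟨_, h, l', by simp, mem_subterms_self _⟩⟩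
  · exact ⟨⟨_, h, l.neg, by simp, mem_subterms_self _⟩, ⟨_, h, l', by simp, mem_subterms_self _⟩⟩
  · exact ⟨⟨_, h, l', by simp, mem_subterms_self _⟩, ⟨_, h, l', by simp, mem_subterms_self _⟩⟩

theorem Path.mem_vertices {l l' : Literal} (h : φ.Path l l') (hl : l ∈ φ.vertices) :
    l' ∈ φ.vertices := by
  rcases ReflTransGen.cases_tail h with rfl | ⟨_, -, h⟩
  · exact hl
  · exact h.mem_vertices.2

theorem componentDependsOn_iff {l l' : Literal} (hl : l ∈ φ.vertices) (hl' : l' ∈ φ.vertices) :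
    φ.ComponentDependsOn (φ.component l) (φ.component l') ↔ φ.Dep l l' := by
  constructor
  · rintro ⟨-, -, u, hu, v, hv, h⟩
    exact ⟨⟨hl, hl'⟩, u, v, hu, hv, h⟩
  · rintro ⟨-, u, v, hu, hv, h⟩
    exact ⟨⟨l, hl, rfl⟩, ⟨l', hl', rfl⟩, u, hu, v, hv, h⟩

/-- Components are sets and may be too large to be stored, so a cycle among them is traced through
representatives. -/
theorem noCycle_iff : (∀ S, ¬ TransGen φ.ComponentDependsOn S S) ↔
    ¬ ∃ l l', φ.Dep l l' ∧ ReflTransGen φ.Dep l' l := by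
  constructor
  · rintro h ⟨l, l', h1, h2⟩
    have key : ∀ {a b}, φ.Dep a b → φ.ComponentDependsOn (φ.component a) (φ.component b) :=
      fun h => (componentDependsOn_iff h.1.1 h.1.2).2 h
    refine h (φ.component l) (TransGen.head' (key h1) ?_)
    exact reflTransGen_map φ.component (fun _ _ => key) h2
  · intro h S hS
    have key : ∀ {S S'}, TransGen φ.ComponentDependsOn S S' → ∀ l ∈ φ.vertices,
        S = φ.component l → ∃ l' ∈ φ.vertices, S' = φ.component l' ∧ TransGen φ.Dep l l' := by
      intro S S' h
      induction h with
      | single h =>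
        rintro l hl rfl
        obtain ⟨l', hl', rfl⟩ := h.2.1
        exact ⟨l', hl', rfl, .single ((componentDependsOn_iff hl hl').1 h)⟩
      | tail _ h ih =>
        rintro l hl rfl
        obtain ⟨m, hm, rfl, h1⟩ := ih l hl rfl
        obtain ⟨l', hl', rfl⟩ := h.2.1
        exact ⟨l', hl', rfl, h1.tail ((componentDependsOn_iff hm hl').1 h)⟩
    have hS' : φ.IsComponent S := by
      obtain ⟨_, h, -⟩ := TransGen.head'_iff.1 hS
      exact h.1
    obtain ⟨l, hl, rfl⟩ := hS'
    obtain ⟨l', hl', h1, h2⟩ := key hS l hl rfl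
    -- The traced path may return to another representative of the same component. As `Dep` does not
    -- depend on representatives, its last step can be redirected to `l`.
    have hc : φ.Conn l l' := show l' ∈ φ.component l from h1 ▸ Conn.refl l'
    obtain ⟨m, h3, ⟨⟨h4, -⟩, u, v, h5, h6, h7⟩⟩ := TransGen.tail'_iff.1 h2
    have h8 : TransGen φ.Dep l l := TransGen.tail' h3 ⟨⟨h4, hl⟩, u, v, h5, hc.trans h6, h7⟩
    obtain ⟨m, h9, h10⟩ := TransGen.head'_iff.1 h8
    exact h ⟨l, m, h9, h10⟩

theorem graphCondition_iff : φ.GraphCondition ↔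
    (∀ u u', u ∈ φ.vertices → u' ∈ φ.vertices → φ.IsUniversal u.atom.head →
      φ.IsUniversal u'.atom.head → ¬ u = u' → ¬ φ.Path u u') ∧
    (∀ v, v ∈ φ.vertices → ¬ φ.Conn v v.neg) ∧
    (∀ u v, u ∈ φ.vertices → φ.Conn u v → φ.IsUniversal u.atom.head →
      φ.IsExistential v.atom.head → φ.DependsOn v u) ∧
    ¬ ∃ l l', φ.Dep l l' ∧ ReflTransGen φ.Dep l' l := by
  rw [← noCycle_iff]
  constructor
  · intro h
    refine ⟨fun u u' hu hu' => h.noUniversalPath u hu u' hu', fun v hv hc =>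
      h.noContradiction _ ⟨v, hv, rfl⟩ v (Conn.refl v) hc, fun u v hu hc => ?_, h.noCycle⟩
    exact h.properDependency _ ⟨u, hu, rfl⟩ u (Conn.refl u) v hc
  · rintro ⟨h1, h2, h3, h4⟩
    refine ⟨fun u hu u' hu' => h1 u u' hu hu', ?_, ?_, h4⟩
    · rintro _ ⟨l, hl, rfl⟩ v hv hv'
      exact h2 v (Path.mem_vertices hv.1 hl) ((Conn.symm hv).trans hv')
    · rintro _ ⟨l, hl, rfl⟩ u hu v hv
      exact h3 u v (Path.mem_vertices hu.1 hl) ((Conn.symm hu).trans hv)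

end PrenexCNF

/-! ### Definability of the criterion -/

section Definability

instance : Finite Quant :=
  Finite.of_injective (fun q => decide (q = .ex)) fun q q' h => by cases q <;> cases q' <;> simp_all

variable {X : Type} [Ctx Sym X] {f g : X → Literal} {i j : X → ℕ} {s t : X → Term}

theorem dfn_change (hi : Proj Sym i) (hj : Proj Sym j) :
    Dfn fun w x => (decode w).Change (i x) (j x) := by
  have h : ∀ q (k : X → ℕ), Proj Sym k → Dfn fun w x => ∃ f, (decode w).QuantAt (k x) q f :=
    fun q k hk => Dfn.ex (dfn_quantAt q (by fun_prop) (by fun_prop))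
      fun w x y _ h => (inDom_of_quantAt h).2
  refine Dfn.congr (Dfn.forallFinite fun q => ((h q i hi).imp (h q j hj)).and
    ((h q j hj).imp (h q i hi))).not fun w x _ => ?_
  exact not_congr (forall_congr' fun q => iff_def.symm)

theorem dfn_block (hi : Proj Sym i) (hj : Proj Sym j) :
    Dfn fun w x => (decode w).block (i x) = j x := by
  refine (Dfn.rtgOn (R := fun w (p q : ℕ × ℕ) => p.1 = q.1 + 1 ∧
      (((decode w).Change q.1 p.1 ∧ p.2 = q.2 + 1) ∨ (¬ (decode w).Change q.1 p.1 ∧ p.2 = q.2)))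
    ((Dfn.numSucc (by fun_prop) (by fun_prop)).and (((dfn_change (by fun_prop) (by fun_prop)).and
      (Dfn.numSucc (by fun_prop) (by fun_prop))).or ((dfn_change (by fun_prop) (by fun_prop)).not.and
      (Dfn.eq (by fun_prop) (by fun_prop))))) ?_ (f := fun x => (i x, j x)) (g := fun _ => (0, 0))
      (by fun_prop) (by fun_prop)).congr fun w x _ => PrenexCNF.block_iff.symm
  rintro w p q hp ⟨h1, h2⟩
  simp only [inDom_prod] at hp ⊢
  exact ⟨inDom_mono (by omega) hp.1, inDom_mono (by omega) hp.2⟩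

theorem dfn_block_eq (hi : Proj Sym i) (hj : Proj Sym j) :
    Dfn fun w x => (decode w).block (i x) = (decode w).block (j x) := by
  refine (Dfn.ex (P := fun w x b => (decode w).block (i x) = b ∧ (decode w).block (j x) = b)
    ((dfn_block (by fun_prop) (by fun_prop)).and (dfn_block (by fun_prop) (by fun_prop)))
    fun w x b hx h => ?_).congr fun w x _ => ?_
  · exact inDom_mono (h.1 ▸ PrenexCNF.block_le _) (hi.inDom hx)
  · simp [eq_comm]

theorem dfn_le_add (k : ℕ) (hi : Proj Sym i) (hj : Proj Sym j) :
    Dfn fun (_ : List Sym) x => i x ≤ j x + k := by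
  have : Dfn fun (_ : List Sym) x => j x + k < i x := by
    induction k generalizing X with
    | zero => exact Dfn.numLt hj hi
    | succ k ih =>
      refine (Dfn.ex (P := fun _ x m => m = j x + 1 ∧ m + k < i x)
        ((Dfn.numSucc (by fun_prop) (by fun_prop)).and (ih (by fun_prop) (by fun_prop)))
        fun w x m hx h => inDom_mono (by omega) (hi.inDom hx)).congr fun w x _ => ?_
      exact ⟨fun ⟨m, h⟩ => by omega, fun h => ⟨_, rfl, by omega⟩⟩
  exact this.not.congr fun w x _ => not_lt

theorem dfn_block_le (k : ℕ) (hi : Proj Sym i) (hj : Proj Sym j) :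
    Dfn fun w x => (decode w).block (j x) ≤ (decode w).block (i x) + k := by
  refine (Dfn.ex (P := fun w x b => (decode w).block (i x) = b ∧
    ∃ c, (decode w).block (j x) = c ∧ c ≤ b + k)
    ((dfn_block (by fun_prop) (by fun_prop)).and (Dfn.ex (X := X × ℕ)
      (P := fun w p c => (decode w).block (j p.1) = c ∧ c ≤ p.2 + k)
      ((dfn_block (by fun_prop) (by fun_prop)).and (dfn_le_add k (by fun_prop) (by fun_prop)))
      fun w x b hx h => ?_)) fun w x b hx h => ?_).congr fun w x _ => ?_
  · exact inDom_mono (h.1 ▸ PrenexCNF.block_le _) (hj.inDom (inDom_prod.1 hx).1)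
  · exact inDom_mono (h.1 ▸ PrenexCNF.block_le _) (hi.inDom hx)
  · simp

theorem dfn_quantAt_head (q : Quant) (hi : Proj Sym i) (ht : Proj Sym t) :
    Dfn fun w x => (decode w).QuantAt (i x) q (t x).head :=
  (Dfn.ex (P := fun w x f => (t x).head = f ∧ (decode w).QuantAt (i x) q f)
    ((dfn_head.comp (f := fun p : X × FVar => (t p.1, p.2)) (by fun_prop)).and
      (dfn_quantAt q (by fun_prop) (by fun_prop)))
    fun w x f _ h => (inDom_of_quantAt h.2).2).congr fun w x _ => by simp

theorem dfn_head_eq (hs : Proj Sym s) (ht : Proj Sym t) :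
    Dfn fun (_ : List Sym) x => (s x).head = (t x).head :=
  (Dfn.ex (P := fun _ x f => (s x).head = f ∧ (t x).head = f)
    ((dfn_head.comp (f := fun p : X × FVar => (s p.1, p.2)) (by fun_prop)).and
      (dfn_head.comp (f := fun p : X × FVar => (t p.1, p.2)) (by fun_prop)))
    fun w x f hx h => h.1 ▸ inDom_head (hs.inDom hx)).congr fun w x _ => by simp [eq_comm]

theorem dfn_isUniversal (ht : Proj Sym t) : Dfn fun w x => (decode w).IsUniversal (t x).head :=
  Dfn.ex (dfn_quantAt_head _ (by fun_prop) (by fun_prop)) fun _ _ _ _ h => (inDom_of_quantAt h).1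

theorem dfn_isExistential (ht : Proj Sym t) : Dfn fun w x => (decode w).IsExistential (t x).head :=
  Dfn.ex (dfn_quantAt_head _ (by fun_prop) (by fun_prop)) fun _ _ _ _ h => (inDom_of_quantAt h).1

theorem dfn_before (hs : Proj Sym s) (ht : Proj Sym t) :
    Dfn fun w x => (decode w).Before (s x).head (t x).head :=
  Dfn.ex (Dfn.ex (Dfn.exFinite fun q => Dfn.exFinite fun q' =>
    (dfn_quantAt_head q (by fun_prop) (by fun_prop)).and
    ((dfn_quantAt_head q' (by fun_prop) (by fun_prop)).and (Dfn.numLt (by fun_prop) (by fun_prop))))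
    fun _ _ _ _ ⟨_, _, _, h, _⟩ => (inDom_of_quantAt h).1)
    fun _ _ _ _ ⟨_, _, _, h, _⟩ => (inDom_of_quantAt h).1

theorem dfn_sameBlock (hs : Proj Sym s) (ht : Proj Sym t) :
    Dfn fun w x => (decode w).SameBlock (s x).head (t x).head :=
  Dfn.ex (Dfn.ex (Dfn.exFinite fun q => Dfn.exFinite fun q' =>
    (dfn_quantAt_head q (by fun_prop) (by fun_prop)).and
    ((dfn_quantAt_head q' (by fun_prop) (by fun_prop)).and (dfn_block_eq (by fun_prop) (by fun_prop))))
    fun _ _ _ _ ⟨_, _, _, h, _⟩ => (inDom_of_quantAt h).1)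
    fun _ _ _ _ ⟨_, _, _, h, _⟩ => (inDom_of_quantAt h).1

theorem dfn_args (hs : Proj Sym s) (ht : Proj Sym t) :
    Dfn fun (_ : List Sym) x => s x ∈ (t x).args :=
  dfn_mem_args.comp (f := fun x => (s x, t x)) (by fun_prop)

theorem dfn_terms (ht : Proj Sym t) : Dfn fun w x => t x ∈ (decode w).terms := by
  refine (Dfn.ex (P := fun w x (l : Literal) => ([l] ∈ (decode w).clauses ∨
      ∃ l', [l, l'] ∈ (decode w).clauses ∨ [l', l] ∈ (decode w).clauses) ∧
      (t x = l.atom ∨ t x ∈ l.atom.args))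
    (((dfn_unit_clause (by fun_prop)).or (Dfn.ex ((dfn_pair_clause (by fun_prop) (by fun_prop)).or
      (dfn_pair_clause (by fun_prop) (by fun_prop))) ?_)).and
      ((Dfn.eq (by fun_prop) (by fun_prop)).or (dfn_args (by fun_prop) (by fun_prop)))) ?_).congr
    fun w x _ => (PrenexCNF.mem_terms_iff (flatKrom_decode w)).symm
  · rintro w x l' _ (h | h)
    · exact inDom_of_mem h (by simp)
    · exact inDom_of_mem h (by simp)
  · rintro w x l _ ⟨h | ⟨l', h | h⟩, -⟩
    · exact inDom_of_mem h (by simp)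
    · exact inDom_of_mem h (by simp)
    · exact inDom_of_mem h (by simp)

theorem inDom_of_terms {w : List Sym} {t : Term} (h : t ∈ (decode w).terms) : InDom w t := by
  obtain ⟨C, hC, l, hl, ht⟩ := h
  have := inDom_literal.1 (inDom_of_mem hC hl)
  rcases (PrenexCNF.mem_subterms_iff ((flatKrom_decode w C hC).2 l hl)).1 ht with rfl | ht
  · exact this
  · exact inDom_arg this ht

theorem inDom_of_vertices {w : List Sym} {l : Literal} (h : l ∈ (decode w).vertices) : InDom w l :=
  inDom_literal.2 (inDom_of_terms h)

theorem dfn_braidedUSK : Dfn fun w (_ : X) => (decode w).BraidedUSK := by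
  refine Dfn.congr (Dfn.and (P := fun w _ => ∀ f i j q q', (decode w).QuantAt i q f →
    (decode w).QuantAt j q' f → i = j) ?_ (Dfn.and (P := fun w _ => ∀ t, t ∈ (decode w).terms →
    ∃ i q, (decode w).QuantAt i q t.head) ?_ (Dfn.and (P := fun w _ => ∀ s t, s ∈ (decode w).terms →
    t ∈ (decode w).terms → s.head = t.head → s = t) ?_ (Q := fun w _ =>
    ∀ t a i j q q', t ∈ (decode w).terms → a ∈ t.args → (decode w).QuantAt i q t.head →
      (decode w).QuantAt j q' a.head → i < j ∧ (decode w).block j ≤ (decode w).block i +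
        (match q with | .ex => 1 | .all => 2)) ?_)))
    fun w x _ => (PrenexCNF.braidedUSK_iff (flatKrom_decode w)).symm
  · refine Dfn.forall (Dfn.forall (Dfn.forall (Dfn.forallFinite fun q => Dfn.forallFinite fun q' =>
      (dfn_quantAt q (by fun_prop) (by fun_prop)).imp ((dfn_quantAt q' (by fun_prop)
        (by fun_prop)).imp (Dfn.eq (by fun_prop) (by fun_prop)))) ?_) ?_) ?_
    all_goals
      intro w x y _ h
      push Not at h
    · obtain ⟨_, _, _, h, _⟩ := h
      exact (inDom_of_quantAt h).1
    · obtain ⟨_, _, _, h, _⟩ := h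
      exact (inDom_of_quantAt h).1
    · obtain ⟨_, _, _, _, h, _⟩ := h
      exact (inDom_of_quantAt h).2
  · refine Dfn.forall ((dfn_terms (by fun_prop)).imp (Dfn.ex (Dfn.exFinite fun q =>
      dfn_quantAt_head q (by fun_prop) (by fun_prop)) ?_)) ?_
    · rintro w x y _ ⟨q, h⟩
      exact (inDom_of_quantAt h).1
    · intro w x y _ h
      push Not at h
      exact inDom_of_terms h.1
  · refine Dfn.forall (Dfn.forall ((dfn_terms (by fun_prop)).imp ((dfn_terms (by fun_prop)).imp
      ((dfn_head_eq (by fun_prop) (by fun_prop)).imp (Dfn.eq (by fun_prop) (by fun_prop))))) ?_) ?_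
    all_goals
      intro w x y _ h
      push Not at h
    · exact inDom_of_terms h.2.1
    · obtain ⟨_, h, _⟩ := h
      exact inDom_of_terms h
  · refine Dfn.forall (Dfn.forall (Dfn.forall (Dfn.forall (Dfn.forallFinite fun q =>
      Dfn.forallFinite fun q' => (dfn_terms (by fun_prop)).imp ((dfn_args (by fun_prop)
        (by fun_prop)).imp ((dfn_quantAt_head q (by fun_prop) (by fun_prop)).imp
        ((dfn_quantAt_head q' (by fun_prop) (by fun_prop)).imp ((Dfn.numLt (by fun_prop)
        (by fun_prop)).and (dfn_block_le _ (by fun_prop) (by fun_prop))))))) ?_) ?_) ?_) ?_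
    all_goals
      intro w x y _ h
      push Not at h
    · obtain ⟨_, _, _, _, _, h, _⟩ := h
      exact (inDom_of_quantAt h).1
    · obtain ⟨_, _, _, _, _, h, _⟩ := h
      exact (inDom_of_quantAt h).1
    · obtain ⟨_, _, _, _, h, h', _⟩ := h
      exact inDom_arg (inDom_of_terms h) h'
    · obtain ⟨_, _, _, _, _, h, _⟩ := h
      exact inDom_of_terms h

theorem dfn_edge (hf : Proj Sym f) (hg : Proj Sym g) :
    Dfn fun w x => (decode w).Edge (f x) (g x) :=
  (dfn_pair_clause (by fun_prop) (by fun_prop)).or ((dfn_pair_clause (by fun_prop)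
    (by fun_prop)).or ((dfn_unit_clause (by fun_prop)).and (Dfn.eq (by fun_prop) (by fun_prop))))

theorem dfn_path (hf : Proj Sym f) (hg : Proj Sym g) :
    Dfn fun w x => (decode w).Path (f x) (g x) :=
  Dfn.rtgOn (dfn_edge (by fun_prop) (by fun_prop))
    (fun _ _ _ _ h => inDom_of_vertices h.mem_vertices.2) hf hg

theorem inDom_of_path {w : List Sym} {l l' : Literal} (h : (decode w).Path l l') (hl : InDom w l) :
    InDom w l' := by
  rcases ReflTransGen.cases_tail h with rfl | ⟨_, -, h⟩
  · exact hl
  · exact inDom_of_vertices h.mem_vertices.2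

theorem dfn_conn (hf : Proj Sym f) (hg : Proj Sym g) :
    Dfn fun w x => (decode w).Conn (f x) (g x) :=
  (dfn_path hf hg).and (dfn_path hg hf)

theorem dfn_dependsOn (hf : Proj Sym f) (hg : Proj Sym g) :
    Dfn fun w x => (decode w).DependsOn (f x) (g x) := by
  refine (dfn_args (by fun_prop) (by fun_prop)).or ((dfn_before (by fun_prop) (by fun_prop)).and
    (Dfn.forall ((dfn_args (by fun_prop) (by fun_prop)).imp ((dfn_args (by fun_prop)
      (by fun_prop)).or (((dfn_isUniversal (by fun_prop)).and (dfn_before (by fun_prop)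
      (by fun_prop))).or ((dfn_isExistential (by fun_prop)).and ((dfn_before (by fun_prop)
      (by fun_prop)).or (dfn_sameBlock (by fun_prop) (by fun_prop))))))) ?_))
  intro w x a hx h
  exact inDom_arg (inDom_literal.1 (hg.inDom hx)) (Classical.not_imp.1 h).1

theorem dfn_vertices (hf : Proj Sym f) : Dfn fun w x => f x ∈ (decode w).vertices :=
  dfn_terms (by fun_prop)

theorem dfn_dep (hf : Proj Sym f) (hg : Proj Sym g) : Dfn fun w x => (decode w).Dep (f x) (g x) := by
  refine ((dfn_vertices hf).and (dfn_vertices hg)).and (Dfn.ex (Dfn.ex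
    ((dfn_conn (by fun_prop) (by fun_prop)).and ((dfn_conn (by fun_prop) (by fun_prop)).and
      ((dfn_isUniversal (by fun_prop)).and (dfn_dependsOn (by fun_prop) (by fun_prop))))) ?_) ?_)
  · intro w p v hp h
    exact inDom_of_path h.2.1.1 (hg.inDom (inDom_prod.1 hp).1)
  · rintro w x u hx ⟨v, h, -⟩
    exact inDom_of_path h.1 (hf.inDom hx)

theorem dfn_graphCondition : Dfn fun w (_ : X) => (decode w).GraphCondition := by
  refine Dfn.congr (Dfn.and (P := fun w _ => ∀ u u', u ∈ (decode w).vertices →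
      u' ∈ (decode w).vertices → (decode w).IsUniversal u.atom.head →
      (decode w).IsUniversal u'.atom.head → ¬ u = u' → ¬ (decode w).Path u u') ?_
    (Dfn.and (P := fun w _ => ∀ v, v ∈ (decode w).vertices → ¬ (decode w).Conn v v.neg) ?_
    (Dfn.and (P := fun w _ => ∀ u v, u ∈ (decode w).vertices → (decode w).Conn u v →
      (decode w).IsUniversal u.atom.head → (decode w).IsExistential v.atom.head →
      (decode w).DependsOn v u) ?_
    (Dfn.not (P := fun w _ => ∃ l l', (decode w).Dep l l' ∧ ReflTransGen (decode w).Dep l' l) ?_))))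
    fun w x _ => PrenexCNF.graphCondition_iff.symm
  · refine Dfn.forall (Dfn.forall ((dfn_vertices (by fun_prop)).imp ((dfn_vertices
      (by fun_prop)).imp ((dfn_isUniversal (by fun_prop)).imp ((dfn_isUniversal (by fun_prop)).imp
      ((Dfn.eq (by fun_prop) (by fun_prop)).not.imp (dfn_path (by fun_prop)
        (by fun_prop)).not))))) ?_) ?_
    all_goals
      intro w x y _ h
      push Not at h
    · exact inDom_of_vertices h.2.1
    · obtain ⟨_, h, _⟩ := h
      exact inDom_of_vertices h
  · refine Dfn.forall ((dfn_vertices (by fun_prop)).imp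
      (dfn_conn (by fun_prop) (by fun_prop)).not) ?_
    intro w x y _ h
    push Not at h
    exact inDom_of_vertices h.1
  · refine Dfn.forall (Dfn.forall ((dfn_vertices (by fun_prop)).imp ((dfn_conn (by fun_prop)
      (by fun_prop)).imp ((dfn_isUniversal (by fun_prop)).imp ((dfn_isExistential (by fun_prop)).imp
      (dfn_dependsOn (by fun_prop) (by fun_prop)))))) ?_) ?_
    all_goals
      intro w x y _ h
      push Not at h
    · exact inDom_of_vertices (h.2.1.1.mem_vertices h.1)
    · obtain ⟨_, h, _⟩ := h
      exact inDom_of_vertices h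
  · refine Dfn.ex (Dfn.ex ((dfn_dep (by fun_prop) (by fun_prop)).and (Dfn.rtgOn (dfn_dep
      (by fun_prop) (by fun_prop)) (fun _ _ _ _ h => inDom_of_vertices h.1.2) (by fun_prop)
      (by fun_prop))) ?_) ?_
    · rintro w x y _ ⟨h, -⟩
      exact inDom_of_vertices h.1.2
    · rintro w x y _ ⟨_, h, -⟩
      exact inDom_of_vertices h.1.1

end Definability

theorem inNL_truthBraidedUSK (h : ∀ φ : PrenexCNF, φ.BraidedUSK → (φ.IsTrue ↔ φ.GraphCondition)) :
    InNL truthBraidedUSK := by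
  -- An ill-formed word is decoded to the empty formula, for which the other conditions hold
  -- vacuously; hence well-formedness is required separately.
  refine Rec.inNL (Dfn.and (X := Unit) dfn_wf (dfn_braidedUSK.and dfn_graphCondition)) fun w => ?_
  constructor
  · rintro ⟨φ, h1, h2, rfl⟩
    refine ⟨(), fun _ => rfl, ⟨φ, h1.flatKrom, rfl⟩, ?_⟩
    rw [decode_encode h1.flatKrom]
    exact ⟨h1, (h φ h1).1 h2⟩
  · rintro ⟨_, -, hw, h1, h2⟩
    exact ⟨decode w, h1, (h _ h1).2 h2, encode_decode hw⟩

end SO2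

/-! ### Strategies for the quantifier prefix and elementary facts about the implication graph -/

namespace SO2

open Relation

/-! ### Semantics of the prefix -/

namespace PrenexCNF

variable {φ : PrenexCNF}

theorem quantAt_unique (hd : φ.DistinctQuants) {i j : ℕ} {q q' : Quant} {f : FVar}
    (h : φ.QuantAt i q f) (h' : φ.QuantAt j q' f) : i = j ∧ q = q' := by
  obtain rfl := distinctQuants_iff.1 hd f i j q q' h h'
  have := h.symm.trans h'
  simp only [Option.some.injEq, Prod.mk.injEq] at this
  exact ⟨rfl, this.1⟩

theorem not_universal_of_existential (hd : φ.DistinctQuants) {f : FVar} (h : φ.IsExistential f) :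
    ¬ φ.IsUniversal f := by
  rintro ⟨j, hj⟩
  obtain ⟨i, hi⟩ := h
  have := (quantAt_unique hd hi hj).2
  cases this

/-- A formula is true if there are Skolem functions; `G J` is the interpretation that arises when the
universal variables are chosen according to `J`. -/
theorem isTrue_of_skolem (hd : φ.DistinctQuants) (G : Interp → Interp)
    (hid : ∀ J f, ¬ φ.IsExistential f → G J f = J f)
    (hloc : ∀ i j f g, φ.QuantAt i .ex f → φ.QuantAt j .all g → i < j →
      ∀ J F, G (Function.update J g F) f = G J f)
    (hG : ∀ J, ClausesHold φ.clauses (G J)) : φ.IsTrue := by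
  -- Induction on the unread part of the prefix: outside of it the current interpretation agrees
  -- with `G J`. A universal choice is recorded in `J`, and by `hloc` this does not disturb earlier
  -- Skolem functions.
  have key : ∀ suf pre, pre ++ suf = φ.quants → ∀ I J : Interp,
      (∀ f ∉ suf.map Prod.snd, I f = G J f) → Sat φ.clauses suf I := by
    intro suf
    induction suf with
    | nil =>
      intro pre _ I J h
      rw [show I = G J from funext fun f => h f (by simp)]
      exact hG J
    | cons p suf ih =>
      obtain ⟨q, f⟩ := p
      intro pre hp I J h
      have hp' : (pre ++ [(q, f)]) ++ suf = φ.quants := by simpa using hp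
      have hf : φ.QuantAt pre.length q f := by simp [QuantAt, ← hp]
      cases q with
      | ex =>
        refine ⟨G J f, ih _ hp' _ J fun g hg => ?_⟩
        by_cases hgf : g = f
        · subst hgf
          simp
        · rw [Function.update_of_ne hgf]
          exact h g (by simp [hgf, hg])
      | all =>
        intro F
        refine ih _ hp' _ (Function.update J f F) fun g hg => ?_
        by_cases hgf : g = f
        · subst hgf
          rw [hid _ _ fun h => not_universal_of_existential hd h ⟨_, hf⟩]
          simp
        · rw [Function.update_of_ne hgf, h g (by simp [hgf, hg])]
          by_cases hge : φ.IsExistential g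
          · obtain ⟨i, hi⟩ := hge
            refine (hloc i _ g f hi hf ?_ J F).symm
            by_contra hlt
            rw [QuantAt, ← hp, List.getElem?_append_right (by omega)] at hi
            have := List.mem_map_of_mem (f := Prod.snd) (List.mem_of_getElem? hi)
            simp [hgf, hg] at this
          · rw [hid _ _ hge, hid _ _ hge, Function.update_of_ne hgf]
  exact fun I => key φ.quants [] rfl I I fun f hf => (hid I f fun ⟨i, hi⟩ =>
    hf (mem_quants_iff.2 ⟨i, _, hi⟩)).symm

/-- If a formula is true, then every strategy for the universal variables has a run in which the
clauses hold. -/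
theorem IsTrue.exists_run (h : φ.IsTrue) (hd : φ.DistinctQuants) (τ : Interp → Interp)
    (hloc : ∀ K K' i f, φ.QuantAt i .all f →
      (∀ j q g, φ.QuantAt j q g → j < i → K g = K' g) → τ K f = τ K' f) :
    ∃ K, ClausesHold φ.clauses K ∧ ∀ f, φ.IsUniversal f → K f = τ K f := by
  have key : ∀ suf pre, pre ++ suf = φ.quants → ∀ I, Sat φ.clauses suf I →
      ∃ K, ClausesHold φ.clauses K ∧ (∀ g ∉ suf.map Prod.snd, K g = I g) ∧
        ∀ f, (Quant.all, f) ∈ suf → K f = τ K f := by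
    intro suf
    induction suf with
    | nil => exact fun _ _ I hI => ⟨I, hI, fun _ _ => rfl, by simp⟩
    | cons p suf ih =>
      obtain ⟨q, f⟩ := p
      intro pre hp I hI
      have hp' : (pre ++ [(q, f)]) ++ suf = φ.quants := by simpa using hp
      have hnot : f ∉ suf.map Prod.snd := by
        have := hd
        rw [DistinctQuants, ← hp, List.map_append, List.map_cons] at this
        exact (List.nodup_cons.1 (List.nodup_append.1 this).2.1).1
      have step : ∀ F, Sat φ.clauses suf (Function.update I f F) → (q = .all → F = τ I f) →
          ∃ K, ClausesHold φ.clauses K ∧ (∀ g ∉ ((q, f) :: suf).map Prod.snd, K g = I g) ∧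
            ∀ g, (Quant.all, g) ∈ (q, f) :: suf → K g = τ K g := by
        intro F hF hq
        obtain ⟨K, h1, h2, h3⟩ := ih _ hp' _ hF
        refine ⟨K, h1, fun g hg => ?_, fun g hg => ?_⟩
        · simp only [List.map_cons, List.mem_cons, not_or] at hg
          rw [h2 g hg.2, Function.update_of_ne hg.1]
        · rcases List.mem_cons.1 hg with hg | hg
          · simp only [Prod.mk.injEq] at hg
            obtain ⟨rfl, rfl⟩ := hg
            rw [h2 g hnot, Function.update_self, hq rfl]
            -- The strategy has answered to the partial play `I`, while the claim is about the
            -- completed play `K`. Both agree on all variables quantified before `g`, so the answers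
            -- coincide.
            refine hloc I K pre.length g (by simp [QuantAt, ← hp]) fun j q' g' hg' hj => ?_
            have hne : g' ∉ ((Quant.all, g) :: suf).map Prod.snd := by
              intro hmem
              obtain ⟨⟨q'', g''⟩, h', rfl⟩ := List.mem_map.1 hmem
              obtain ⟨k, hk⟩ := List.mem_iff_getElem?.1 h'
              have : φ.QuantAt (pre.length + k) q'' g'' := by
                rw [QuantAt, ← hp, List.getElem?_append_right (by omega)]
                simpa using hk
              have := (quantAt_unique hd hg' this).1
              omega
            simp only [List.map_cons, List.mem_cons, not_or] at hne
            rw [h2 g' hne.2, Function.update_of_ne hne.1]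
          · exact h3 g hg
      cases q with
      | ex =>
        obtain ⟨F, hF⟩ := hI
        exact step F hF (by simp)
      | all => exact step _ (hI (τ I f)) fun _ => rfl
  obtain ⟨K, h1, -, h3⟩ := key φ.quants [] rfl (fun _ _ => false) (h _)
  exact ⟨K, h1, fun f ⟨i, hi⟩ => h3 f (List.mem_iff_getElem?.2 ⟨i, hi⟩)⟩

/-! ### Blocks -/

theorem block_mono {i j : ℕ} (h : i ≤ j) : φ.block i ≤ φ.block j := by
  refine monotone_nat_of_le_succ (fun n => ?_) h
  rcases φ.block_succ n with h | h <;> omega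

/-- Quantifiers alternate from block to block, so the parity of the block determines the quantifier.
-/
theorem quant_eq_iff_even {i j : ℕ} {q q' : Quant} {f g : FVar} (hi : φ.QuantAt i q f)
    (hj : φ.QuantAt j q' g) (hij : i ≤ j) : q = q' ↔ Even (φ.block i + φ.block j) := by
  induction hij generalizing q' g with
  | refl =>
    have := hi.symm.trans hj
    simp only [Option.some.injEq, Prod.mk.injEq] at this
    simp [this.1]
  | @step j hij ih =>
    obtain ⟨hlt, -⟩ := List.getElem?_eq_some_iff.1 hj
    obtain ⟨⟨q'', g'⟩, hg'⟩ : ∃ p, φ.quants[j]? = some p := ⟨_, List.getElem?_eq_getElem (by omega)⟩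
    have h1 := ih (q' := q'') (g := g') hg'
    have h2 : φ.Change j (j + 1) ↔ q'' ≠ q' := by
      rw [change_iff, hg', show φ.quants[j + 1]? = _ from hj]
      simp
    rcases φ.block_succ j with ⟨h3, h4⟩ | ⟨h3, h4⟩
    · rw [Nat.succ_eq_add_one, h4, ← add_assoc, Nat.even_add_one, ← h1]
      have := h2.1 h3
      cases q <;> cases q' <;> cases q'' <;> simp_all
    · rw [Nat.succ_eq_add_one, h4, ← h1]
      rw [h2, not_not] at h3
      rw [h3]

theorem block_lt {i j : ℕ} {q q' : Quant} {f g : FVar} (hi : φ.QuantAt i q f)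
    (hj : φ.QuantAt j q' g) (hij : i ≤ j) (hq : q ≠ q') : φ.block i < φ.block j := by
  refine lt_of_le_of_ne (block_mono hij) fun h => hq ((quant_eq_iff_even hi hj hij).2 ?_)
  rw [h]
  exact Even.add_self _

theorem quant_eq_of_block_eq {i j : ℕ} {q q' : Quant} {f g : FVar} (hi : φ.QuantAt i q f)
    (hj : φ.QuantAt j q' g) (h : φ.block i = φ.block j) : q = q' := by
  rcases le_total i j with hij | hij
  · exact (quant_eq_iff_even hi hj hij).2 (h ▸ Even.add_self _)
  · exact ((quant_eq_iff_even hj hi hij).2 (h ▸ Even.add_self _)).symm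

theorem block_add_two_le {i j : ℕ} {q : Quant} {f g : FVar} (hi : φ.QuantAt i q f)
    (hj : φ.QuantAt j q g) (hij : i ≤ j) (h : φ.block i ≠ φ.block j) :
    φ.block i + 2 ≤ φ.block j := by
  have h1 := block_mono (φ := φ) hij
  obtain ⟨k, hk⟩ := (quant_eq_iff_even hi hj hij).1 rfl
  omega

/-! ### The implication graph -/

@[simp] theorem _root_.SO2.Literal.neg_neg (l : Literal) : l.neg.neg = l := by simp [Literal.neg]

theorem _root_.SO2.Literal.neg_holds {l : Literal} {I : Interp} : l.neg.Holds I ↔ ¬ l.Holds I := by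
  simp only [Literal.Holds, Literal.neg]
  cases l.pos <;> cases l.atom.eval I <;> simp

theorem Edge.neg {l l' : Literal} (h : φ.Edge l l') : φ.Edge l'.neg l.neg := by
  rcases h with h | h | ⟨h, rfl⟩
  · exact .inr (.inl (by simpa using h))
  · exact .inl (by simpa using h)
  · exact .inr (.inr ⟨by simpa using h, by simp⟩)

theorem Path.neg {l l' : Literal} (h : φ.Path l l') : φ.Path l'.neg l.neg := by
  induction h with
  | refl => exact .refl
  | tail _ h ih => exact .head h.neg ih

theorem Conn.neg {l l' : Literal} (h : φ.Conn l l') : φ.Conn l.neg l'.neg := ⟨h.2.neg, h.1.neg⟩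

theorem Edge.holds {l l' : Literal} {I : Interp} (h : φ.Edge l l') (hI : ClausesHold φ.clauses I)
    (hl : l.Holds I) : l'.Holds I := by
  rcases h with h | h | ⟨h, rfl⟩
  · obtain ⟨k, hk, hk'⟩ := hI _ h
    simp only [List.mem_cons, List.not_mem_nil, or_false] at hk
    rcases hk with rfl | rfl
    · exact absurd hl (Literal.neg_holds.1 hk')
    · exact hk'
  · obtain ⟨k, hk, hk'⟩ := hI _ h
    simp only [List.mem_cons, List.not_mem_nil, or_false] at hk
    rcases hk with rfl | rfl
    · exact hk'
    · exact absurd hl (Literal.neg_holds.1 hk')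
  · obtain ⟨k, hk, hk'⟩ := hI _ h
    obtain rfl := List.mem_singleton.1 hk
    exact hk'

theorem Path.holds {l l' : Literal} {I : Interp} (h : φ.Path l l') (hI : ClausesHold φ.clauses I)
    (hl : l.Holds I) : l'.Holds I := by
  induction h with
  | refl => exact hl
  | tail _ h ih => exact h.holds hI ih

theorem Conn.holds_iff {l l' : Literal} {I : Interp} (h : φ.Conn l l')
    (hI : ClausesHold φ.clauses I) : l.Holds I ↔ l'.Holds I := ⟨h.1.holds hI, h.2.holds hI⟩

theorem clausesHold_of_edges (hφ : φ.FlatKrom) {I : Interp}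
    (h : ∀ l l', φ.Edge l l' → l.Holds I → l'.Holds I) : ClausesHold φ.clauses I := by
  intro C hC
  obtain ⟨⟨h1, h2⟩, -⟩ := hφ C hC
  rcases C with _ | ⟨l, _ | ⟨l', _ | ⟨l'', C⟩⟩⟩
  · exact absurd rfl h1
  · refine ⟨l, by simp, by_contra fun hl => hl ?_⟩
    exact h l.neg l (.inr (.inr ⟨hC, rfl⟩)) (Literal.neg_holds.2 hl)
  · by_cases hl : l.Holds I
    · exact ⟨l, by simp, hl⟩
    · exact ⟨l', by simp, h l.neg l' (.inl (by simpa using hC)) (Literal.neg_holds.2 hl)⟩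
  · simp at h2

end PrenexCNF

/-! ### Arguments of terms -/

namespace Term

def arg : (t : Term) → Fin t.head.arity → Term
  | app _ a => a

theorem args_eq (t : Term) : t.args = Set.range t.arg := by cases t; rfl

theorem arg_mem (t : Term) (i : Fin t.head.arity) : t.arg i ∈ t.args := by
  rw [args_eq]
  exact ⟨i, rfl⟩

theorem eval_eq (t : Term) (I : Interp) : t.eval I = I t.head fun i => (t.arg i).eval I := by
  cases t
  rfl

theorem apply_eq_of_arity_zero {f : FVar} (hf : f.arity = 0) (I : Interp)
    (x y : Fin f.arity → Bool) : I f x = I f y := by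
  congr 1
  funext i
  exact (Fin.cast hf i).elim0

theorem eval_of_arity_zero {t : Term} (ht : t.head.arity = 0) (I : Interp) (x) :
    t.eval I = I t.head x := by
  rw [eval_eq]
  exact apply_eq_of_arity_zero ht I _ _

open Classical in
/-- The value of `v`, computed from the values `x` of the arguments of `t`; whatever is not an argument
of `t` is interpreted by `I`. -/
noncomputable def transfer (t v : Term) (I : Interp) (x : Fin t.head.arity → Bool) : Bool :=
  if h : ∃ j, t.arg j = v then x h.choose
  else I v.head fun i => if h : ∃ j, t.arg j = v.arg i then x h.choose
    else I (v.arg i).head fun _ => false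

theorem transfer_eq {t v : Term} {I : Interp} {x : Fin t.head.arity → Bool} (W : Term → Bool)
    (hx : ∀ j, x j = W (t.arg j)) (hv : v ∉ t.args → I v.head (fun i => W (v.arg i)) = W v)
    (ha : ∀ i, v.arg i ∉ t.args → I (v.arg i).head (fun _ => false) = W (v.arg i)) :
    t.transfer v I x = W v := by
  unfold transfer
  split_ifs with h
  · rw [hx, h.choose_spec]
  · rw [← hv (by rw [args_eq]; exact h)]
    congr 1
    funext i
    split_ifs with h'
    · rw [hx, h'.choose_spec]
    · exact ha i (by rw [args_eq]; exact h')

/-- This gives the locality of strategies and Skolem functions: the transfer consults the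
interpretation only for `v` and those of its arguments that `t` does not see itself, and not at all
if `v` is an argument of `t`. -/
theorem transfer_congr {t v : Term} {I I' : Interp} (hv : v ∉ t.args → I v.head = I' v.head)
    (ha : v ∉ t.args → ∀ i, v.arg i ∉ t.args → I (v.arg i).head = I' (v.arg i).head) :
    t.transfer v I = t.transfer v I' := by
  funext x
  unfold transfer
  split_ifs with h
  · rfl
  · have h' : v ∉ t.args := by rw [args_eq]; exact h
    rw [hv h']
    congr 1
    funext i
    split_ifs with h''
    · rfl
    · rw [ha h' i (by rw [args_eq]; exact h'')]

end Term

end SO2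

/-! ### Strategies that refute formulae violating the criterion -/

namespace SO2

open Relation

namespace PrenexCNF

variable {φ : PrenexCNF}

/-! ### Necessity of the conditions -/

namespace BraidedUSK

theorem mem_terms_of_mem_args (h : φ.BraidedUSK) {t a : Term} (ht : t ∈ φ.terms) (ha : a ∈ t.args) :
    a ∈ φ.terms := by
  rw [mem_terms_iff h.flatKrom] at ht ⊢
  obtain ⟨l, hl, rfl | h'⟩ := ht
  · exact ⟨l, hl, .inr ha⟩
  · obtain ⟨C, hC, hlC⟩ : ∃ C ∈ φ.clauses, l ∈ C := by
      rcases hl with hl | ⟨l', hl | hl⟩ <;> exact ⟨_, hl, by simp⟩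
    have := (h.flatKrom C hC).2 l hlC t h'
    rw [Term.args_eq] at ha
    obtain ⟨i, -⟩ := ha
    exact (Fin.cast this i).elim0

theorem exists_quantAt (h : φ.BraidedUSK) {t : Term} (ht : t ∈ φ.terms) :
    ∃ i q, φ.QuantAt i q t.head := mem_quants_iff.1 (h.closed t ht)

theorem arity_arg (h : φ.BraidedUSK) {t : Term} (ht : t ∈ φ.terms) (i : Fin t.head.arity) :
    (t.arg i).head.arity = 0 := h.simple t ht _ (t.arg_mem i)

theorem universal_or_existential (h : φ.BraidedUSK) {t : Term} (ht : t ∈ φ.terms) :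
    φ.IsUniversal t.head ∨ φ.IsExistential t.head := by
  obtain ⟨i, _ | _, hi⟩ := h.exists_quantAt ht
  · exact .inr ⟨i, hi⟩
  · exact .inl ⟨i, hi⟩

/-- Constant functions make `u` true and `u'` false, against the path. If both have the same head,
uniqueness leaves only `u'` equal to the negation of `u`, which fails as soon as `u` holds. -/
theorem not_path_of_isTrue (h : φ.BraidedUSK) (hT : φ.IsTrue) {u u' : Literal}
    (hu : u ∈ φ.vertices) (hu' : u' ∈ φ.vertices) (huu : φ.IsUniversal u.atom.head)
    (huu' : φ.IsUniversal u'.atom.head) (hne : u ≠ u') : ¬ φ.Path u u' := by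
  intro hp
  obtain ⟨K, hK, hc⟩ := hT.exists_run h.distinct
    (fun _ f _ => if f = u.atom.head then u.pos else !u'.pos) fun _ _ _ _ _ _ => rfl
  have h1 : u.Holds K := by
    rw [Literal.Holds, Term.eval_eq, hc _ huu, if_pos rfl]
  have h2 := hp.holds hK h1
  rw [Literal.Holds, Term.eval_eq, hc _ huu'] at h2
  split_ifs at h2 with h3
  · have := h.unique _ hu' _ hu h3
    exact hne (congrArg₂ Literal.mk h2 this.symm)
  · cases hp : u'.pos <;> simp_all

theorem not_conn_neg_of_isTrue (h : φ.BraidedUSK) (hT : φ.IsTrue) (v : Literal) :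
    ¬ φ.Conn v v.neg := by
  intro hc
  obtain ⟨K, hK, -⟩ := hT.exists_run h.distinct (fun _ _ _ => false) fun _ _ _ _ _ _ => rfl
  have := hc.holds_iff hK
  rw [Literal.neg_holds] at this
  tauto

/-- There is a run in which the universal `x` is chosen depending on the value of an existential `v`
before `x`. -/
theorem exists_run_diagonal (h : φ.BraidedUSK) (hT : φ.IsTrue) {v x : Term} (hv : v ∈ φ.terms)
    (hve : φ.IsExistential v.head) (hx : x ∈ φ.terms) (hxu : φ.IsUniversal x.head)
    (hvx : φ.Before v.head x.head) (hnot : x ∉ v.args) (b : Bool) (c : Interp)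
    (hc : ∀ a ∈ v.args, φ.IsUniversal a.head → ∀ y, c a.head y = false) :
    ∃ K, ClausesHold φ.clauses K ∧ (∀ f, φ.IsUniversal f → f ≠ x.head → K f = c f) ∧
      ∀ y, K x.head y = (v.eval K == b) := by
  classical
  -- The choice of `x` may use `v`, but not the universal arguments of `v`, which may be quantified
  -- later. They are replaced by the value that `c` is going to give them; this is the role of `hc`,
  -- while `hnot` ensures that `x` is none of them.
  let K₀ : Interp → Interp := fun K g => if φ.IsUniversal g then fun _ => false else K g
  obtain ⟨i, hi⟩ := hve
  obtain ⟨j, hj⟩ := hxu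
  have hij : i < j := by
    obtain ⟨i', j', q, q', hi', hj', hlt⟩ := hvx
    have h1 := (quantAt_unique h.distinct hi hi').1
    have h2 := (quantAt_unique h.distinct hj hj').1
    omega
  have hvu : ¬ φ.IsUniversal v.head := not_universal_of_existential h.distinct ⟨i, hi⟩
  obtain ⟨K, hK, hτ⟩ := hT.exists_run h.distinct
    (fun K f => if f = x.head then fun _ => v.eval (K₀ K) == b else c f) (by
      intro K K' i' f hf hagree
      split_ifs with hfx
      swap
      · rfl
      subst hfx
      obtain rfl := (quantAt_unique h.distinct hj hf).1
      have : v.eval (K₀ K) = v.eval (K₀ K') := by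
        rw [Term.eval_eq, Term.eval_eq]
        simp only [K₀, if_neg hvu]
        rw [hagree i _ _ hi hij]
        congr 1
        funext k
        rw [Term.eval_of_arity_zero (h.arity_arg hv k) _ fun _ => false,
          Term.eval_of_arity_zero (h.arity_arg hv k) _ fun _ => false]
        split_ifs with hu
        · rfl
        · obtain ⟨m, hm⟩ := (h.universal_or_existential
            (h.mem_terms_of_mem_args hv (v.arg_mem k))).resolve_left hu
          have h1 := h.braided v hv _ (v.arg_mem k) i m _ _ hi hm
          rw [hagree m _ _ hm ?_]
          -- By braidedness an existential argument of `v` lies in the block of `v` or the next one,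
          -- which is universal. So it lies in the block of `v`, and hence before `x`.
          by_contra hlt
          have h2 := block_lt hi hj hij.le (by decide)
          have h3 := block_mono (φ := φ) (not_lt.1 hlt)
          have h4 := block_add_two_le hi hm h1.1.le (by omega)
          have h5 : φ.block m ≤ φ.block i + 1 := h1.2
          omega
      rw [this])
  refine ⟨K, hK, fun f hf hfx => by rw [hτ f hf, if_neg hfx], fun y => ?_⟩
  rw [hτ _ ⟨j, hj⟩, if_pos rfl]
  have : v.eval (K₀ K) = v.eval K := by
    rw [Term.eval_eq, Term.eval_eq]
    simp only [K₀, if_neg hvu]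
    congr 1
    funext k
    rw [Term.eval_of_arity_zero (h.arity_arg hv k) _ fun _ => false,
      Term.eval_of_arity_zero (h.arity_arg hv k) _ fun _ => false]
    split_ifs with hu
    · have hmem := h.mem_terms_of_mem_args hv (v.arg_mem k)
      rw [hτ _ hu, if_neg, hc _ (v.arg_mem k) hu]
      intro heq
      exact hnot (h.unique _ hmem _ hx heq ▸ v.arg_mem k)
    · rfl
  rw [this]

/-- Being in one component, `u` and `v` always have the same truth value, which a universal choice
against `v` destroys. If `v` comes first, `u` is chosen so. If `u` comes first, the failing
dependency provides an argument of `u` that `v` does not know, and this argument takes over the role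
of `u`. -/
theorem dependsOn_of_isTrue (h : φ.BraidedUSK) (hT : φ.IsTrue) {u v : Literal}
    (hu : u ∈ φ.vertices) (hc : φ.Conn u v) (huu : φ.IsUniversal u.atom.head)
    (hve : φ.IsExistential v.atom.head) : φ.DependsOn v u := by
  by_contra hdep
  have hv : v ∈ φ.vertices := hc.1.mem_vertices hu
  obtain ⟨hdep1, hdep2⟩ := not_or.1 hdep
  have key : ∀ K, ClausesHold φ.clauses K →
      u.atom.eval K ≠ (v.atom.eval K == !(u.pos == v.pos)) := by
    intro K hK heq
    have := hc.holds_iff hK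
    simp only [Literal.Holds] at this
    cases hup : u.pos <;> cases hvp : v.pos <;> cases hve : v.atom.eval K <;> simp_all
  obtain ⟨j, hj⟩ := huu
  obtain ⟨i, hi⟩ := hve
  have hij : i ≠ j := by
    rintro rfl
    cases hi.symm.trans hj
  rcases lt_or_gt_of_ne hij with hij | hij
  · obtain ⟨K, hK, -, hx⟩ := h.exists_run_diagonal hT hv ⟨i, hi⟩ hu ⟨j, hj⟩
      ⟨i, j, _, _, hi, hj, hij⟩ hdep1 (!(u.pos == v.pos)) (fun _ _ => false) (by simp)
    exact key K hK (by rw [Term.eval_eq u.atom, hx])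
  · have hb : φ.Before u.atom.head v.atom.head := ⟨j, i, _, _, hj, hi, hij⟩
    have hdep3 := not_and.1 hdep2 hb
    push Not at hdep3
    obtain ⟨a, ha, hav, ha1, ha2⟩ := hdep3
    have hat := h.mem_terms_of_mem_args hu ha
    have hbl := block_lt hj hi hij.le (by decide)
    rcases h.universal_or_existential hat with ⟨k, hk⟩ | ⟨k, hk⟩
    · have hik : i < k := by
        have h1 : i ≠ k := by
          rintro rfl
          cases hi.symm.trans hk
        by_contra h2
        exact ha1 ⟨k, hk⟩ ⟨k, i, _, _, hk, hi, by omega⟩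
      obtain ⟨m, rfl⟩ : ∃ m, u.atom.arg m = a := by
        rw [Term.args_eq] at ha
        exact ha
      obtain ⟨K, hK, hu', hx⟩ := h.exists_run_diagonal hT hv ⟨i, hi⟩ hat ⟨k, hk⟩
        ⟨i, k, _, _, hi, hk, hik⟩ hav (!(u.pos == v.pos))
        -- The function of `u` is the projection onto the argument in question, which makes `u`
        -- equal to that argument.
        (Function.update (fun _ _ => false) u.atom.head fun y => y m) (by
          intro a' ha' hau' y
          rw [Function.update_of_ne]
          intro heq
          have := h.unique _ (h.mem_terms_of_mem_args hv ha') _ hu heq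
          exact hdep1 (this ▸ ha'))
      refine key K hK ?_
      have hne : u.atom.head ≠ (u.atom.arg m).head := by
        intro heq
        rw [← heq] at hk
        have := (quantAt_unique h.distinct hj hk).1
        omega
      rw [Term.eval_eq u.atom, hu' _ ⟨j, hj⟩ hne, Function.update_self]
      dsimp only
      rw [Term.eval_eq (u.atom.arg m), hx]
    -- Here braidedness is decisive. The existential argument lies in an existential block after
    -- that of `v`, hence at least three blocks after `u`, but only two are allowed.
    · obtain ⟨h1, h2⟩ := ha2 ⟨k, hk⟩
      have hik : i ≤ k := not_lt.1 fun h' => h1 ⟨k, i, _, _, hk, hi, h'⟩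
      have hne : φ.block i ≠ φ.block k := fun h' => h2 ⟨k, i, _, _, hk, hi, h'.symm⟩
      have h3 := block_add_two_le hi hk hik hne
      have h4 : φ.block k ≤ φ.block j + 2 := (h.braided _ hu a ha j k _ _ hj hk).2
      omega

/-- There is a run in which every universal `t` from `R` is chosen to agree, or to disagree, with the
value of a given vertex on which it depends. -/
theorem exists_run_follow (h : φ.BraidedUSK) (hT : φ.IsTrue) (R : Term → Prop)
    (hR : ∀ t, R t → t ∈ φ.terms ∧ φ.IsUniversal t.head) (v : Term → Literal)
    (hv : ∀ t, R t → v t ∈ φ.vertices) (hdep : ∀ t, R t → φ.DependsOn ⟨true, t⟩ (v t))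
    (b : Term → Bool) :
    ∃ K, ClausesHold φ.clauses K ∧ ∀ t, R t → t.eval K = ((v t).atom.eval K == b t) := by
  classical
  -- A strategy answers for a variable, so the term headed by `f` is recovered by choice; uniqueness
  -- makes this the intended term.
  obtain ⟨K, hK, hτ⟩ := hT.exists_run h.distinct (fun K f x =>
    if h : ∃ a, R (.app f a) then
      (Term.app f h.choose).transfer (v (.app f h.choose)).atom K x == b (.app f h.choose)
    else false) (by
      intro K K' i f hf hagree
      funext x
      split_ifs with ha
      swap
      · rfl
      have hb : ∀ g, φ.Before g f → K g = K' g := by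
        rintro g ⟨j, k, q, q', hj, hk, hlt⟩
        obtain rfl := (quantAt_unique h.distinct hf hk).1
        exact hagree j q g hj hlt
      have hd := hdep _ ha.choose_spec
      rw [Term.transfer_congr (I' := K')]
      · intro hnot
        exact hb _ (hd.resolve_left hnot).1
      · intro hnot k hk
        rcases ((hd.resolve_left hnot).2 _ ((v _).atom.arg_mem k)).resolve_left hk with
          ⟨-, h'⟩ | ⟨⟨m, hm⟩, h' | ⟨m', i', q, q', hm', hi', heq⟩⟩
        · exact hb _ h'
        · exact hb _ h'
        · obtain ⟨rfl, rfl⟩ := quantAt_unique h.distinct hm hm'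
          obtain ⟨rfl, rfl⟩ := quantAt_unique h.distinct hf hi'
          -- Dependency also admits existential arguments in the same block, but a block of a
          -- universal variable contains none.
          cases quant_eq_of_block_eq hm hf heq)
  refine ⟨K, hK, ?_⟩
  rintro ⟨f, a⟩ ht
  obtain ⟨hmem, hu⟩ := hR _ ht
  have hex : ∃ a, R (.app f a) := ⟨a, ht⟩
  have heq : Term.app f hex.choose = Term.app f a :=
    h.unique _ (hR _ hex.choose_spec).1 _ hmem rfl
  have hx : (Term.app f a).eval K = K f fun i => ((Term.app f hex.choose).arg i).eval K := by
    conv_rhs => rw [show hex.choose = a from by simpa using heq]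
    rfl
  have htr := Term.transfer_eq (t := .app f hex.choose) (v := (v (.app f hex.choose)).atom) (I := K)
    (fun t => t.eval K) (fun _ => rfl) (fun _ => (Term.eval_eq _ _).symm) fun i _ =>
      (Term.eval_of_arity_zero (h.arity_arg (hv _ hex.choose_spec) i) _ _).symm
  refine hx.trans ((congrFun (hτ f hu) _).trans ((dif_pos hex).trans ?_))
  exact (congrArg (· == b (.app f hex.choose)) htr).trans (by rw [heq])

end BraidedUSK

end PrenexCNF

/-- One can get from `a` to `b` in exactly `n` steps. -/
def StepsTo {A : Type} (r : A → A → Prop) (b : A) : ℕ → A → Prop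
  | 0, a => a = b
  | n + 1, a => ∃ c, r a c ∧ StepsTo r b n c

/-- From every point from which `b` is accessible one can choose a next step towards `b`. -/
theorem exists_descent {A : Type} (r : A → A → Prop) (b : A) : ∃ d : A → ℕ, ∀ a,
    ReflTransGen r a b → a ≠ b → ∃ c, r a c ∧ ReflTransGen r c b ∧ d c < d a := by
  have hex : ∀ a, ReflTransGen r a b → ∃ n, StepsTo r b n a := by
    intro a h
    induction h using ReflTransGen.head_induction_on with
    | refl => exact ⟨0, rfl⟩
    | head h _ ih =>
      obtain ⟨n, hn⟩ := ih
      exact ⟨n + 1, _, h, hn⟩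
  have hrt : ∀ n a, StepsTo r b n a → ReflTransGen r a b := by
    intro n
    induction n with
    | zero =>
      rintro a rfl
      exact .refl
    | succ n ih =>
      rintro a ⟨c, h, h'⟩
      exact .head h (ih c h')
  refine ⟨fun a => sInf {n | StepsTo r b n a}, fun a ha hne => ?_⟩
  have h1 : StepsTo r b (sInf {n | StepsTo r b n a}) a := Nat.sInf_mem (s := {n | StepsTo r b n a}) (hex a ha)
  rcases hn : sInf {n | StepsTo r b n a} with _ | n
  · rw [hn] at h1
    exact absurd h1 hne
  · rw [hn] at h1
    obtain ⟨c, hc, hc'⟩ := h1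
    refine ⟨c, hc, hrt n c hc', ?_⟩
    dsimp only
    rw [hn]
    exact Nat.lt_succ_of_le (Nat.sInf_le hc')

namespace PrenexCNF.BraidedUSK

variable {φ : PrenexCNF}

/-- A liar paradox: all universal terms leading to `t₀` copy the value of the next one, except `t₀`,
which negates it. Then all of them have the value of `t₀`, and `t₀` differs from itself. -/
theorem no_cycle_of_isTrue (h : φ.BraidedUSK) (hT : φ.IsTrue) :
    ¬ ∃ l l', φ.Dep l l' ∧ ReflTransGen φ.Dep l' l := by
  rintro ⟨l, l', ⟨⟨hl, hl'⟩, u, v, hu, hv, huu, huv⟩, hcyc⟩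
  -- The cycle of components becomes a cycle of universal terms: `t` depends on some vertex in whose
  -- component `t'` occurs, possibly negated.
  let N : Term → Term → Prop := fun t t' => (t ∈ φ.terms ∧ φ.IsUniversal t.head) ∧
    ∃ v s, v ∈ φ.vertices ∧ φ.DependsOn ⟨true, t⟩ v ∧ φ.Conn v ⟨s, t'⟩
  have key : ∀ m, ReflTransGen φ.Dep m l → ∀ v, φ.Conn m v →
      ∃ t' s, φ.Conn v ⟨s, t'⟩ ∧ ReflTransGen N t' u.atom := by
    intro m hm
    induction hm using ReflTransGen.head_induction_on with
    | refl => exact fun v hv => ⟨u.atom, u.pos, hv.symm.trans hu, .refl⟩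
    | head hd _ ih =>
      obtain ⟨⟨hm, hm'⟩, u', v', h1, h2, h3, h4⟩ := hd
      intro v hv
      obtain ⟨t', s, h5, h6⟩ := ih v' h2
      exact ⟨u'.atom, u'.pos, hv.symm.trans h1,
        .head ⟨⟨h1.1.mem_vertices hm, h3⟩, v', s, h2.1.mem_vertices hm', h4, h5⟩ h6⟩
  obtain ⟨t₁, s₁, h1, h2⟩ := key l' hcyc v hv
  have h0 : N u.atom t₁ := ⟨⟨hu.1.mem_vertices hl, huu⟩, v, s₁, hv.1.mem_vertices hl', huv, h1⟩
  generalize u.atom = t₀ at *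
  -- The given cycle may visit a term repeatedly, whereas a strategy can follow only one successor.
  -- Successors are therefore chosen with decreasing distance to `t₀`.
  obtain ⟨d, hd⟩ := exists_descent N t₀
  have hnext : ∀ t, ReflTransGen N t t₀ → ∃ t', N t t' ∧ ReflTransGen N t' t₀ ∧
      (t ≠ t₀ → d t' < d t) := by
    intro t ht
    by_cases hne : t = t₀
    · exact ⟨t₁, hne ▸ h0, h2, fun h => absurd hne h⟩
    · obtain ⟨t', h3, h4, h5⟩ := hd t ht hne
      exact ⟨t', h3, h4, fun _ => h5⟩
  classical
  choose! nxt hN hrt hdec using hnext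
  have hN2 := fun t ht => (hN t ht).2
  have : Nonempty Literal := ⟨v⟩
  choose! w s hw hdep hconn using hN2
  -- The first comparison corrects the signs between the followed vertex and the next term of the
  -- cycle; the second one inserts the negation at `t₀`.
  obtain ⟨K, hK, hev⟩ := h.exists_run_follow hT (fun t => ReflTransGen N t t₀)
    (fun t ht => (hN t ht).1) w hw hdep fun t => (((w t).pos == s t) == decide (t ≠ t₀))
  have hstep : ∀ t, ReflTransGen N t t₀ → t.eval K = ((nxt t).eval K == decide (t ≠ t₀)) := by
    intro t ht
    rw [hev t ht]
    have := (hconn t ht).holds_iff hK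
    simp only [Literal.Holds] at this
    cases hp : (w t).pos <;> cases hs : s t <;> cases he : (w t).atom.eval K <;>
      cases he' : (nxt t).eval K <;> simp_all
  have hall : ∀ n t, d t = n → ReflTransGen N t t₀ → t.eval K = t₀.eval K := by
    intro n
    induction n using Nat.strong_induction_on with
    | _ n ih =>
      intro t hn ht
      by_cases hne : t = t₀
      · rw [hne]
      · rw [hstep t ht, ih _ (hn ▸ hdec t ht hne) _ rfl (hrt t ht)]
        simp [hne]
  have := hstep t₀ .refl
  rw [hall _ _ rfl (hrt t₀ .refl)] at this
  simp at this

theorem graphCondition_of_isTrue (h : φ.BraidedUSK) (hT : φ.IsTrue) : φ.GraphCondition :=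
  graphCondition_iff.2 ⟨fun _ _ hu hu' huu huu' hne => h.not_path_of_isTrue hT hu hu' huu huu' hne,
    fun v _ => h.not_conn_neg_of_isTrue hT v,
    fun _ _ hu hc huu hve => h.dependsOn_of_isTrue hT hu hc huu hve, h.no_cycle_of_isTrue hT⟩

end PrenexCNF.BraidedUSK

end SO2

/-! ### Skolem functions for formulae satisfying the criterion -/

namespace SO2

open Relation

namespace PrenexCNF

variable {φ : PrenexCNF}

/-! ### Sufficiency of the conditions -/

/-- The literal `l` lies in the component of the universal vertex `u`. -/
def Bound (φ : PrenexCNF) (l u : Literal) : Prop :=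
  (u ∈ φ.vertices ∧ φ.IsUniversal u.atom.head) ∧ φ.Conn l u

/-- The vertex lies in a component without universal vertices. -/
def Unbound (φ : PrenexCNF) (l : Literal) : Prop := l ∈ φ.vertices ∧ ∀ u, ¬ φ.Bound l u

theorem Bound.neg {l u : Literal} (h : φ.Bound l u) : φ.Bound l.neg u.neg := ⟨h.1, h.2.neg⟩

theorem Bound.mem {l u : Literal} (h : φ.Bound l u) : l ∈ φ.vertices := h.2.2.mem_vertices h.1.1

theorem Unbound.neg {l : Literal} (h : φ.Unbound l) : φ.Unbound l.neg :=
  ⟨h.1, fun u hu => h.2 u.neg (by simpa using hu.neg)⟩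

theorem bound_self {u : Literal} (hu : u ∈ φ.vertices) (huu : φ.IsUniversal u.atom.head) :
    φ.Bound u u := ⟨⟨hu, huu⟩, Conn.refl u⟩

theorem Bound.unique (hg : φ.GraphCondition) {l u u' : Literal} (h : φ.Bound l u)
    (h' : φ.Bound l u') : u = u' := by
  by_contra hne
  exact hg.noUniversalPath u h.1.1 u' h'.1.1 h.1.2 h'.1.2 hne (h.2.symm.trans h'.2).1

/-- A partial assignment to the unbound vertices that is closed under implication. -/
structure PartialAssignment (φ : PrenexCNF) (S : Set Literal) : Prop where
  unbound : ∀ l ∈ S, φ.Unbound l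
  closed : ∀ l ∈ S, ∀ l', φ.Path l l' → φ.Unbound l' → l' ∈ S
  consistent : ∀ l ∈ S, l.neg ∉ S

/-- What universal vertices imply has to be true whatever they are. If `u` implied `l` and `u'`
implied its negation, then `u` would imply the negation of `u'`. By the first condition these two
coincide, but then `l` lies in the component of `u` and is not unbound. -/
theorem partialAssignment_forced (hg : φ.GraphCondition) :
    φ.PartialAssignment {l | φ.Unbound l ∧ ∃ u, φ.Bound u u ∧ φ.Path u l} where
  unbound _ h := h.1
  closed := fun _ ⟨_, u, hu, hp⟩ _ hp' h' => ⟨h', u, hu, hp.trans hp'⟩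
  consistent := by
    rintro l ⟨hl, u, hu, hp⟩ ⟨-, u', hu', hp'⟩
    have h1 : φ.Path l u'.neg := by simpa using hp'.neg
    by_cases hne : u = u'.neg
    · exact hl.2 u ⟨hu.1, hne ▸ h1, hp⟩
    · exact hg.noUniversalPath u hu.1.1 u'.neg hu'.1.1 hu.1.2 hu'.1.2 hne (hp.trans h1)

/-- The 2-SAT argument: a maximal closed and consistent set extending the forced literals decides
every unbound vertex. -/
theorem exists_assignment (hg : φ.GraphCondition) : ∃ T, φ.PartialAssignment T ∧
    (∀ l, φ.Unbound l → l ∈ T ∨ l.neg ∈ T) ∧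
    ∀ l u, φ.Bound u u → φ.Path u l → φ.Unbound l → l ∈ T := by
  obtain ⟨T, hT0, hmax⟩ := zorn_subset_nonempty {S | φ.PartialAssignment S} (by
    intro c hc hchain _
    refine ⟨⋃₀ c, ⟨?_, ?_, ?_⟩, fun s hs => Set.subset_sUnion_of_mem hs⟩
    · rintro l ⟨S, hS, hl⟩
      exact (hc hS).unbound l hl
    · rintro l ⟨S, hS, hl⟩ l' hp h'
      exact ⟨S, hS, (hc hS).closed l hl l' hp h'⟩
    · rintro l ⟨S, hS, hl⟩ ⟨S', hS', hl'⟩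
      rcases hchain.total hS hS' with h | h
      · exact (hc hS').consistent l (h hl) hl'
      · exact (hc hS).consistent l hl (h hl')) _ (partialAssignment_forced hg)
  have hT : φ.PartialAssignment T := hmax.prop
  have hforced : ∀ l u, φ.Bound u u → φ.Path u l → φ.Unbound l → l ∈ T :=
    fun l u hu hp hl => hT0 ⟨hl, u, hu, hp⟩
  have hadd : ∀ l, φ.Unbound l → ¬ φ.Path l l.neg → l.neg ∈ T ∨ l ∈ T := by
    intro l hl hp
    by_cases hn : l.neg ∈ T
    · exact .inl hn
    right
    have hS : φ.PartialAssignment (T ∪ {l' | φ.Unbound l' ∧ φ.Path l l'}) := by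
      -- If the negation of a consequence of `l` were in `T`, contraposition and closure would put
      -- the negation of `l` there as well.
      have hcross : ∀ a, φ.Path l a → a.neg ∉ T := by
        intro a ha ha'
        exact hn (hT.closed _ ha' _ ha.neg hl.neg)
      refine ⟨?_, ?_, ?_⟩
      · rintro a (ha | ha)
        · exact hT.unbound a ha
        · exact ha.1
      · rintro a (ha | ha) b hb hb'
        · exact .inl (hT.closed a ha b hb hb')
        · exact .inr ⟨hb', ha.2.trans hb⟩
      · rintro a (ha | ha) (hb | hb)
        · exact hT.consistent a ha hb
        · exact hcross _ hb.2 (by simpa using ha)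
        · exact hcross a ha.2 hb
        · have := hb.2.neg
          rw [Literal.neg_neg] at this
          exact hp (ha.2.trans this)
    exact hmax.le_of_ge hS Set.subset_union_left (.inr ⟨hl, .refl⟩)
  refine ⟨T, hT, fun l hl => ?_, hforced⟩
  -- A literal can be added unless it implies its own negation. By the second condition this cannot
  -- happen for both `l` and its negation.
  by_cases hp : φ.Path l l.neg
  · have hp' : ¬ φ.Path l.neg l := fun h =>
      hg.noContradiction _ ⟨l, hl.1, rfl⟩ l (Conn.refl l) ⟨hp, h⟩
    have := hadd l.neg hl.neg (by simpa using hp')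
    simpa using this
  · exact (hadd l hl hp).symm

theorem finite_terms (h : φ.FlatKrom) : φ.terms.Finite := by
  have h1 : φ.terms ⊆ ⋃ C ∈ {C | C ∈ φ.clauses}, ⋃ l ∈ {l | l ∈ C},
      ({l.atom} ∪ Set.range l.atom.arg) := by
    rintro t ⟨C, hC, l, hl, ht⟩
    simp only [Set.mem_iUnion]
    refine ⟨C, hC, l, hl, ?_⟩
    rw [mem_subterms_iff ((h C hC).2 l hl), Term.args_eq] at ht
    exact ht
  exact (Set.Finite.biUnion (List.finite_toSet _) fun C _ => Set.Finite.biUnion (List.finite_toSet _)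
    fun l _ => (Set.finite_singleton _).union (Set.finite_range _)).subset h1

/-- The formula has only finitely many terms, so acyclicity already gives well-foundedness. -/
theorem wellFounded_dep (h : φ.BraidedUSK) (hg : φ.GraphCondition) :
    WellFounded fun a t : Term => φ.Dep ⟨true, t⟩ ⟨true, a⟩ := by
  let r : Term → Term → Prop := TransGen fun a t => φ.Dep ⟨true, t⟩ ⟨true, a⟩
  have hirr : ∀ t, ¬ r t t := by
    intro t ht
    have h4 := (graphCondition_iff.1 hg).2.2.2
    have hl : ∀ {a b}, r a b → TransGen φ.Dep ⟨true, b⟩ ⟨true, a⟩ := by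
      intro a b hab
      induction hab with
      | single h => exact .single h
      | tail _ h ih => exact .head h ih
    obtain ⟨m, h1, h2⟩ := TransGen.head'_iff.1 (hl ht)
    exact h4 ⟨_, m, h1, h2⟩
  have : IsStrictOrder Term r := { irrefl := hirr, trans := fun _ _ _ => TransGen.trans }
  have hwf := Set.wellFoundedOn_iff.1 ((finite_terms h.flatKrom).wellFoundedOn (r := r))
  exact Subrelation.wf (fun {a t} hd => ⟨TransGen.single hd, hd.1.2, hd.1.1⟩) hwf

theorem Bound.dep_arg (h : φ.BraidedUSK) {l u : Literal} (hb : φ.Bound l u)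
    (i : Fin u.atom.head.arity) : φ.Dep l ⟨true, u.atom.arg i⟩ :=
  ⟨⟨hb.mem, h.mem_terms_of_mem_args hb.1.1 (u.atom.arg_mem i)⟩, u, _, hb.2, Conn.refl _, hb.1.2,
    .inl (u.atom.arg_mem i)⟩

/-- The values of the terms in the intended model, depending on the choice `J` of the universal
variables. -/
structure IsValuation (φ : PrenexCNF) (T : Set Literal) (W : Interp → Term → Bool) : Prop where
  bound : ∀ J t u, φ.Bound ⟨true, t⟩ u →
    W J t = (J u.atom.head (fun i => W J (u.atom.arg i)) == u.pos)
  unbound : ∀ J t, φ.Unbound ⟨true, t⟩ → (W J t = true ↔ ⟨true, t⟩ ∈ T)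

/-- Recursion along the dependency of components. The value of a bound term is that of the universal
vertex of its component, a function value at arguments whose components come earlier. -/
theorem exists_valuation (h : φ.BraidedUSK) (hg : φ.GraphCondition) (T : Set Literal) :
    ∃ W, φ.IsValuation T W := by
  classical
  let W : Interp → Term → Bool := fun J => (wellFounded_dep h hg).fix fun t rec =>
    if hu : ∃ u, φ.Bound ⟨true, t⟩ u then
      J hu.choose.atom.head (fun i => rec _ (hu.choose_spec.dep_arg h i)) == hu.choose.pos
    else decide (⟨true, t⟩ ∈ T)
  refine ⟨W, fun J t u hu => ?_, fun J t ht => ?_⟩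
  · have hex : ∃ u, φ.Bound ⟨true, t⟩ u := ⟨u, hu⟩
    have h1 : W J t = (J hex.choose.atom.head (fun i => W J (hex.choose.atom.arg i)) ==
        hex.choose.pos) := by
      change (wellFounded_dep h hg).fix _ t = _
      rw [WellFounded.fix_eq, dif_pos hex]
    rwa [hex.choose_spec.unique hg hu] at h1
  · change (wellFounded_dep h hg).fix _ t = _ ↔ _
    rw [WellFounded.fix_eq, dif_neg fun ⟨u, hu⟩ => ht.2 u hu, decide_eq_true_iff]

namespace IsValuation

variable {T : Set Literal} {W : Interp → Term → Bool}

theorem universal (hW : φ.IsValuation T W) {t : Term} (ht : t ∈ φ.terms) (hu : φ.IsUniversal t.head)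
    (J : Interp) : W J t = J t.head fun i => W J (t.arg i) := by
  rw [hW.bound J t ⟨true, t⟩ (bound_self ht hu)]
  simp

theorem bound' (hW : φ.IsValuation T W) {l u : Literal} (hb : φ.Bound l u) (J : Interp) :
    W J l.atom = l.pos ↔ W J u.atom = u.pos := by
  have key : ∀ t u, φ.Bound ⟨true, t⟩ u → W J t = (W J u.atom == u.pos) := by
    intro t u hb
    rw [hW.bound J t u hb, hW.universal hb.1.1 hb.1.2]
  obtain ⟨_ | _, t⟩ := l
  · rw [show (⟨false, t⟩ : Literal).atom = t from rfl, key t u.neg hb.neg]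
    simp only [Literal.neg]
    cases u.pos <;> cases W J u.atom <;> simp
  · rw [show (⟨true, t⟩ : Literal).atom = t from rfl, key t u hb]
    cases u.pos <;> cases W J u.atom <;> simp

theorem unbound' (hW : φ.IsValuation T W) (hT : φ.PartialAssignment T)
    (hc : ∀ l, φ.Unbound l → l ∈ T ∨ l.neg ∈ T) {l : Literal} (hl : φ.Unbound l) (J : Interp) :
    W J l.atom = l.pos ↔ l ∈ T := by
  obtain ⟨_ | _, t⟩ := l
  · have h1 := hW.unbound J t hl.neg
    have h2 := hc _ hl
    have h3 := hT.consistent ⟨false, t⟩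
    change W J t = false ↔ _
    change _ ∨ (⟨true, t⟩ : Literal) ∈ T at h2
    change _ → (⟨true, t⟩ : Literal) ∉ T at h3
    cases hw : W J t <;> simp_all
  · exact hW.unbound J t hl

/-- Values of existential propositions depend only on the universal variables of earlier blocks. -/
theorem local_prop (h : φ.BraidedUSK) (hg : φ.GraphCondition) (hW : φ.IsValuation T W) {j : ℕ}
    {g : FVar} (hj : φ.QuantAt j .all g) (J : Interp) (F) (a : Term) : ∀ i, a ∈ φ.terms →
      a.head.arity = 0 → φ.QuantAt i .ex a.head → φ.block i < φ.block j →
      W (Function.update J g F) a = W J a := by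
  induction a using (wellFounded_dep h hg).induction with
  | _ a ih =>
    intro i ha h0 hi hb
    have hij : i < j := by
      by_contra hlt
      exact absurd (block_mono (φ := φ) (not_lt.1 hlt)) (by omega)
    have hne : ∀ f, φ.Before f a.head → f ≠ g := by
      rintro _ ⟨k, i', q, q', hk, hi', hlt⟩ rfl
      have h1 := (quantAt_unique h.distinct hk hj).1
      have h2 := (quantAt_unique h.distinct hi' hi).1
      omega
    by_cases hex : ∃ u, φ.Bound ⟨true, a⟩ u
    · obtain ⟨u, hu⟩ := hex
      have hargs : ∀ b, b ∉ a.args := by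
        intro b hb
        rw [Term.args_eq] at hb
        obtain ⟨k, -⟩ := hb
        exact (Fin.cast h0 k).elim0
      -- A proposition has no arguments of its own. So proper dependency says that `u` is quantified
      -- before it, and that the arguments of `u` are earlier universal propositions or existential
      -- ones of no later block, to which the induction applies.
      obtain ⟨hbef, hd⟩ := ((graphCondition_iff.1 hg).2.2.1 u ⟨true, a⟩ hu.1.1 hu.2.symm hu.1.2
        ⟨i, hi⟩).resolve_left (hargs _)
      rw [hW.bound _ a u hu, hW.bound _ a u hu, Function.update_of_ne (hne _ hbef)]
      congr 2
      funext k
      have hk := h.mem_terms_of_mem_args hu.1.1 (u.atom.arg_mem k)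
      have hk0 := h.arity_arg hu.1.1 k
      rcases (hd _ (u.atom.arg_mem k)).resolve_left (hargs _) with ⟨hu', hbef'⟩ | ⟨⟨m, hm⟩, hbl⟩
      · rw [hW.universal hk hu', hW.universal hk hu', Function.update_of_ne (hne _ hbef')]
        exact Term.apply_eq_of_arity_zero hk0 _ _ _
      · refine ih _ (hu.dep_arg h k) m hk hk0 hm (lt_of_le_of_lt ?_ hb)
        rcases hbl with ⟨m', i', q, q', hm', hi', hlt⟩ | ⟨m', i', q, q', hm', hi', heq⟩
        · rw [(quantAt_unique h.distinct hm hm').1, (quantAt_unique h.distinct hi hi').1]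
          exact block_mono hlt.le
        · rw [(quantAt_unique h.distinct hm hm').1, (quantAt_unique h.distinct hi hi').1]
          exact heq.le
    · have hun : φ.Unbound ⟨true, a⟩ := ⟨ha, fun u hu => hex ⟨u, hu⟩⟩
      exact Bool.eq_iff_iff.2 ((hW.unbound _ a hun).trans (hW.unbound _ a hun).symm)

end IsValuation

open Classical in
/-- The universal variables are interpreted by `J`, the existential propositions by `W J`. -/
noncomputable def propInterp (φ : PrenexCNF) (W : Interp → Term → Bool) (J : Interp) : Interp :=
  fun f => if h : φ.IsExistential f ∧ ∃ t ∈ φ.terms, t.head = f then fun _ => W J h.2.choose else J f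

open Classical in
/-- The Skolem functions. -/
noncomputable def skolem (φ : PrenexCNF) (T : Set Literal) (W : Interp → Term → Bool) (J : Interp) :
    Interp := fun f =>
  if h : φ.IsExistential f ∧ ∃ a, .app f a ∈ φ.terms then
    if hu : ∃ u, φ.Bound ⟨true, .app f h.2.choose⟩ u then
      fun x => (Term.app f h.2.choose).transfer hu.choose.atom (φ.propInterp W J) x == hu.choose.pos
    else fun _ => decide (⟨true, .app f h.2.choose⟩ ∈ T)
  else J f

variable {T : Set Literal} {W : Interp → Term → Bool}

theorem propInterp_existential (h : φ.BraidedUSK) {t : Term} (ht : t ∈ φ.terms)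
    (he : φ.IsExistential t.head) (J : Interp) (x) : φ.propInterp W J t.head x = W J t := by
  have hex : φ.IsExistential t.head ∧ ∃ s ∈ φ.terms, s.head = t.head := ⟨he, t, ht, rfl⟩
  rw [propInterp, dif_pos hex]
  rw [h.unique _ hex.2.choose_spec.1 _ ht hex.2.choose_spec.2]

theorem propInterp_universal (h : φ.BraidedUSK) {f : FVar} (hu : φ.IsUniversal f) (J : Interp) :
    φ.propInterp W J f = J f := by
  rw [propInterp, dif_neg fun h' => not_universal_of_existential h.distinct h'.1 hu]

theorem propInterp_prop (h : φ.BraidedUSK) (hW : φ.IsValuation T W) {t : Term} (ht : t ∈ φ.terms)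
    (h0 : t.head.arity = 0) (J : Interp) (x) : φ.propInterp W J t.head x = W J t := by
  rcases h.universal_or_existential ht with hu | he
  · rw [propInterp_universal h hu, hW.universal ht hu]
    exact Term.apply_eq_of_arity_zero h0 _ _ _
  · exact propInterp_existential h ht he J x

theorem skolem_bound (h : φ.BraidedUSK) (hg : φ.GraphCondition) {f : FVar}
    {a : Fin f.arity → Term} (ht : .app f a ∈ φ.terms) (he : φ.IsExistential f) {u : Literal}
    (hb : φ.Bound ⟨true, .app f a⟩ u) (J : Interp) : φ.skolem T W J f =
      fun x => (Term.app f a).transfer u.atom (φ.propInterp W J) x == u.pos := by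
  have hex : φ.IsExistential f ∧ ∃ a, .app f a ∈ φ.terms := ⟨he, a, ht⟩
  have heq : hex.2.choose = a := by simpa using h.unique _ hex.2.choose_spec _ ht rfl
  rw [skolem, dif_pos hex]
  generalize hex.2.choose = b at heq
  subst heq
  have hu : ∃ u, φ.Bound ⟨true, .app f b⟩ u := ⟨u, hb⟩
  rw [dif_pos hu, hu.choose_spec.unique hg hb]
  rfl

open Classical in
theorem skolem_unbound (h : φ.BraidedUSK) {f : FVar} {a : Fin f.arity → Term}
    (ht : .app f a ∈ φ.terms) (he : φ.IsExistential f) (hun : φ.Unbound ⟨true, .app f a⟩)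
    (J : Interp) (x) : φ.skolem T W J f x = true ↔ ⟨true, .app f a⟩ ∈ T := by
  have hex : φ.IsExistential f ∧ ∃ a, .app f a ∈ φ.terms := ⟨he, a, ht⟩
  have heq : hex.2.choose = a := by simpa using h.unique _ hex.2.choose_spec _ ht rfl
  rw [skolem, dif_pos hex]
  generalize hex.2.choose = b at heq
  subst heq
  rw [dif_neg fun ⟨u, hu⟩ => hun.2 u hu]
  exact decide_eq_true_iff

/-- On the actual values of its arguments a Skolem function returns the intended value: it computes
the universal vertex of its component from arguments it sees and propositions that `propInterp`
supplies. Arguments are propositions, so applying the claim to them first suffices. -/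
theorem eval_skolem (h : φ.BraidedUSK) (hg : φ.GraphCondition) (hW : φ.IsValuation T W) (J : Interp)
    {t : Term} (ht : t ∈ φ.terms) : t.eval (φ.skolem T W J) = W J t := by
  have key : ∀ t ∈ φ.terms, (∀ i, (t.arg i).eval (φ.skolem T W J) = W J (t.arg i)) →
      t.eval (φ.skolem T W J) = W J t := by
    rintro ⟨f, a⟩ ht harg
    rcases h.universal_or_existential ht with hu | he
    · rw [Term.eval_eq, hW.universal ht hu, skolem, dif_neg fun h' =>
        not_universal_of_existential h.distinct h'.1 hu]
      exact congrArg _ (funext harg)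
    · by_cases hex : ∃ u, φ.Bound ⟨true, .app f a⟩ u
      · obtain ⟨u, hb⟩ := hex
        have htr := Term.transfer_eq (t := .app f a) (v := u.atom) (I := φ.propInterp W J)
          (W J) (x := fun i => (a i).eval (φ.skolem T W J)) harg (fun _ => by
            rw [propInterp_universal h hb.1.2, hW.universal hb.1.1 hb.1.2]) (fun i _ =>
            propInterp_prop h hW (h.mem_terms_of_mem_args hb.1.1 (Term.arg_mem _ i))
              (h.arity_arg hb.1.1 i) J _)
        refine (congrFun (skolem_bound h hg ht he hb J) _).trans ?_
        refine (congrArg (· == u.pos) htr).trans ?_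
        rw [hW.bound J _ u hb, hW.universal hb.1.1 hb.1.2]
      · have hun : φ.Unbound ⟨true, .app f a⟩ := ⟨ht, fun u hu => hex ⟨u, hu⟩⟩
        exact Bool.eq_iff_iff.2 ((skolem_unbound h ht he hun J _).trans (hW.unbound J _ hun).symm)
  refine key t ht fun i => key _ (h.mem_terms_of_mem_args ht (t.arg_mem i)) fun j => ?_
  exact (Fin.cast (h.arity_arg ht i) j).elim0

theorem isTrue_of_graphCondition (h : φ.BraidedUSK) (hg : φ.GraphCondition) : φ.IsTrue := by
  obtain ⟨T, hT, hcompl, hforced⟩ := exists_assignment hg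
  obtain ⟨W, hW⟩ := exists_valuation h hg T
  refine isTrue_of_skolem h.distinct (φ.skolem T W) (fun J f hf => ?_) ?_ fun J => ?_
  · rw [skolem, dif_neg fun h' => hf h'.1]
  · intro i j f g hi hj hij J F
    have hfg : f ≠ g := by
      rintro rfl
      have := (quantAt_unique h.distinct hi hj).1
      omega
    unfold skolem
    split_ifs with hex hu
    · have hb := hu.choose_spec
      have hd := (graphCondition_iff.1 hg).2.2.1 _ _ hb.1.1 hb.2.symm hb.1.2 hex.1
      have hne : ∀ f', φ.Before f' f → f' ≠ g := by
        rintro _ ⟨k, i', q, q', hk, hi', hlt⟩ rfl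
        have h1 := (quantAt_unique h.distinct hk hj).1
        have h2 := (quantAt_unique h.distinct hi' hi).1
        omega
      funext x
      rw [Term.transfer_congr (I' := φ.propInterp W J)]
      · intro hnot
        rw [propInterp_universal h hb.1.2, propInterp_universal h hb.1.2,
          Function.update_of_ne (hne _ (hd.resolve_left hnot).1)]
      · intro hnot k hk
        have hmem := h.mem_terms_of_mem_args hb.1.1 (hu.choose.atom.arg_mem k)
        rcases ((hd.resolve_left hnot).2 _ (hu.choose.atom.arg_mem k)).resolve_left hk with
          ⟨hu', hbef⟩ | ⟨he, hbl⟩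
        · rw [propInterp_universal h hu', propInterp_universal h hu',
            Function.update_of_ne (hne _ hbef)]
        · funext y
          rw [propInterp_existential h hmem he, propInterp_existential h hmem he]
          obtain ⟨m, hm⟩ := he
          -- The existential proposition lies in a block not after that of `f`, and this block is
          -- earlier than the one of the changed universal variable.
          refine hW.local_prop h hg hj J F _ m hmem (h.arity_arg hb.1.1 k) hm
            (lt_of_le_of_lt ?_ (block_lt hi hj hij.le (by decide)))
          rcases hbl with ⟨m', i', q, q', hm', hi', hlt⟩ | ⟨m', i', q, q', hm', hi', heq⟩
          · rw [(quantAt_unique h.distinct hm hm').1, (quantAt_unique h.distinct hi hi').1]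
            exact block_mono hlt.le
          · rw [(quantAt_unique h.distinct hm hm').1, (quantAt_unique h.distinct hi hi').1]
            exact heq.le
    · rfl
    · exact Function.update_of_ne hfg _ _
  -- An edge between bound vertices stays within the control of one universal vertex, by the first
  -- condition. From a bound to an unbound vertex the target is forced to be true. From an unbound
  -- to a bound vertex contraposition forces the source to be false. Between unbound vertices the
  -- assignment is closed.
  · refine clausesHold_of_edges h.flatKrom fun l l' he hl => ?_
    obtain ⟨hv, hv'⟩ := he.mem_vertices
    rw [Literal.Holds, eval_skolem h hg hW J hv] at hl
    rw [Literal.Holds, eval_skolem h hg hW J hv']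
    have hp : φ.Path l l' := .single he
    by_cases hb : ∃ u, φ.Bound l u
    · obtain ⟨u, hu⟩ := hb
      by_cases hb' : ∃ u, φ.Bound l' u
      · obtain ⟨u', hu'⟩ := hb'
        obtain rfl : u = u' := by
          by_contra hne
          exact hg.noUniversalPath u hu.1.1 u' hu'.1.1 hu.1.2 hu'.1.2 hne
            ((hu.2.2.trans hp).trans hu'.2.1)
        exact (hW.bound' hu' J).2 ((hW.bound' hu J).1 hl)
      · have hun : φ.Unbound l' := ⟨hv', fun u hu => hb' ⟨u, hu⟩⟩
        exact (hW.unbound' hT hcompl hun J).2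
          (hforced l' u (bound_self hu.1.1 hu.1.2) (hu.2.2.trans hp) hun)
    · have hun : φ.Unbound l := ⟨hv, fun u hu => hb ⟨u, hu⟩⟩
      have hlT := (hW.unbound' hT hcompl hun J).1 hl
      by_cases hb' : ∃ u, φ.Bound l' u
      · obtain ⟨u', hu'⟩ := hb'
        have h1 : φ.Path u'.neg l.neg := Path.neg (ReflTransGen.trans hp hu'.2.1)
        exact absurd (hforced _ _ (bound_self hu'.neg.1.1 hu'.neg.1.2) h1 hun.neg)
          (hT.consistent l hlT)
      · have hun' : φ.Unbound l' := ⟨hv', fun u hu => hb' ⟨u, hu⟩⟩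
        exact (hW.unbound' hT hcompl hun' J).2 (hT.closed l hlT l' hp hun')

theorem BraidedUSK.isTrue_iff (h : φ.BraidedUSK) : φ.IsTrue ↔ φ.GraphCondition :=
  ⟨h.graphCondition_of_isTrue, isTrue_of_graphCondition h⟩

end PrenexCNF

end SO2

theorem mainTheorem2 :
    NLSpace.InNL SO2.truthBraidedUSK ∧
    ∀ φ : SO2.PrenexCNF, φ.BraidedUSK → (φ.IsTrue ↔ φ.GraphCondition) :=
  ⟨SO2.inNL_truthBraidedUSK fun _ h => h.isTrue_iff, fun _ h => h.isTrue_iff⟩
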